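/- **Model.** Link types are $t\in\{\mathrm L,\mathrm N\}$ (LOS/NLOS). A link of length $r$ is LOS with probability $p_{\mathrm L}(r)$ and NLOS with probability $p_{\mathrm N}(r)=1-p_{\mathrm L}(r)$, independently of all other links ($p_{\mathrm L}$ is a measurable function with values in $[0,1]$); a link of type $t$ and length $r$ has path loss $C_t r^{-\alpha_t}$, with $C_t>0$, $\alpha_t>0$. Primary base stations (BSs), primary users and secondary BSs form independent homogeneous Poisson point processes (PPPs) in $\mathbb R^2$ with intensities $\lambda_{\mathrm{PT}},\lambda_{\mathrm{PR}},\lambda_{\mathrm{ST}}>0$. Every primary BS transmits with power $P_{\mathrm P}>0$. The home user of a secondary BS is the primary user to which it has the largest average received power $C_tr^{-\alpha_t}$; let $R$ and $T$ be the length and the type of the link to the home user. Secondary BS $i$ transmits with power $\xi\,\overline P_i$, where $\overline P_i=R_i^{\alpha_{T_i}}/C_{T_i}$ and $\xi>0$ is the interference threshold; the pairs $(R_i,T_i)$ are assumed independent over $i$ and independent of the positions of the BSs and of their links to the typical secondary user, each with the law of $(R,T)$, and $\overline P$ denotes a variable with their common law $R^{\alpha_T}/C_T$. All fading variables are independent,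 exponential with mean $1$. A BS of operator $\mathrm O\in\{\mathrm P,\mathrm S\}$ (primary, secondary) has antenna gain $G_{\mathrm O,1}>0$ in directions at angle $|\theta|\le\theta_{\mathrm{Ob}}/2$ from its beam and $G_{\mathrm O,2}\ge0$ otherwise ($0<\theta_{\mathrm{Ob}}\le2\pi$); the angles between the beams of interfering BSs and the typical user are independent and uniform on $[-\pi,\pi]$. The typical secondary user is at the origin. Its tagged BS $\mathbf y_0$ is the secondary BS with the largest average received power $\xi\overline P_i C_{t_i}\|\mathbf y_i\|^{-\alpha_{t_i}}$, where $t_i$ is the type of the link from the secondary BS $\mathbf y_i$ to the user. With fading $h_i,g_j$, beam angles $\omega_i,\theta_j$, link types $s_j$ of the primary BSs $\mathbf x_j$, and noise power $\sigma^2\ge0$, $$\mathrm{SINR}=\frac{\xi\overline P_0\,G_{\mathrm S,1}h_0C_{t_0}\|\mathbf y_0\|^{-\alpha_{t_0}}}{\sigma^2+\sum_{j}P_{\mathrm P}G_{\mathrm P}(\theta_j)g_jC_{s_j}\|\mathbf x_j\|^{-\alpha_{s_j}}+\sum_{i\ne0}\xi\overline P_iG_{\mathrm S}(\omega_i)h_iC_{t_i}\|\mathbf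 y_i\|^{-\alpha_{t_i}}}.$$ **Theorem.** Almost surely the tagged BS exists and is unique, and for every $\tau>0$ the coverage probability $\mathrm P^{\mathrm c}_{\mathrm S}(\tau)=\mathbb P[\mathrm{SINR}>\tau]$ is $$\mathrm P^{\mathrm c}_{\mathrm S}(\tau)=\sum_{t_0\in\{\mathrm L,\mathrm N\}}\int_0^\infty2\pi\lambda_{\mathrm{ST}}\exp\Big[-\lambda_{\mathrm{PT}}\sum_{k=1}^2b_kF_{\mathrm P}\Big(\frac{\tau u^{\alpha_{t_0}}G_{\mathrm P,k}}{\xi G_{\mathrm S,1}}\Big)-\lambda_{\mathrm{ST}}\sum_{k=1}^2a_kF_{\mathrm S}\Big(\frac{\tau u^{\alpha_{t_0}}G_{\mathrm S,k}}{G_{\mathrm S,1}},u^{\alpha_{t_0}}\Big)-\frac{\tau u^{\alpha_{t_0}}}{\xi G_{\mathrm S,1}}\sigma^2$$ $$\qquad-2\pi\lambda_{\mathrm{ST}}\int_0^{u^{\alpha_{t_0}/\alpha_{\mathrm L}}}K_{\mathrm L}(z)\,z\,dz-2\pi\lambda_{\mathrm{ST}}\int_0^{u^{\alpha_{t_0}/\alpha_{\mathrm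 N}}}K_{\mathrm N}(z)\,z\,dz\Big]K_{t_0}(u)\,u\,du,$$ where $a_1=\theta_{\mathrm{Sb}}/2\pi$, $a_2=1-a_1$, $b_1=\theta_{\mathrm{Pb}}/2\pi$, $b_2=1-b_1$, $$K_t(u)=\mathbb E\big[p_t(u\overline P^{1/\alpha_t}C_t^{1/\alpha_t})\,\overline P^{2/\alpha_t}\big]C_t^{2/\alpha_t},\qquad M_t(u)=p_t(uP_{\mathrm P}^{1/\alpha_t}C_t^{1/\alpha_t})\,P_{\mathrm P}^{2/\alpha_t}C_t^{2/\alpha_t},$$ $$F_{\mathrm S}(B,e)=2\pi\sum_{t}\int_{e^{1/\alpha_t}}^\infty\frac{K_t(v)}{1+B^{-1}v^{\alpha_t}}v\,dv,\qquad F_{\mathrm P}(B)=2\pi\sum_t\int_0^\infty\frac{M_t(v)}{1+B^{-1}v^{\alpha_t}}v\,dv .$$ All integrals are of nonnegative functions and take values in $[0,\infty]$, with $e^{-\infty}=0$, $0\cdot\infty=0$ and $0^{-1}=\infty$; the two interference sums likewise take values in $[0,\infty]$, and $\mathrm{SINR}=0$ if one of them is infinite. -/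

import Mathlib

open MeasureTheory ProbabilityTheory Set
open scoped ENNReal

noncomputable section

/-- Type of a radio link: line-of-sight or non-line-of-sight. -/
inductive LinkType where
  | LOS : LinkType
  | NLOS : LinkType
deriving DecidableEq

instance LinkType.instFintype : Fintype LinkType :=
  ⟨{LinkType.LOS, LinkType.NLOS}, fun t => by cases t <;> simp⟩

instance LinkType.instMeasurableSpace : MeasurableSpace LinkType := ⊤

/-- The plane in which base stations (BSs) and users are located. -/
abbrev Plane := EuclideanSpace ℝ (Fin 2)

/-! ### Deterministic parameters -/

/-- Sectored antenna pattern: main-lobe gain, side-lobe gain, half-power beamwidth. -/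
structure Antenna where
  main : ℝ
  side : ℝ
  beamwidth : ℝ
  main_pos : 0 < main
  side_nonneg : 0 ≤ side
  beamwidth_pos : 0 < beamwidth
  beamwidth_le : beamwidth ≤ 2 * Real.pi

/-- The gains `G₁` (index `0`, main lobe) and `G₂` (index `1`, side lobe). -/
def Antenna.lobe (A : Antenna) : Fin 2 → ℝ := ![A.main, A.side]

/-- Gain in a direction at angle `θ ∈ [-π, π]` from the beam. -/
def Antenna.gain (A : Antenna) (θ : ℝ) : ℝ :=
  if |θ| ≤ A.beamwidth / 2 then A.main else A.side

/-- The weights `θ_b / 2π` (main lobe) and `1 - θ_b / 2π` (side lobe). -/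
def Antenna.weight (A : Antenna) : Fin 2 → ℝ :=
  ![A.beamwidth / (2 * Real.pi), 1 - A.beamwidth / (2 * Real.pi)]

/-- Parameters of the two-operator network. -/
structure NetParams where
  /-- intensity of the primary BSs -/
  lamPT : ℝ
  /-- intensity of the primary users -/
  lamPR : ℝ
  /-- intensity of the secondary BSs -/
  lamST : ℝ
  /-- probability that a link of length `r` is LOS -/
  pLOS : ℝ → ℝ
  /-- near-field gains -/
  C : LinkType → ℝ
  /-- path-loss exponents -/
  α : LinkType → ℝ
  /-- transmit power of the primary BSs -/
  powerP : ℝ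
  /-- interference threshold at primary users -/
  xi : ℝ
  /-- noise power at the secondary user -/
  noise : ℝ
  /-- antennas of the primary BSs -/
  antP : Antenna
  /-- antennas of the secondary BSs -/
  antS : Antenna
  lamPT_pos : 0 < lamPT
  lamPR_pos : 0 < lamPR
  lamST_pos : 0 < lamST
  pLOS_measurable : Measurable pLOS
  pLOS_nonneg : ∀ r, 0 ≤ r → 0 ≤ pLOS r
  pLOS_le_one : ∀ r, 0 ≤ r → pLOS r ≤ 1
  C_pos : ∀ t, 0 < C t
  α_pos : ∀ t, 0 < α t
  powerP_pos : 0 < powerP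
  xi_pos : 0 < xi
  noise_nonneg : 0 ≤ noise

namespace NetParams

variable (q : NetParams)

/-- `p_t(r)`: probability that a link of length `r` has type `t`. -/
def p : LinkType → ℝ → ℝ
  | LinkType.LOS, r => q.pLOS r
  | LinkType.NLOS, r => 1 - q.pLOS r

/-- Path loss `ℓ_t(r) = C_t r^{-α_t}`. -/
def pathLoss (t : LinkType) (r : ℝ) : ℝ := q.C t * r ^ (-q.α t)

/-- Type of a link of length `r`, decided by a number `b` uniform on `[0,1]`:
it is LOS with probability `p_L(r)`. -/
def linkType (r b : ℝ) : LinkType :=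
  if b ≤ q.pLOS r then LinkType.LOS else LinkType.NLOS

/-- Normalized transmit power `r^{α_T} / C_T` of a secondary BS whose home primary user
is at distance `r` through a link of type `T`. -/
def normPower (r : ℝ) (T : LinkType) : ℝ := r ^ q.α T / q.C T

end NetParams

/-! ### Poisson point processes with independent marks -/

/-- Number of points of the random sequence `X` in `B`. -/
def pointCount {Ω : Type*} (X : ℕ → Ω → Plane) (B : Set Plane) (ω : Ω) : ℕ∞ :=
  {i : ℕ | X i ω ∈ B}.encard

/-- `X` enumerates a homogeneous Poisson point process on the plane of intensity `lam > 0`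
(it has infinitely many points almost surely, hence the index set `ℕ`). -/
structure IsPPP {Ω : Type*} [MeasurableSpace Ω] (P : Measure Ω) (lam : ℝ)
    (X : ℕ → Ω → Plane) : Prop where
  measurable : ∀ i, Measurable (X i)
  poisson : ∀ B : Set Plane, MeasurableSet B → volume B ≠ ∞ → ∀ k : ℕ,
    P {ω | pointCount X B ω = (k : ℕ∞)} =
      poissonMeasure (lam * (volume B).toReal).toNNReal {k}
  indep : ∀ B : ℕ → Set Plane, (∀ j, MeasurableSet (B j)) → Pairwise (Function.onFun Disjoint B) →
    iIndepFun (fun j => pointCount X (B j)) P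

/-- `X` is a Poisson point process whose points carry i.i.d. marks of law `κ`,
independent of the points. -/
structure IsMarkedPPP {Ω M : Type*} [MeasurableSpace Ω] [MeasurableSpace M]
    (P : Measure Ω) (lam : ℝ) (κ : Measure M) (X : ℕ → Ω → Plane) (m : ℕ → Ω → M) :
    Prop where
  ppp : IsPPP P lam X
  mark_law : ∀ i, HasLaw (m i) κ P
  mark_indep : iIndepFun m P
  point_mark_indep : IndepFun (fun ω i => X i ω) (fun ω i => m i ω) P

/-- Uniform law on `[0,1]` (drives the LOS/NLOS state of a link). -/
def unitLaw : Measure ℝ := ProbabilityTheory.cond volume (Icc (0 : ℝ) 1)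

/-- Uniform law on `[-π, π]` (angle between the beam of an interferer and the user). -/
def angleLaw : Measure ℝ := ProbabilityTheory.cond volume (Icc (-Real.pi) Real.pi)

/-- Law of normalized Rayleigh fading: exponential with mean `1`. -/
def fadingLaw : Measure ℝ := expMeasure 1

/-! ### The random network seen by the typical secondary user at the origin -/

/-- The random network.

* `user` and `userBlock` are the primary users and the blocking variables of their links to
  a secondary BS located at the origin; `homeDist`, `homeType` are the distance and the link type
  of its home user, the primary user to which it has the largest average received power.
* `bsS` are the secondary BSs. BS `i` has a link to the typical secondary user with blocking
  variable `blockS i`, fading `fadS i` and, when it interferes, angle `angS i`. Its own home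
  distance and link type are `R i`, `T i`: these pairs are independent over `i`, each one with
  the law of the home link of a secondary BS.
* `bsP` are the primary BSs, with the analogous variables for their links to the typical
  secondary user. -/
structure Network (q : NetParams) {Ω : Type*} [MeasurableSpace Ω] (P : Measure Ω) where
  user : ℕ → Ω → Plane
  userBlock : ℕ → Ω → ℝ
  homeDist : Ω → ℝ
  homeType : Ω → LinkType
  bsS : ℕ → Ω → Plane
  blockS : ℕ → Ω → ℝ
  fadS : ℕ → Ω → ℝ
  angS : ℕ → Ω → ℝ
  R : ℕ → Ω → ℝ
  T : ℕ → Ω → LinkType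
  bsP : ℕ → Ω → Plane
  blockP : ℕ → Ω → ℝ
  fadP : ℕ → Ω → ℝ
  angP : ℕ → Ω → ℝ
  users_law : IsMarkedPPP P q.lamPR unitLaw user userBlock
  home_measurable : Measurable (fun ω => (homeDist ω, homeType ω))
  /-- `homeDist`, `homeType` belong to a primary user of largest average received power. -/
  home_spec : ∀ᵐ ω ∂P, ∃ j : ℕ,
    (∀ k : ℕ, q.pathLoss (q.linkType ‖user k ω‖ (userBlock k ω)) ‖user k ω‖ ≤
      q.pathLoss (q.linkType ‖user j ω‖ (userBlock j ω)) ‖user j ω‖) ∧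
    homeDist ω = ‖user j ω‖ ∧ homeType ω = q.linkType ‖user j ω‖ (userBlock j ω)
  secondary_law : IsMarkedPPP P q.lamST
    (unitLaw.prod (fadingLaw.prod (angleLaw.prod
      (P.map (fun ω => (homeDist ω, homeType ω))))))
    bsS (fun i ω => (blockS i ω, fadS i ω, angS i ω, R i ω, T i ω))
  primary_law : IsMarkedPPP P q.lamPT (unitLaw.prod (fadingLaw.prod angleLaw))
    bsP (fun i ω => (blockP i ω, fadP i ω, angP i ω))
  /-- The secondary and the primary network (points and marks) are independent. -/
  networks_indep : IndepFun
    (fun ω i => (bsS i ω, blockS i ω, fadS i ω, angS i ω, R i ω, T i ω))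
    (fun ω i => (bsP i ω, blockP i ω, fadP i ω, angP i ω)) P

namespace Network

variable {q : NetParams} {Ω : Type*} [MeasurableSpace Ω] {P : Measure Ω} (N : Network q P)

/-- Type of the link from secondary BS `i` to the typical secondary user. -/
def typeS (i : ℕ) (ω : Ω) : LinkType := q.linkType ‖N.bsS i ω‖ (N.blockS i ω)

/-- Type of the link from primary BS `i` to the typical secondary user. -/
def typeP (i : ℕ) (ω : Ω) : LinkType := q.linkType ‖N.bsP i ω‖ (N.blockP i ω)

/-- Transmit power `ξ R_i^{α_{T_i}} / C_{T_i}` of secondary BS `i`. -/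
def powerS (i : ℕ) (ω : Ω) : ℝ := q.xi * q.normPower (N.R i ω) (N.T i ω)

/-- Power received from secondary BS `i`, averaged over fading (without antenna gain). -/
def avgPowerS (i : ℕ) (ω : Ω) : ℝ := N.powerS i ω * q.pathLoss (N.typeS i ω) ‖N.bsS i ω‖

/-- Secondary BS `i` is the tagged BS: it has the maximum average received power. -/
def IsTagged (i : ℕ) (ω : Ω) : Prop := ∀ j : ℕ, N.avgPowerS j ω ≤ N.avgPowerS i ω

/-- Interference from all primary BSs. -/
def interfP (ω : Ω) : ℝ≥0∞ :=
  ∑' j : ℕ, ENNReal.ofReal (q.powerP * q.antP.gain (N.angP j ω) * N.fadP j ω *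
    q.pathLoss (N.typeP j ω) ‖N.bsP j ω‖)

/-- Interference from all secondary BSs other than BS `i`. -/
def interfS (i : ℕ) (ω : Ω) : ℝ≥0∞ :=
  ∑' j : ℕ, if j = i then 0 else
    ENNReal.ofReal (N.powerS j ω * q.antS.gain (N.angS j ω) * N.fadS j ω *
      q.pathLoss (N.typeS j ω) ‖N.bsS j ω‖)

/-- SINR of the typical secondary user when it is served by secondary BS `i`, whose beam
points at the user; values in `[0, ∞]`. -/
def sinr (i : ℕ) (ω : Ω) : ℝ≥0∞ :=
  ENNReal.ofReal (N.powerS i ω * q.antS.main * N.fadS i ω *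
      q.pathLoss (N.typeS i ω) ‖N.bsS i ω‖) /
    (ENNReal.ofReal q.noise + N.interfP ω + N.interfS i ω)

/-- SINR coverage probability of the typical secondary user: the probability that the SINR from
the tagged BS exceeds `τ`. -/
def coverage (τ : ℝ) : ℝ≥0∞ :=
  P {ω | ∃ i : ℕ, N.IsTagged i ω ∧ ENNReal.ofReal τ < N.sinr i ω}

/-- `K_t(u) = E[p_t(u P̄^{1/α_t} C_t^{1/α_t}) P̄^{2/α_t}] C_t^{2/α_t}`, where `P̄` is the normalized
transmit power of a secondary BS. -/
def K (t : LinkType) (u : ℝ) : ℝ≥0∞ :=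
  (∫⁻ ω, ENNReal.ofReal
      (q.p t (u * q.normPower (N.homeDist ω) (N.homeType ω) ^ (1 / q.α t) * q.C t ^ (1 / q.α t)) *
        q.normPower (N.homeDist ω) (N.homeType ω) ^ (2 / q.α t)) ∂P) *
    ENNReal.ofReal (q.C t ^ (2 / q.α t))

/-- `F_S(B, e) = 2π ∑_t ∫_{e^{1/α_t}}^∞ K_t(v) / (1 + B⁻¹ v^{α_t}) v dv`. -/
def FS (B e : ℝ) : ℝ≥0∞ :=
  ENNReal.ofReal (2 * Real.pi) * ∑ t : LinkType, ∫⁻ v in Ioi (e ^ (1 / q.α t)),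
    N.K t v / (1 + (ENNReal.ofReal B)⁻¹ * ENNReal.ofReal (v ^ q.α t)) * ENNReal.ofReal v

end Network

namespace NetParams

variable (q : NetParams)

/-- `M_t(u) = p_t(u P_P^{1/α_t} C_t^{1/α_t}) P_P^{2/α_t} C_t^{2/α_t}`. -/
def M (t : LinkType) (u : ℝ) : ℝ≥0∞ :=
  ENNReal.ofReal (q.p t (u * q.powerP ^ (1 / q.α t) * q.C t ^ (1 / q.α t)) *
    q.powerP ^ (2 / q.α t) * q.C t ^ (2 / q.α t))

/-- `F_P(B) = 2π ∑_t ∫_0^∞ M_t(v) / (1 + B⁻¹ v^{α_t}) v dv`. -/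
def FP (B : ℝ) : ℝ≥0∞ :=
  ENNReal.ofReal (2 * Real.pi) * ∑ t : LinkType, ∫⁻ v in Ioi (0 : ℝ),
    q.M t v / (1 + (ENNReal.ofReal B)⁻¹ * ENNReal.ofReal (v ^ q.α t)) * ENNReal.ofReal v

end NetParams

/-- `exp(-x)` for `x ∈ [0, ∞]`, with `exp(-∞) = 0`. -/
def expNeg (x : ℝ≥0∞) : ℝ≥0∞ := EReal.exp (-(x : EReal))

end

open Filter Topology

/-! ### The function `exp(-x)` on `[0, ∞]` -/

/-! The average power received from a secondary BS is ξ divided by its level r^α/(C·P̄), so the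
tagged BS is the point of smallest level. Together with their marks the secondary BSs form a Poisson
process on the product of the plane and the mark space. Polar coordinates and the substitution r =
(P̄ C_t)^{1/α_t} u show that, for links of type t, the level is u^{α_t} with u of intensity 2πλ
K_t(u) u du. Bounded sets of levels have finite mass and no level is an atom, hence a smallest level
exists and is unique, and the coverage probability is the sum over i of the probabilities that BS i
has the smallest level and covers the user.

Given everything else, the fading of BS i is exponential, so its probability of covering is the
exponential of minus a multiple of noise plus interference. "No other BS has a smaller level" takes
the same form if a point of smaller level is given the exponent ∞. Each summand is thus the mean of
a function of the level of BS i times an exponential of a sum over the other points. Mecke's formula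
replaces the sum over i by an integral over one independent point, and the remaining mean is the
Laplace functional of the whole process. In its exponent, points below the level contribute 1 -
e^{-∞} = 1, which gives the integrals of K_L and K_N; points above it, averaged over fading and
gain, give F_S. The independent primary network contributes its own Laplace transform, which gives
F_P.

The Laplace functional is computed from the counts in `IsPPP.laplace` and extended to marks in
`IsMarkedPPP.poissonLaplace`. Its difference quotients give `PoissonLaplace.campbell`, and from
there `PoissonLaplace.mecke` and the distinctness statement `PoissonLaplace.ae_ne`. Finiteness of
the mass of bounded levels rests on `Network.lintegral_homePower_rpow_lt_top`. The model enters
through `Network.lintegral_intensityS` and `Network.lintegral_exponentS`, and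
`Network.coverage_eq_lintegral` assembles the pieces. -/

@[simp] lemma expNeg_zero : expNeg 0 = 1 := by simp [expNeg]

@[simp] lemma expNeg_top : expNeg ∞ = 0 := by simp [expNeg]

lemma expNeg_ofReal {x : ℝ} (hx : 0 ≤ x) :
    expNeg (ENNReal.ofReal x) = ENNReal.ofReal (Real.exp (-x)) := by
  rw [expNeg, EReal.coe_ennreal_ofReal, max_eq_left hx, ← EReal.coe_neg, EReal.exp_coe]

lemma expNeg_antitone : Antitone expNeg := fun x y h => by
  unfold expNeg
  exact EReal.exp_monotone (EReal.neg_le_neg_iff.2 (by exact_mod_cast h))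

lemma expNeg_le_one (x : ℝ≥0∞) : expNeg x ≤ 1 := by
  simpa using expNeg_antitone (zero_le : 0 ≤ x)

lemma expNeg_ne_top (x : ℝ≥0∞) : expNeg x ≠ ∞ :=
  ((expNeg_le_one x).trans_lt ENNReal.one_lt_top).ne

lemma expNeg_add (x y : ℝ≥0∞) : expNeg (x + y) = expNeg x * expNeg y := by
  unfold expNeg
  rw [← EReal.exp_add, EReal.coe_ennreal_add, EReal.neg_add, sub_eq_add_neg]
  · left; exact EReal.coe_ennreal_ne_bot _
  · right; exact EReal.coe_ennreal_ne_bot _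

lemma expNeg_continuous : Continuous expNeg := by
  unfold expNeg
  exact ENNReal.continuous_exp.comp (continuous_neg.comp continuous_coe_ennreal_ereal)

lemma expNeg_measurable : Measurable expNeg := expNeg_continuous.measurable

@[fun_prop]
lemma Measurable.expNeg {α : Type*} [MeasurableSpace α] {f : α → ℝ≥0∞} (hf : Measurable f) :
    Measurable (fun x => expNeg (f x)) := expNeg_measurable.comp hf

lemma expNeg_sum {ι : Type*} (s : Finset ι) (f : ι → ℝ≥0∞) :
    expNeg (∑ i ∈ s, f i) = ∏ i ∈ s, expNeg (f i) := by
  classical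
  induction s using Finset.induction_on with
  | empty => simp
  | insert a s ha ih => rw [Finset.sum_insert ha, Finset.prod_insert ha, expNeg_add, ih]

lemma expNeg_mul_natCast (c : ℝ≥0∞) (n : ℕ) : expNeg (c * n) = expNeg c ^ n := by
  have := expNeg_sum (Finset.range n) (fun _ => c)
  simpa [mul_comm] using this

lemma expNeg_pos {x : ℝ≥0∞} (hx : x ≠ ∞) : 0 < expNeg x := by
  rw [← ENNReal.ofReal_toReal hx, expNeg_ofReal ENNReal.toReal_nonneg]
  exact ENNReal.ofReal_pos.2 (Real.exp_pos _)

/-- `-log` on `[0, 1]`. -/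
noncomputable def negLog (g : ℝ≥0∞) : ℝ≥0∞ := (-(ENNReal.log g)).toENNReal

lemma expNeg_negLog {g : ℝ≥0∞} (hg : g ≤ 1) : expNeg (negLog g) = g := by
  unfold expNeg negLog
  rw [EReal.coe_toENNReal, neg_neg, ENNReal.exp_log]
  rw [EReal.le_neg, neg_zero, ← ENNReal.log_one]
  · exact ENNReal.log_monotone hg

lemma negLog_measurable : Measurable negLog := by
  unfold negLog
  exact (continuous_neg.measurable.comp ENNReal.measurable_log).ereal_toENNReal

lemma tendsto_expNeg_tsum (v : ℕ → ℝ≥0∞) :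
    Tendsto (fun n => ∏ i ∈ Finset.range n, expNeg (v i)) atTop (𝓝 (expNeg (∑' i, v i))) := by
  simp_rw [← expNeg_sum]
  exact (expNeg_continuous.tendsto _).comp ENNReal.summable.hasSum.tendsto_sum_nat

/-- Dominated convergence for functions with values in `[0, 1]`. -/
lemma tendsto_lintegral_of_le_one {α : Type*} [MeasurableSpace α] {Q : Measure α}
    [IsFiniteMeasure Q] {F : ℕ → α → ℝ≥0∞} {f : α → ℝ≥0∞} (hF : ∀ n, Measurable (F n))
    (h1 : ∀ n a, F n a ≤ 1) (h : ∀ a, Tendsto (fun n => F n a) atTop (𝓝 (f a))) :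
    Tendsto (fun n => ∫⁻ a, F n a ∂Q) atTop (𝓝 (∫⁻ a, f a ∂Q)) := by
  refine tendsto_lintegral_of_dominated_convergence (fun _ => 1) hF
    (fun n => Eventually.of_forall (h1 n)) ?_ (Eventually.of_forall h)
  simp

/-- The difference quotients `n (1 - exp(-x/n))` increase to `x`. -/
noncomputable def expQuot (n : ℕ) (x : ℝ≥0∞) : ℝ≥0∞ := (n + 1) * (1 - expNeg (x / (n + 1)))

lemma expQuot_mono_right (n : ℕ) : Monotone (expQuot n) := fun x y h => by
  unfold expQuot
  gcongr
  exact expNeg_antitone (ENNReal.div_le_div_right h _)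

lemma expQuot_ofReal (n : ℕ) {x : ℝ} (hx : 0 ≤ x) :
    expQuot n (ENNReal.ofReal x) =
      ENNReal.ofReal ((n + 1) * (1 - Real.exp (-(x / (n + 1))))) := by
  have h : (0 : ℝ) < n + 1 := by positivity
  have h2 : ((n : ℝ≥0∞) + 1) = ENNReal.ofReal ((n : ℝ) + 1) := by
    rw [ENNReal.ofReal_add (by positivity) zero_le_one]; simp
  rw [expQuot, h2, ← ENNReal.ofReal_div_of_pos h, expNeg_ofReal (by positivity),
    ← ENNReal.ofReal_one, ← ENNReal.ofReal_sub _ (by positivity), ← ENNReal.ofReal_mul h.le]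

lemma expQuot_top (n : ℕ) : expQuot n ∞ = n + 1 := by
  unfold expQuot
  rw [ENNReal.top_div_of_ne_top (by finiteness)]
  simp

/-- Convexity of the exponential: -x/t is the mean of -x/s and 0 with weights s/t and 1 - s/t. -/
lemma monotone_expQuot_real (x : ℝ) {s t : ℝ} (hs : 0 < s) (hst : s ≤ t) :
    s * (1 - Real.exp (-(x / s))) ≤ t * (1 - Real.exp (-(x / t))) := by
  have ht : 0 < t := hs.trans_le hst
  have hconv := convexOn_exp.2 (Set.mem_univ (-(x / s))) (Set.mem_univ (0 : ℝ))
    (show 0 ≤ s / t by positivity) (show 0 ≤ 1 - s / t by rw [sub_nonneg, div_le_one ht]; exact hst)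
    (by ring)
  simp only [smul_eq_mul, Real.exp_zero, mul_zero, add_zero, mul_one] at hconv
  rw [show s / t * -(x / s) = -(x / t) by field_simp] at hconv
  have := mul_le_mul_of_nonneg_left hconv ht.le
  have e : t * (s / t * Real.exp (-(x / s)) + (1 - s / t)) =
    s * Real.exp (-(x / s)) + (t - s) := by field_simp
  rw [e] at this
  linarith

lemma expQuot_mono_left (x : ℝ≥0∞) : Monotone (fun n => expQuot n x) := by
  intro m n h
  dsimp only
  by_cases hx : x = ∞
  · subst hx
    rw [expQuot_top, expQuot_top]
    gcongr
  · rw [← ENNReal.ofReal_toReal hx, expQuot_ofReal _ ENNReal.toReal_nonneg,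
      expQuot_ofReal _ ENNReal.toReal_nonneg]
    apply ENNReal.ofReal_le_ofReal
    exact monotone_expQuot_real _ (by positivity) (by gcongr)

lemma expQuot_le (n : ℕ) (x : ℝ≥0∞) : expQuot n x ≤ x := by
  by_cases hx : x = ∞
  · simp [hx]
  · rw [← ENNReal.ofReal_toReal hx, expQuot_ofReal _ ENNReal.toReal_nonneg]
    apply ENNReal.ofReal_le_ofReal
    have h : (0 : ℝ) < n + 1 := by positivity
    have := Real.add_one_le_exp (-(x.toReal / (n + 1)))
    have h3 : (n + 1) * (1 - Real.exp (-(x.toReal / (n + 1)))) ≤ (n + 1) * (x.toReal / (n + 1)) := by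
      gcongr; linarith
    rwa [mul_div_cancel₀ _ h.ne'] at h3

lemma tendsto_expQuot (x : ℝ≥0∞) : Tendsto (fun n => expQuot n x) atTop (𝓝 x) := by
  by_cases hx : x = ∞
  · subst hx
    simp_rw [expQuot_top]
    have := ENNReal.tendsto_nat_nhds_top
    refine tendsto_nhds_top_mono this (Eventually.of_forall fun n => ?_)
    exact le_self_add
  · rw [← ENNReal.ofReal_toReal hx]
    simp_rw [expQuot_ofReal _ ENNReal.toReal_nonneg]
    apply ENNReal.tendsto_ofReal
    set y := x.toReal
    have hy : 0 ≤ y := ENNReal.toReal_nonneg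
    -- The quotient lies between this sequence and y, by e^{-r} ≤ 1/(1+r) and 1 - r ≤ e^{-r} with r
    -- = y/(n+1).
    have hl : Tendsto (fun n : ℕ => y / (1 + y * (1 / ((n : ℝ) + 1)))) atTop (𝓝 y) := by
      have h0 := tendsto_one_div_add_atTop_nhds_zero_nat (𝕜 := ℝ)
      have := (tendsto_const_nhds (x := y) (f := atTop (α := ℕ))).div ((h0.const_mul y).const_add 1) (by simp)
      simpa [Pi.div_def] using this
    refine tendsto_of_tendsto_of_tendsto_of_le_of_le hl tendsto_const_nhds (fun n => ?_) (fun n => ?_)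
    · have h : (0 : ℝ) < n + 1 := by positivity
      have h1 := Real.add_one_le_exp (y / (n + 1))
      have h2 : Real.exp (-(y / (n + 1))) ≤ 1 / (y / (n + 1) + 1) := by
        rw [Real.exp_neg, ← one_div]
        exact one_div_le_one_div_of_le (by positivity) h1
      have h3 : (n + 1) * (1 - 1 / (y / (n + 1) + 1)) ≤ (n + 1) * (1 - Real.exp (-(y / (n + 1)))) := by
        gcongr
      refine le_trans (le_of_eq ?_) h3
      field_simp
      ring
    · have h : (0 : ℝ) < n + 1 := by positivity
      have := Real.add_one_le_exp (-(y / (n + 1)))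
      have h3 : (n + 1) * (1 - Real.exp (-(y / (n + 1)))) ≤ (n + 1) * (y / (n + 1)) := by
        gcongr; linarith
      rwa [mul_div_cancel₀ _ h.ne'] at h3

lemma iSup_expQuot (x : ℝ≥0∞) : ⨆ n, expQuot n x = x :=
  tendsto_nhds_unique (tendsto_atTop_iSup (expQuot_mono_left x)) (tendsto_expQuot x)

/-- Monotonicity in both arguments lets the diagonal supremum replace the iterated one. In
Campbell's formula the index of the quotient and its argument grow together. -/
lemma iSup_expQuot_diag {x : ℕ → ℝ≥0∞} (hx : Monotone x) :
    ⨆ n, expQuot n (x n) = ⨆ n, x n := by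
  apply le_antisymm
  · exact iSup_mono fun n => expQuot_le n _
  · refine iSup_le fun m => ?_
    rw [← iSup_expQuot (x m)]
    refine iSup_le fun n => ?_
    refine le_trans ?_ (le_iSup _ (max m n))
    exact (expQuot_mono_left _ (le_max_right m n)).trans
      (expQuot_mono_right _ (hx (le_max_left m n)))

@[fun_prop]
lemma expQuot_measurable (n : ℕ) : Measurable (expQuot n) := by
  unfold expQuot; fun_prop

/-! ### Laplace functionals of Poisson processes -/

/-- A random sequence of law `Q` has the Laplace functional of a Poisson process of
intensity measure `μ`. -/
def PoissonLaplace {E : Type*} [MeasurableSpace E] (Q : Measure (ℕ → E)) (μ : Measure E) : Prop :=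
  ∀ v : E → ℝ≥0∞, Measurable v →
    ∫⁻ z, expNeg (∑' i, v (z i)) ∂Q = expNeg (∫⁻ w, (1 - expNeg (v w)) ∂μ)

section PPP

variable {Ω : Type*} [MeasurableSpace Ω] {P : Measure Ω} {lam : ℝ} {X : ℕ → Ω → Plane}

lemma pointCount_toENNReal {Ω : Type*} (X : ℕ → Ω → Plane) (B : Set Plane) (ω : Ω) :
    ((pointCount X B ω : ℕ∞) : ℝ≥0∞) = ∑' i, B.indicator 1 (X i ω) := by
  rw [pointCount, ← ENNReal.tsum_set_one, tsum_subtype {i | X i ω ∈ B} (fun _ => (1 : ℝ≥0∞))]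
  rfl

lemma measurable_pointCount (hX : ∀ i, Measurable (X i)) {B : Set Plane} (hB : MeasurableSet B) :
    Measurable (pointCount X B) := by
  have hm : Measurable fun ω => ∑' i, B.indicator (1 : Plane → ℝ≥0∞) (X i ω) :=
    Measurable.tsum fun i => (measurable_one.indicator hB).comp (hX i)
  refine measurable_to_countable' fun k => ?_
  have : pointCount X B ⁻¹' {k} =
      (fun ω => ∑' i, B.indicator (1 : Plane → ℝ≥0∞) (X i ω)) ⁻¹' {((k : ℕ∞) : ℝ≥0∞)} := by
    ext ω
    simp only [mem_preimage, mem_singleton_iff, ← pointCount_toENNReal]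
    exact ENat.toENNReal_inj.symm
  rw [this]
  exact hm (measurableSet_singleton _)

/-- The generating function of the Poisson law at y = e^{-c}: the exponential series at m y. -/
lemma tsum_poisson_mul_pow (m : NNReal) (c : ℝ≥0∞) :
    ∑' k : ℕ, poissonMeasure m {k} * expNeg (c * k) = expNeg (m * (1 - expNeg c)) := by
  obtain ⟨y, hy⟩ : ∃ y : NNReal, expNeg c = y := ⟨_, (ENNReal.coe_toNNReal (expNeg_ne_top c)).symm⟩
  have hy1 : (y : ℝ) ≤ 1 := by
    have := expNeg_le_one c
    rw [hy] at this
    exact_mod_cast this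
  have hs : HasSum (fun k : ℕ => Real.exp (-m) * ((m * y : ℝ) ^ k / (k.factorial : ℝ)))
      (Real.exp (-m) * Real.exp (m * y)) := by
    have := (NormedSpace.expSeries_div_hasSum_exp (m * y : ℝ)).mul_left (Real.exp (-(m : ℝ)))
    rwa [← Real.exp_eq_exp_ℝ] at this
  have e1 : ∀ k : ℕ, poissonMeasure m {k} * expNeg (c * k) =
      ENNReal.ofReal (Real.exp (-m) * ((m * y : ℝ) ^ k / (k.factorial : ℝ))) := fun k => by
    rw [poissonMeasure_singleton, expNeg_mul_natCast, hy, ← ENNReal.ofReal_coe_nnreal,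
      ← ENNReal.ofReal_pow y.coe_nonneg, ← ENNReal.ofReal_mul (by positivity)]
    congr 1
    rw [mul_pow]; ring
  simp_rw [e1]
  rw [← ENNReal.ofReal_tsum_of_nonneg (fun k => by positivity) hs.summable, hs.tsum_eq, hy,
    ← ENNReal.ofReal_coe_nnreal, ← ENNReal.ofReal_coe_nnreal, ← ENNReal.ofReal_one,
    ← ENNReal.ofReal_sub _ y.coe_nonneg, ← ENNReal.ofReal_mul m.coe_nonneg, expNeg_ofReal, ← Real.exp_add]
  · congr 2; ring
  · exact mul_nonneg m.coe_nonneg (by linarith)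

lemma IsPPP.lintegral_pointCount [IsProbabilityMeasure P] (h : IsPPP P lam X) {B : Set Plane}
    (hB : MeasurableSet B) (hB' : volume B ≠ ∞) (c : ℝ≥0∞) :
    ∫⁻ ω, expNeg (c * ((pointCount X B ω : ℕ∞) : ℝ≥0∞)) ∂P =
      expNeg (ENNReal.ofReal lam * volume B * (1 - expNeg c)) := by
  have hm := measurable_pointCount h.measurable hB
  set m : NNReal := (lam * (volume B).toReal).toNNReal with hmdef
  have hk : ∀ k : ℕ, MeasurableSet {ω | pointCount X B ω = (k : ℕ∞)} := fun k =>
    hm (measurableSet_singleton _)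
  have hdisj : Pairwise (Function.onFun Disjoint fun k : ℕ => {ω | pointCount X B ω = (k : ℕ∞)}) := by
    intro i j hij
    refine Set.disjoint_left.2 fun ω hi hj => hij ?_
    simp only [mem_ofPred_eq] at hi hj
    exact_mod_cast hi.symm.trans hj
  -- The Poisson masses of the natural numbers add up to 1, so the count is almost surely finite.
  have hU : P (⋃ k : ℕ, {ω | pointCount X B ω = (k : ℕ∞)}) = 1 := by
    rw [measure_iUnion hdisj hk]
    simp_rw [h.poisson B hB hB']
    rw [← measure_iUnion (fun i j hij => Set.disjoint_singleton.2 hij)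
      (fun _ => measurableSet_singleton _), Set.iUnion_of_singleton, measure_univ]
  have hae : ∀ᵐ ω ∂P, expNeg (c * ((pointCount X B ω : ℕ∞) : ℝ≥0∞)) =
      ∑' k : ℕ, {ω | pointCount X B ω = (k : ℕ∞)}.indicator (fun _ => expNeg (c * k)) ω := by
    have hmem : ∀ᵐ ω ∂P, ω ∈ ⋃ k : ℕ, {ω | pointCount X B ω = (k : ℕ∞)} :=
      (prob_compl_eq_zero_iff (MeasurableSet.iUnion hk)).2 hU
    filter_upwards [hmem] with ω hω
    obtain ⟨k, hk⟩ := mem_iUnion.1 hω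
    simp only [mem_ofPred_eq] at hk
    rw [tsum_eq_single k]
    · simp [hk]
    · intro j hj
      refine indicator_of_notMem ?_ _
      simp only [mem_ofPred_eq, hk]
      exact_mod_cast hj.symm
  rw [lintegral_congr_ae hae, lintegral_tsum fun k => (measurable_const.indicator (hk k)).aemeasurable]
  have e : ENNReal.ofReal lam * volume B = m := by
    rw [hmdef]
    change _ = ENNReal.ofReal _
    rw [ENNReal.ofReal_mul' ENNReal.toReal_nonneg, ENNReal.ofReal_toReal hB']
  rw [e, ← tsum_poisson_mul_pow]
  congr 1 with k
  rw [lintegral_indicator_const (hk k), h.poisson B hB hB', mul_comm]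

/-- The level sets of φ inside D are disjoint sets of finite area, so their counts are independent
Poisson variables and the expectation factors over the values of φ. -/
lemma IsPPP.lintegral_simpleFunc [IsProbabilityMeasure P] (h : IsPPP P lam X)
    (φ : SimpleFunc Plane ℝ≥0∞) {D : Set Plane} (hD : MeasurableSet D) (hD' : volume D ≠ ∞) :
    ∫⁻ ω, expNeg (∑' i, D.indicator φ (X i ω)) ∂P =
      expNeg (ENNReal.ofReal lam * ∫⁻ x, (1 - expNeg (D.indicator φ x))) := by
  -- The independence hypothesis concerns sequences of sets, so the finitely many values of φ are
  -- numbered injectively.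
  obtain ⟨code, hcode⟩ := Set.countable_iff_exists_injOn.1 φ.range.countable_toSet
  set B : ℕ → Set Plane := fun j => D ∩ {x | code (φ x) = j} with hBdef
  have hB : ∀ j, MeasurableSet (B j) := fun j =>
    hD.inter ((φ.map code).measurableSet_fiber j)
  have hB' : ∀ j, volume (B j) ≠ ∞ := fun j => measure_ne_top_of_subset inter_subset_left hD'
  have hdisj : Pairwise (Function.onFun Disjoint B) := by
    intro i j hij
    exact Set.disjoint_left.2 fun x hi hj => hij (hi.2.symm.trans hj.2)
  -- Used twice: with H the identity for the sum over the points, and with H c = 1 - e^{-c} for the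
  -- integral on the right-hand side.
  have key : ∀ (H : ℝ≥0∞ → ℝ≥0∞), H 0 = 0 → ∀ x,
      H (D.indicator φ x) = ∑ c ∈ φ.range, H c * (B (code c)).indicator 1 x := by
    intro H H0 x
    by_cases hx : x ∈ D
    · rw [indicator_of_mem hx, Finset.sum_eq_single (φ x)]
      · rw [indicator_of_mem (show x ∈ B (code (φ x)) from ⟨hx, rfl⟩)]; simp
      · intro c hc hcx
        rw [indicator_of_notMem, mul_zero]
        rintro ⟨_, h2⟩
        exact hcx (hcode hc (φ.mem_range_self x) h2.symm)
      · intro h; exact absurd (φ.mem_range_self x) h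
    · rw [indicator_of_notMem hx, H0]
      refine (Finset.sum_eq_zero fun c _ => ?_).symm
      rw [indicator_of_notMem (fun h => hx h.1), mul_zero]
  have e1 : ∀ ω, expNeg (∑' i, D.indicator φ (X i ω)) =
      ∏ c : φ.range, expNeg (c * ((pointCount X (B (code c)) ω : ℕ∞) : ℝ≥0∞)) := by
    intro ω
    rw [Finset.prod_coe_sort φ.range
      (fun c => expNeg (c * ((pointCount X (B (code c)) ω : ℕ∞) : ℝ≥0∞))), ← expNeg_sum]
    congr 1
    simp_rw [pointCount_toENNReal, ← ENNReal.tsum_mul_left]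
    rw [← Summable.tsum_finsetSum fun _ _ => ENNReal.summable]
    exact tsum_congr fun i => key id rfl _
  simp_rw [e1]
  have hind : iIndepFun (fun (c : φ.range) ω => expNeg (c * ((pointCount X (B (code c)) ω : ℕ∞) : ℝ≥0∞))) P := by
    have := (h.indep B hB hdisj).precomp (g := fun c : φ.range => code c)
      (fun a b hab => Subtype.ext (hcode a.2 b.2 hab))
    exact this.comp (fun c n => expNeg (c * ((n : ℕ∞) : ℝ≥0∞))) fun c => measurable_from_top
  rw [lintegral_prod_eq_prod_lintegral_of_indepFun Finset.univ _ hind]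
  · have e2 : ∀ c : φ.range, ∫⁻ ω, expNeg (c * ((pointCount X (B (code c)) ω : ℕ∞) : ℝ≥0∞)) ∂P =
        expNeg (ENNReal.ofReal lam * volume (B (code c)) * (1 - expNeg c)) := fun c =>
      h.lintegral_pointCount (hB _) (hB' _) _
    simp_rw [e2]
    rw [← expNeg_sum]
    congr 1
    rw [Finset.sum_coe_sort φ.range (fun c => ENNReal.ofReal lam * volume (B (code c)) * (1 - expNeg c))]
    simp_rw [key (fun c => 1 - expNeg c) (by simp)]
    rw [lintegral_finsetSum _ fun c _ => (measurable_one.indicator (hB _)).const_mul _, Finset.mul_sum]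
    refine Finset.sum_congr rfl fun c _ => ?_
    rw [lintegral_const_mul _ (measurable_one.indicator (hB _)), lintegral_indicator_one (hB _)]
    ring
  · intro c
    exact (measurable_from_top (f := fun n : ℕ∞ => expNeg (c * (n : ℝ≥0∞)))).comp
      (measurable_pointCount h.measurable (hB _))

/-- Monotone convergence for the counting measure. -/
lemma tendsto_tsum_of_monotone {f : ℕ → ℕ → ℝ≥0∞} {g : ℕ → ℝ≥0∞} (hf : ∀ i, Monotone fun n => f n i)
    (h : ∀ i, Tendsto (fun n => f n i) atTop (𝓝 (g i))) :
    Tendsto (fun n => ∑' i, f n i) atTop (𝓝 (∑' i, g i)) := by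
  simp_rw [← lintegral_count]
  exact lintegral_tendsto_of_tendsto_of_monotone (fun n => measurable_from_top.aemeasurable)
    (Eventually.of_forall hf) (Eventually.of_forall h)

/-- The Laplace functional of a Poisson point process. -/
lemma IsPPP.laplace [IsProbabilityMeasure P] (h : IsPPP P lam X) {v : Plane → ℝ≥0∞}
    (hv : Measurable v) :
    ∫⁻ ω, expNeg (∑' i, v (X i ω)) ∂P =
      expNeg (ENNReal.ofReal lam * ∫⁻ x, (1 - expNeg (v x))) := by
  -- Simple functions increasing to v, cut off to growing balls so that the counts involved have
  -- finite mean.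
  set w : ℕ → Plane → ℝ≥0∞ := fun n =>
    (Metric.ball (0 : Plane) n).indicator (SimpleFunc.eapprox v n) with hw
  have hwm : ∀ n, Measurable (w n) := fun n =>
    (SimpleFunc.measurable _).indicator Metric.isOpen_ball.measurableSet
  have hmono : ∀ x, Monotone fun n => w n x := by
    intro x m n hmn
    refine (indicator_le_indicator_of_subset (Metric.ball_subset_ball (Nat.cast_le.2 hmn))
      (fun _ => by simp) x).trans ?_
    exact indicator_le_indicator (SimpleFunc.monotone_eapprox v hmn x)
  have hlim : ∀ x, Tendsto (fun n => w n x) atTop (𝓝 (v x)) := by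
    intro x
    have h1 : Tendsto (fun n => SimpleFunc.eapprox v n x) atTop (𝓝 (v x)) := by
      rw [← SimpleFunc.iSup_eapprox_apply hv]
      exact tendsto_atTop_iSup fun m n hmn => SimpleFunc.monotone_eapprox v hmn x
    obtain ⟨k, hk⟩ := exists_nat_gt ‖x‖
    refine h1.congr' ?_
    filter_upwards [eventually_ge_atTop k] with n hn
    rw [hw]
    simp only
    rw [indicator_of_mem]
    rw [mem_ball_zero_iff]
    exact hk.trans_le (by exact_mod_cast hn)
  have hstep : ∀ n, ∫⁻ ω, expNeg (∑' i, w n (X i ω)) ∂P =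
      expNeg (ENNReal.ofReal lam * ∫⁻ x, (1 - expNeg (w n x))) := fun n =>
    h.lintegral_simpleFunc _ Metric.isOpen_ball.measurableSet measure_ball_lt_top.ne
  have hL : Tendsto (fun n => ∫⁻ ω, expNeg (∑' i, w n (X i ω)) ∂P) atTop
      (𝓝 (∫⁻ ω, expNeg (∑' i, v (X i ω)) ∂P)) := by
    refine tendsto_lintegral_of_le_one (fun n => ?_) (fun n ω => expNeg_le_one _) fun ω => ?_
    · exact (Measurable.tsum fun i => (hwm n).comp (h.measurable i)).expNeg
    · exact (expNeg_continuous.tendsto _).comp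
        (tendsto_tsum_of_monotone (fun i => hmono _) fun i => hlim _)
  have hR : Tendsto (fun n => expNeg (ENNReal.ofReal lam * ∫⁻ x, (1 - expNeg (w n x)))) atTop
      (𝓝 (expNeg (ENNReal.ofReal lam * ∫⁻ x, (1 - expNeg (v x))))) := by
    refine (expNeg_continuous.tendsto _).comp (ENNReal.Tendsto.const_mul ?_ (Or.inr (by finiteness)))
    refine lintegral_tendsto_of_tendsto_of_monotone (fun n => ?_) (Eventually.of_forall fun x => ?_)
      (Eventually.of_forall fun x => ?_)
    · have := hwm n
      fun_prop
    · exact fun m n hmn => tsub_le_tsub_left (expNeg_antitone (hmono x hmn)) _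
    · exact ENNReal.Tendsto.sub tendsto_const_nhds ((expNeg_continuous.tendsto _).comp (hlim x))
        (Or.inl (by simp))
  simp_rw [hstep] at hL
  exact tendsto_nhds_unique hL hR

end PPP

/-! ### Campbell's and Mecke's formulas from the Laplace functional -/

section Campbell

variable {E : Type*} [MeasurableSpace E] {Q : Measure (ℕ → E)} {μ : Measure E}

/-- The quotient of e^{-a} and e^{-(a+x/(n+1))}, with the subtracted term moved to the other side to
avoid truncated subtraction. -/
lemma expNeg_mul_expQuot (n : ℕ) (a x : ℝ≥0∞) :
    expNeg a * expQuot n x + (n + 1) * expNeg (a + x / (n + 1)) = (n + 1) * expNeg a := by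
  rw [expQuot, expNeg_add, mul_left_comm, ← mul_add, ← mul_add,
    tsub_add_cancel_of_le (expNeg_le_one _), mul_one]

/-- Campbell's formula, weighted with the exponential of a sum over the process. -/
lemma PoissonLaplace.campbell [IsProbabilityMeasure Q] (hQ : PoissonLaplace Q μ)
    {f v : E → ℝ≥0∞} (hf : Measurable f) (hv : Measurable v) :
    ∫⁻ z, (∑' i, f (z i)) * expNeg (∑' i, v (z i)) ∂Q =
      (∫⁻ w, f w * expNeg (v w) ∂μ) * expNeg (∫⁻ w, (1 - expNeg (v w)) ∂μ) := by
  set V := ∫⁻ w, (1 - expNeg (v w)) ∂μ with hV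
  have hS : Measurable fun z : ℕ → E => ∑' i, f (z i) :=
    Measurable.tsum fun i => hf.comp (measurable_pi_apply i)
  have hT : Measurable fun z : ℕ → E => ∑' i, v (z i) :=
    Measurable.tsum fun i => hv.comp (measurable_pi_apply i)
  set D : ℕ → ℝ≥0∞ := fun n => ∫⁻ w, expNeg (v w) * expQuot n (f w) ∂μ with hD
  have hDmono : Monotone D := fun m n hmn => by
    refine lintegral_mono fun w => ?_
    dsimp only
    gcongr
    exact expQuot_mono_left _ hmn
  have hDsup : ⨆ n, D n = ∫⁻ w, f w * expNeg (v w) ∂μ := by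
    rw [← lintegral_iSup (fun n => by fun_prop)]
    · refine lintegral_congr fun w => ?_
      rw [← ENNReal.mul_iSup, iSup_expQuot, mul_comm]
    · intro m n hmn w
      dsimp only
      gcongr
      exact expQuot_mono_left _ hmn
  -- The Laplace functional is evaluated at v and at v + f/(n+1). The scaled difference of the two
  -- values is again a difference quotient, with base exponent V and increment D n. Since the
  -- quotients are monotone in n, the derivative is a supremum and no integrability of f is needed.
  have step : ∀ n : ℕ, ∫⁻ z, expNeg (∑' i, v (z i)) * expQuot n (∑' i, f (z i)) ∂Q =
      expNeg V * expQuot n (D n) := by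
    intro n
    have h1 : ∫⁻ z, expNeg (∑' i, v (z i)) * expQuot n (∑' i, f (z i)) ∂Q +
        (n + 1) * ∫⁻ z, expNeg (∑' i, (v (z i) + f (z i) / (n + 1))) ∂Q =
        (n + 1) * ∫⁻ z, expNeg (∑' i, v (z i)) ∂Q := by
      rw [← lintegral_const_mul _ (by fun_prop), ← lintegral_const_mul _ (by fun_prop),
        ← lintegral_add_left (by fun_prop)]
      refine lintegral_congr fun z => ?_
      refine Eq.trans ?_ (expNeg_mul_expQuot n _ (∑' i, f (z i)))
      rw [ENNReal.tsum_add]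
      simp_rw [div_eq_mul_inv]
      rw [ENNReal.tsum_mul_right]
    rw [hQ v hv, hQ (fun w => v w + f w / (n + 1)) (by fun_prop)] at h1
    have h2 : ∫⁻ w, (1 - expNeg (v w + f w / (n + 1))) ∂μ = V + D n / (n + 1) := by
      rw [hV, hD, div_eq_mul_inv, ← lintegral_mul_const _ (by fun_prop),
        ← lintegral_add_left (by fun_prop)]
      refine lintegral_congr fun w => ?_
      have hne : ((n : ℝ≥0∞) + 1) ≠ 0 := by simp
      have hnt : ((n : ℝ≥0∞) + 1) ≠ ∞ := by finiteness
      rw [expQuot, expNeg_add, mul_assoc (expNeg (v w)), mul_right_comm, ENNReal.mul_inv_cancel hne hnt,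
        one_mul, ENNReal.mul_sub (fun _ _ => expNeg_ne_top _), mul_one]
      refine (tsub_add_tsub_cancel (expNeg_le_one _) ?_).symm
      exact mul_le_of_le_one_right' (expNeg_le_one _)
    rw [h2] at h1
    have h3 := expNeg_mul_expQuot n V (D n)
    rw [← h1] at h3
    -- The term cancelled on both sides is finite, being a multiple of a value of `expNeg`.
    refine (ENNReal.add_left_inj ?_).1 h3.symm
    have := expNeg_ne_top (V + D n / (n + 1))
    finiteness
  have hlim : ⨆ n, ∫⁻ z, expNeg (∑' i, v (z i)) * expQuot n (∑' i, f (z i)) ∂Q =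
      ∫⁻ z, (∑' i, f (z i)) * expNeg (∑' i, v (z i)) ∂Q := by
    rw [← lintegral_iSup (fun n => by fun_prop)]
    · refine lintegral_congr fun z => ?_
      rw [← ENNReal.mul_iSup, iSup_expQuot, mul_comm]
    · intro m n hmn z
      dsimp only
      gcongr
      exact expQuot_mono_left _ hmn
  rw [← hlim]
  simp_rw [step]
  rw [← ENNReal.mul_iSup, iSup_expQuot_diag hDmono, hDsup, mul_comm]

lemma PoissonLaplace.mean [IsProbabilityMeasure Q] (hQ : PoissonLaplace Q μ)
    {f : E → ℝ≥0∞} (hf : Measurable f) :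
    ∫⁻ z, ∑' i, f (z i) ∂Q = ∫⁻ w, f w ∂μ := by
  simpa using hQ.campbell hf (v := fun _ => 0) measurable_const

/-- Sum over the points other than the `i`-th. -/
noncomputable def sumOthers (i : ℕ) (a : ℕ → ℝ≥0∞) : ℝ≥0∞ := ∑' j, if j = i then 0 else a j

lemma add_sumOthers (i : ℕ) (a : ℕ → ℝ≥0∞) : a i + sumOthers i a = ∑' j, a j := by
  rw [ENNReal.tsum_eq_add_tsum_ite i, sumOthers]
  congr 1
  exact tsum_congr fun j => by split_ifs <;> rfl

lemma sumOthers_add (i : ℕ) (a b : ℕ → ℝ≥0∞) :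
    sumOthers i (fun j => a j + b j) = sumOthers i a + sumOthers i b := by
  unfold sumOthers
  rw [← ENNReal.tsum_add]
  exact tsum_congr fun j => by split_ifs <;> simp

lemma mul_sumOthers (i : ℕ) (c : ℝ≥0∞) (a : ℕ → ℝ≥0∞) :
    sumOthers i (fun j => c * a j) = c * sumOthers i a := by
  unfold sumOthers
  rw [← ENNReal.tsum_mul_left]
  exact tsum_congr fun j => by split_ifs <;> simp

lemma measurable_sumOthers {α : Type*} [MeasurableSpace α] (i : ℕ) {a : ℕ → α → ℝ≥0∞}
    (ha : ∀ j, Measurable (a j)) : Measurable fun x => sumOthers i fun j => a j x := by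
  refine Measurable.tsum fun j => ?_
  split_ifs
  · exact measurable_const
  · exact ha j

/-- Mecke's formula for a weight that does not depend on the distinguished point. -/
lemma PoissonLaplace.mecke_const [IsProbabilityMeasure Q] (hQ : PoissonLaplace Q μ)
    {f v : E → ℝ≥0∞} (hf : Measurable f) (hv : Measurable v) (hfv : ∀ w, f w ≠ 0 → v w ≠ ∞) :
    ∫⁻ z, ∑' i, f (z i) * expNeg (sumOthers i fun j => v (z j)) ∂Q =
      (∫⁻ w, f w ∂μ) * expNeg (∫⁻ w, (1 - expNeg (v w)) ∂μ) := by
  -- The factor e^{-v} of the distinguished point completes the sum over the others to the full sum,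
  -- and f is divided by the same factor. Where f is nonzero, v is finite, so this division loses
  -- nothing.
  have hc : ∀ w, f w / expNeg (v w) * expNeg (v w) = f w := by
    intro w
    by_cases h : f w = 0
    · simp [h]
    · exact ENNReal.div_mul_cancel (expNeg_pos (hfv w h)).ne' (expNeg_ne_top _)
  have := hQ.campbell (f := fun w => f w / expNeg (v w)) (by fun_prop) hv
  simp_rw [hc] at this
  rw [← this]
  refine lintegral_congr fun z => ?_
  rw [← ENNReal.tsum_mul_right]
  refine tsum_congr fun i => ?_
  rw [← add_sumOthers i fun j => v (z j), expNeg_add, ← mul_assoc, hc]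

/-- Dyadic approximation from below. -/
noncomputable def dyadicFloor (n : ℕ) (x : ℝ) : ℝ := ⌊(2 : ℝ) ^ n * x⌋ / 2 ^ n

lemma dyadicFloor_le (n : ℕ) (x : ℝ) : dyadicFloor n x ≤ x := by
  rw [dyadicFloor, div_le_iff₀ (by positivity), mul_comm]
  exact Int.floor_le _

/-- This is 2⌊y⌋ ≤ ⌊2y⌋ with y = 2^n x. -/
lemma dyadicFloor_mono (x : ℝ) : Monotone fun n => dyadicFloor n x := by
  refine monotone_nat_of_le_succ fun n => ?_
  rw [dyadicFloor, dyadicFloor, pow_succ, div_le_div_iff₀ (by positivity) (by positivity)]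
  have h1 : (⌊(2 : ℝ) ^ n * x⌋ * 2 : ℤ) ≤ ⌊(2 : ℝ) ^ n * 2 * x⌋ := by
    rw [Int.le_floor]
    have := Int.floor_le ((2 : ℝ) ^ n * x)
    push_cast
    linarith
  have h2 : ((⌊(2 : ℝ) ^ n * x⌋ : ℝ) * 2) ≤ ⌊(2 : ℝ) ^ n * 2 * x⌋ := by exact_mod_cast h1
  have h3 : (0 : ℝ) < 2 ^ n := by positivity
  nlinarith

lemma tendsto_dyadicFloor (x : ℝ) : Tendsto (fun n => dyadicFloor n x) atTop (𝓝 x) := by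
  have h0 : Tendsto (fun n : ℕ => x - (1 / 2 : ℝ) ^ n) atTop (𝓝 x) := by
    simpa using (tendsto_pow_atTop_nhds_zero_of_lt_one (r := (1 / 2 : ℝ)) (by norm_num) (by norm_num)).const_sub x
  refine tendsto_of_tendsto_of_tendsto_of_le_of_le h0 tendsto_const_nhds (fun n => ?_)
    fun n => dyadicFloor_le n x
  have h3 : (0 : ℝ) < 2 ^ n := by positivity
  simp only [dyadicFloor]
  rw [le_div_iff₀ h3, sub_mul, div_pow, one_pow, one_div_mul_cancel h3.ne']
  have := Int.lt_floor_add_one ((2 : ℝ) ^ n * x)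
  linarith

lemma measurable_dyadicFloor (n : ℕ) : Measurable (dyadicFloor n) := by
  unfold dyadicFloor
  exact ((measurable_from_top (f := fun k : ℤ => (k : ℝ))).comp
    (Int.measurable_floor.comp (measurable_const_mul _))).div_const _

variable {s : E → ℝ} {v : ℝ → E → ℝ≥0∞} {f : E → ℝ≥0∞}

/-- The rounded level takes countably many values. On the slice where it equals k/2^n the weight no
longer depends on the distinguished point, so `mecke_const` applies to f restricted to that slice.
Rounding down keeps the rounded level below s, where v is finite. -/
lemma PoissonLaplace.mecke_dyadic [IsProbabilityMeasure Q] (hQ : PoissonLaplace Q μ)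
    (hs : Measurable s) (hf : Measurable f) (hv : Measurable (Function.uncurry v))
    (hfin : ∀ w, ∀ σ ≤ s w, v σ w ≠ ∞) (n : ℕ) :
    ∫⁻ z, ∑' i, f (z i) * expNeg (sumOthers i fun j => v (dyadicFloor n (s (z i))) (z j)) ∂Q =
      ∫⁻ w, f w * expNeg (∫⁻ w', (1 - expNeg (v (dyadicFloor n (s w)) w')) ∂μ) ∂μ := by
  have hσ : Measurable fun w => ⌊(2 : ℝ) ^ n * s w⌋ :=
    Int.measurable_floor.comp (hs.const_mul _)
  set A : ℤ → Set E := fun k => {w | ⌊(2 : ℝ) ^ n * s w⌋ = k} with hA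
  have hAm : ∀ k, MeasurableSet (A k) := fun k => hσ (measurableSet_singleton k)
  have hvk : ∀ r : ℝ, Measurable (v r) := fun r => hv.comp measurable_prodMk_left
  have split : ∀ (w : E) (G : ℝ → ℝ≥0∞), f w * G (dyadicFloor n (s w)) =
      ∑' k : ℤ, (A k).indicator f w * G (k / 2 ^ n) := by
    intro w G
    rw [tsum_eq_single ⌊(2 : ℝ) ^ n * s w⌋]
    · rw [indicator_of_mem (by rfl)]; rfl
    · intro k hk
      rw [indicator_of_notMem (fun h => hk h.symm), zero_mul]
  have e1 : ∀ z : ℕ → E, ∑' i, f (z i) * expNeg (sumOthers i fun j => v (dyadicFloor n (s (z i))) (z j)) =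
      ∑' k : ℤ, ∑' i, (A k).indicator f (z i) * expNeg (sumOthers i fun j => v (k / 2 ^ n) (z j)) := by
    intro z
    rw [ENNReal.tsum_comm]
    exact tsum_congr fun i => split _ fun r => expNeg (sumOthers i fun j => v r (z j))
  simp_rw [e1]
  rw [lintegral_tsum]
  · have e2 : ∀ w, f w * expNeg (∫⁻ w', (1 - expNeg (v (dyadicFloor n (s w)) w')) ∂μ) =
        ∑' k : ℤ, (A k).indicator f w * expNeg (∫⁻ w', (1 - expNeg (v (k / 2 ^ n) w')) ∂μ) := fun w =>
      split w fun r => expNeg (∫⁻ w', (1 - expNeg (v r w')) ∂μ)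
    simp_rw [e2]
    rw [lintegral_tsum fun k => ((hf.indicator (hAm k)).mul_const _).aemeasurable]
    refine tsum_congr fun k => ?_
    rw [hQ.mecke_const (hf.indicator (hAm k)) (hvk _), lintegral_mul_const _ (hf.indicator (hAm k))]
    intro w hw
    have hwA : w ∈ A k := by
      by_contra h; exact hw (indicator_of_notMem h _)
    refine hfin w _ ?_
    have := dyadicFloor_le n (s w)
    rwa [dyadicFloor, show ⌊(2 : ℝ) ^ n * s w⌋ = k from hwA] at this
  · intro k
    refine (Measurable.tsum fun i => ?_).aemeasurable
    refine ((hf.indicator (hAm k)).comp (measurable_pi_apply i)).mul (Measurable.expNeg ?_)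
    exact measurable_sumOthers i fun j => (hvk _).comp (measurable_pi_apply j)

lemma tendsto_sumOthers {a : ℕ → ℕ → ℝ≥0∞} {b : ℕ → ℝ≥0∞} (i : ℕ)
    (hm : ∀ j, Monotone fun n => a n j) (h : ∀ j, Tendsto (fun n => a n j) atTop (𝓝 (b j))) :
    Tendsto (fun n => sumOthers i (a n)) atTop (𝓝 (sumOthers i b)) := by
  refine tendsto_tsum_of_monotone (fun j => ?_) fun j => ?_
  · split_ifs
    · exact monotone_const
    · exact hm j
  · split_ifs
    · exact tendsto_const_nhds
    · exact h j

/-- Mecke's formula for a weight that depends on the distinguished point through a real level,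
in a monotone and left-continuous way. -/
lemma PoissonLaplace.mecke_of_lintegral_ne_top [IsProbabilityMeasure Q] [SFinite μ]
    (hQ : PoissonLaplace Q μ)
    (hs : Measurable s) (hf : Measurable f) (hv : Measurable (Function.uncurry v))
    (hfin : ∀ w, ∀ σ ≤ s w, v σ w ≠ ∞) (hmono : ∀ w, Monotone fun σ => v σ w)
    (hleft : ∀ w (σ : ℕ → ℝ) (r : ℝ), (∀ n, σ n ≤ r) → Tendsto σ atTop (𝓝 r) →
      Tendsto (fun n => v (σ n) w) atTop (𝓝 (v r w)))
    (hf' : ∫⁻ w, f w ∂μ ≠ ∞) :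
    ∫⁻ z, ∑' i, f (z i) * expNeg (sumOthers i fun j => v (s (z i)) (z j)) ∂Q =
      ∫⁻ w, f w * expNeg (∫⁻ w', (1 - expNeg (v (s w) w')) ∂μ) ∂μ := by
  have hd : ∀ n, Measurable fun w => dyadicFloor n (s w) := fun n => (measurable_dyadicFloor n).comp hs
  have hlim : ∀ w w', Tendsto (fun n => v (dyadicFloor n (s w)) w') atTop (𝓝 (v (s w) w')) :=
    fun w w' => hleft w' _ _ (fun n => dyadicFloor_le n _) (tendsto_dyadicFloor _)
  have hm : ∀ w w', Monotone fun n => v (dyadicFloor n (s w)) w' :=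
    fun w w' => (hmono w').comp (dyadicFloor_mono _)
  have hL : Tendsto (fun n => ∫⁻ z, ∑' i, f (z i) *
      expNeg (sumOthers i fun j => v (dyadicFloor n (s (z i))) (z j)) ∂Q) atTop
      (𝓝 (∫⁻ z, ∑' i, f (z i) * expNeg (sumOthers i fun j => v (s (z i)) (z j)) ∂Q)) := by
    -- The dominating sum is integrable because its mean is the integral of f. It is then almost
    -- surely finite, which permits a second dominated convergence, over the index i.
    refine tendsto_lintegral_of_dominated_convergence (fun z => ∑' i, f (z i)) (fun n => ?_)
      (fun n => Eventually.of_forall fun z => ?_) ?_ ?_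
    · refine Measurable.tsum fun i => ?_
      refine (hf.comp (measurable_pi_apply i)).mul (Measurable.expNeg ?_)
      exact measurable_sumOthers i fun j => hv.comp
        (((hd n).comp (measurable_pi_apply i)).prodMk (measurable_pi_apply j))
    · exact ENNReal.tsum_le_tsum fun i => mul_le_of_le_one_right' (expNeg_le_one _)
    · rwa [hQ.mean hf]
    · have hfin' : ∀ᵐ z ∂Q, ∑' i, f (z i) < ∞ := by
        refine ae_lt_top (Measurable.tsum fun i => hf.comp (measurable_pi_apply i)) ?_
        rwa [hQ.mean hf]
      filter_upwards [hfin'] with z hz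
      simp_rw [← lintegral_count]
      refine tendsto_lintegral_of_dominated_convergence (fun i => f (z i))
        (fun n => measurable_from_top) (fun n => Eventually.of_forall fun i => ?_)
        (by rw [lintegral_count]; exact hz.ne) (Eventually.of_forall fun i => ?_)
      · exact mul_le_of_le_one_right' (expNeg_le_one _)
      · refine ENNReal.Tendsto.const_mul ((expNeg_continuous.tendsto _).comp
          (tendsto_sumOthers i (fun j => hm _ _) fun j => hlim _ _)) (Or.inr ?_)
        exact ((ENNReal.le_tsum i).trans_lt hz).ne
  have hI : ∀ n, Measurable fun w => ∫⁻ w', (1 - expNeg (v (dyadicFloor n (s w)) w')) ∂μ := by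
    intro n
    refine Measurable.lintegral_prod_right' (f := fun p : E × E => 1 - expNeg (v (dyadicFloor n (s p.1)) p.2)) ?_
    exact (hv.comp (((hd n).comp measurable_fst).prodMk measurable_snd)).expNeg.const_sub _
  have hR : Tendsto (fun n => ∫⁻ w, f w * expNeg (∫⁻ w', (1 - expNeg (v (dyadicFloor n (s w)) w')) ∂μ) ∂μ)
      atTop (𝓝 (∫⁻ w, f w * expNeg (∫⁻ w', (1 - expNeg (v (s w) w')) ∂μ) ∂μ)) := by
    refine tendsto_lintegral_of_dominated_convergence f (fun n => hf.mul (hI n).expNeg)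
      (fun n => Eventually.of_forall fun w => mul_le_of_le_one_right' (expNeg_le_one _)) hf' ?_
    filter_upwards [ae_lt_top hf hf'] with w hw
    refine ENNReal.Tendsto.const_mul ((expNeg_continuous.tendsto _).comp ?_) (Or.inr hw.ne)
    refine lintegral_tendsto_of_tendsto_of_monotone (fun n => ?_) (Eventually.of_forall fun x => ?_)
      (Eventually.of_forall fun x => ?_)
    · exact ((hv.comp measurable_prodMk_left).expNeg.const_sub _).aemeasurable
    · exact fun m n hmn => tsub_le_tsub_left (expNeg_antitone (hm w x hmn)) _
    · exact ENNReal.Tendsto.sub tendsto_const_nhds ((expNeg_continuous.tendsto _).comp (hlim w x))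
        (Or.inl (by simp))
  simp_rw [hQ.mecke_dyadic hs hf hv hfin] at hL
  exact tendsto_nhds_unique hL hR

end Campbell

/-! ### Mecke's formula on a locally finite process; finiteness and distinctness of levels -/

section Mecke

variable {E : Type*} [MeasurableSpace E] {Q : Measure (ℕ → E)} {μ : Measure E}
  {s : E → ℝ} {v : ℝ → E → ℝ≥0∞} {f : E → ℝ≥0∞}

/-- Since f ≤ 1 and {s ≤ n} has finite measure, f restricted to {s ≤ n} is integrable. Monotone
convergence in n then removes the restriction. -/
lemma PoissonLaplace.mecke [IsProbabilityMeasure Q] [SFinite μ]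
    (hQ : PoissonLaplace Q μ)
    (hs : Measurable s) (hf : Measurable f) (hv : Measurable (Function.uncurry v))
    (hfin : ∀ w, ∀ σ ≤ s w, v σ w ≠ ∞) (hmono : ∀ w, Monotone fun σ => v σ w)
    (hleft : ∀ w (σ : ℕ → ℝ) (r : ℝ), (∀ n, σ n ≤ r) → Tendsto σ atTop (𝓝 r) →
      Tendsto (fun n => v (σ n) w) atTop (𝓝 (v r w)))
    (hf1 : ∀ w, f w ≤ 1) (hμ : ∀ n : ℕ, μ {w | s w ≤ n} ≠ ∞) :
    ∫⁻ z, ∑' i, f (z i) * expNeg (sumOthers i fun j => v (s (z i)) (z j)) ∂Q =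
      ∫⁻ w, f w * expNeg (∫⁻ w', (1 - expNeg (v (s w) w')) ∂μ) ∂μ := by
  have hA : ∀ n : ℕ, MeasurableSet {w | s w ≤ n} := fun n => measurableSet_le hs measurable_const
  set g : ℕ → E → ℝ≥0∞ := fun n => {w | s w ≤ n}.indicator f with hg
  have hgm : ∀ n, Measurable (g n) := fun n => hf.indicator (hA n)
  have hgfin : ∀ n, ∫⁻ w, g n w ∂μ ≠ ∞ := fun n => by
    rw [hg, lintegral_indicator (hA n)]
    refine ne_top_of_le_ne_top (hμ n) ?_
    calc ∫⁻ w in {w | s w ≤ n}, f w ∂μ ≤ ∫⁻ w in {w | s w ≤ n}, 1 ∂μ := lintegral_mono hf1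
      _ = _ := by simp
  have hgmono : ∀ w, Monotone fun n => g n w := fun w m n hmn =>
    indicator_le_indicator_of_subset (fun w (hw : s w ≤ m) => hw.trans (Nat.cast_le.2 hmn))
      (fun _ => by simp) w
  have hglim : ∀ w, Tendsto (fun n => g n w) atTop (𝓝 (f w)) := by
    intro w
    obtain ⟨k, hk⟩ := exists_nat_ge (s w)
    refine tendsto_const_nhds.congr' ?_
    filter_upwards [eventually_ge_atTop k] with n hn
    exact (indicator_of_mem (s := {w | s w ≤ n}) (hk.trans (Nat.cast_le.2 hn)) f).symm
  have hstep := fun n => hQ.mecke_of_lintegral_ne_top hs (hgm n) hv hfin hmono hleft (hgfin n)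
  have hL : Tendsto (fun n => ∫⁻ z, ∑' i, g n (z i) *
      expNeg (sumOthers i fun j => v (s (z i)) (z j)) ∂Q) atTop
      (𝓝 (∫⁻ z, ∑' i, f (z i) * expNeg (sumOthers i fun j => v (s (z i)) (z j)) ∂Q)) := by
    refine lintegral_tendsto_of_tendsto_of_monotone (fun n => ?_)
      (Eventually.of_forall fun z m n hmn => ?_) (Eventually.of_forall fun z => ?_)
    · refine (Measurable.tsum fun i => ?_).aemeasurable
      refine ((hgm n).comp (measurable_pi_apply i)).mul (Measurable.expNeg ?_)
      exact measurable_sumOthers i fun j => hv.comp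
        ((hs.comp (measurable_pi_apply i)).prodMk (measurable_pi_apply j))
    · exact ENNReal.tsum_le_tsum fun i => mul_le_mul_left (hgmono _ hmn) _
    · exact tendsto_tsum_of_monotone (fun i m n hmn => mul_le_mul_left (hgmono _ hmn) _)
        fun i => ENNReal.Tendsto.mul_const (hglim _) (Or.inr (expNeg_ne_top _))
  have hR : Tendsto (fun n => ∫⁻ w, g n w * expNeg (∫⁻ w', (1 - expNeg (v (s w) w')) ∂μ) ∂μ)
      atTop (𝓝 (∫⁻ w, f w * expNeg (∫⁻ w', (1 - expNeg (v (s w) w')) ∂μ) ∂μ)) := by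
    have hI : Measurable fun w => ∫⁻ w', (1 - expNeg (v (s w) w')) ∂μ := by
      refine Measurable.lintegral_prod_right' (f := fun p : E × E => 1 - expNeg (v (s p.1) p.2)) ?_
      exact (hv.comp ((hs.comp measurable_fst).prodMk measurable_snd)).expNeg.const_sub _
    refine lintegral_tendsto_of_tendsto_of_monotone (fun n => ((hgm n).mul hI.expNeg).aemeasurable)
      (Eventually.of_forall fun z m n hmn => mul_le_mul_left (hgmono _ hmn) _)
      (Eventually.of_forall fun z => ENNReal.Tendsto.mul_const (hglim _) (Or.inr (expNeg_ne_top _)))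
  simp_rw [hstep] at hL
  exact tendsto_nhds_unique hL hR

/-- Points of a Poisson process with finite mean measure on `{s ≤ n}` do not accumulate. -/
lemma PoissonLaplace.ae_finite [IsProbabilityMeasure Q] (hQ : PoissonLaplace Q μ)
    (hs : Measurable s) (hμ : ∀ n : ℕ, μ {w | s w ≤ n} ≠ ∞) :
    ∀ᵐ z ∂Q, ∀ n : ℕ, {i | s (z i) ≤ n}.Finite := by
  refine ae_all_iff.2 fun n => ?_
  have hA : MeasurableSet {w | s w ≤ n} := measurableSet_le hs measurable_const
  have hm : Measurable ({w | s w ≤ n}.indicator (1 : E → ℝ≥0∞)) := measurable_one.indicator hA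
  have h : ∀ᵐ z ∂Q, ∑' i, {w | s w ≤ n}.indicator (1 : E → ℝ≥0∞) (z i) < ∞ := by
    refine ae_lt_top (Measurable.tsum fun i => hm.comp (measurable_pi_apply i)) ?_
    rw [hQ.mean hm, lintegral_indicator_one hA]
    exact hμ n
  filter_upwards [h] with z hz
  refine (ENNReal.finite_const_le_of_tsum_ne_top hz.ne one_ne_zero).subset fun i hi => ?_
  have hi' : z i ∈ {w | s w ≤ n} := hi
  simp [indicator_of_mem hi']

/-- Follows from e^{-y} ≤ 1/(1+y) ≤ 1 - y + y². It makes the probability of two points in a set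
quadratic in the mass of the set. -/
lemma expNeg_add_self_le (x : ℝ≥0∞) : x + expNeg x ≤ 1 + x * x := by
  by_cases hx : x = ∞
  · simp [hx]
  · have h0 : 0 ≤ x.toReal := ENNReal.toReal_nonneg
    rw [← ENNReal.ofReal_toReal hx, expNeg_ofReal h0, ← ENNReal.ofReal_mul h0, ← ENNReal.ofReal_one,
      ← ENNReal.ofReal_add h0 (by positivity), ← ENNReal.ofReal_add (by positivity) (by positivity)]
    apply ENNReal.ofReal_le_ofReal
    set y := x.toReal
    have h1 := Real.add_one_le_exp y
    have h2 : Real.exp (-y) ≤ 1 / (y + 1) := by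
      rw [Real.exp_neg, ← one_div]
      exact one_div_le_one_div_of_le (by positivity) h1
    have h3 : 1 / (y + 1) ≤ 1 - y + y * y := by
      rw [div_le_iff₀ (by positivity)]
      nlinarith [pow_nonneg h0 3]
    linarith

/-- If n points lie in A, then 1 + 1_{n ≥ 2} ≤ n + 1_{n = 0}. Taking means, one plus the probability
of a pair is at most μ A + e^{-μ A}. -/
lemma PoissonLaplace.measure_pair_le [IsProbabilityMeasure Q] (hQ : PoissonLaplace Q μ)
    {A : Set E} (hA : MeasurableSet A) :
    Q {z | ∃ i j, i ≠ j ∧ z i ∈ A ∧ z j ∈ A} ≤ μ A * μ A := by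
  set T := {z : ℕ → E | ∃ i j, i ≠ j ∧ z i ∈ A ∧ z j ∈ A} with hT
  have hTm : MeasurableSet T := by
    have : T = ⋃ i, ⋃ j, {z : ℕ → E | i ≠ j ∧ z i ∈ A ∧ z j ∈ A} := by
      ext z; simp [hT]
    rw [this]
    refine MeasurableSet.iUnion fun i => MeasurableSet.iUnion fun j => ?_
    exact (MeasurableSet.const _).inter ((measurable_pi_apply i hA).inter (measurable_pi_apply j hA))
  have hm : Measurable (A.indicator (1 : E → ℝ≥0∞)) := measurable_one.indicator hA
  -- With exponent ∞ on A, the exponential of the sum is the indicator that A contains no point.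
  have hm' : Measurable (A.indicator (fun _ => ∞ : E → ℝ≥0∞)) := measurable_const.indicator hA
  have h1 := hQ.mean hm
  have h2 := hQ _ hm'
  rw [lintegral_indicator_one hA] at h1
  have e : ∫⁻ w, (1 - expNeg (A.indicator (fun _ => ∞) w)) ∂μ = μ A := by
    rw [← lintegral_indicator_one hA]
    refine lintegral_congr fun w => ?_
    by_cases hw : w ∈ A <;> simp [hw]
  rw [e] at h2
  have hmS : Measurable fun z : ℕ → E => ∑' i, A.indicator (1 : E → ℝ≥0∞) (z i) :=
    Measurable.tsum fun i => hm.comp (measurable_pi_apply i)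
  have h3 : 1 + Q T ≤ μ A + expNeg (μ A) := by
    have hadd := lintegral_add_left (μ := Q) hmS fun z => expNeg (∑' i, A.indicator (fun _ => ∞) (z i))
    rw [h1, h2] at hadd
    rw [← hadd]
    have h4 : 1 + Q T = ∫⁻ z, (1 + T.indicator 1 z) ∂Q := by
      rw [lintegral_add_left measurable_const, lintegral_indicator_one hTm]; simp
    rw [h4]
    refine lintegral_mono fun z => ?_
    by_cases hz : z ∈ T
    · obtain ⟨i, j, hij, hi, hj⟩ := id hz
      rw [indicator_of_mem hz]
      refine le_trans ?_ le_self_add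
      have := ENNReal.sum_le_tsum (f := fun i => A.indicator (1 : E → ℝ≥0∞) (z i)) {i, j}
      rw [Finset.sum_pair hij] at this
      simpa [hi, hj] using this
    · rw [indicator_of_notMem hz, add_zero]
      by_cases h : ∃ i, z i ∈ A
      · obtain ⟨i, hi⟩ := h
        refine le_trans ?_ le_self_add
        have := ENNReal.le_tsum (f := fun i => A.indicator (1 : E → ℝ≥0∞) (z i)) i
        simpa [hi] using this
      · push Not at h
        refine le_trans ?_ le_add_self
        simp [h]
  have h4 := h3.trans (expNeg_add_self_le (μ A))
  exact (ENNReal.add_le_add_iff_left (by simp)).1 h4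

/-- The values of a function without atoms at the points of a Poisson process are distinct. -/
lemma PoissonLaplace.ae_ne [IsProbabilityMeasure Q] (hQ : PoissonLaplace Q μ)
    (hs : Measurable s) (hμ : ∀ n : ℕ, μ {w | s w ≤ n} ≠ ∞) (hatom : ∀ r, μ {w | s w = r} = 0) :
    ∀ᵐ z ∂Q, ∀ i j, i ≠ j → s (z i) ≠ s (z j) := by
  have main : ∀ m : ℕ, Q {z | ∃ i j, i ≠ j ∧ s (z i) = s (z j) ∧ s (z i) ≤ m} = 0 := by
    intro m
    set A : Set E := {w | s w ≤ m} with hAdef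
    have hA : MeasurableSet A := measurableSet_le hs measurable_const
    have : IsFiniteMeasure (μ.restrict A) := ⟨by simpa using (hμ m).lt_top⟩
    set D : ℕ → Set (E × E) := fun n => {p | dyadicFloor n (s p.1) = dyadicFloor n (s p.2)} with hD
    have hd : ∀ n, Measurable fun w => dyadicFloor n (s w) := fun n => (measurable_dyadicFloor n).comp hs
    have hDm : ∀ n, MeasurableSet (D n) := fun n =>
      measurableSet_eq_fun ((hd n).comp measurable_fst) ((hd n).comp measurable_snd)
    -- Equal values lie in the same dyadic cell. The squared masses of the cells add up to the
    -- product measure of a neighbourhood of the diagonal {s = s'}. As n grows this tends to the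
    -- measure of the diagonal itself, which vanishes in the absence of atoms.
    have hbound : ∀ n, Q {z | ∃ i j, i ≠ j ∧ s (z i) = s (z j) ∧ s (z i) ≤ m} ≤
        ((μ.restrict A).prod (μ.restrict A)) (D n) := by
      intro n
      set B : ℤ → Set E := fun k => {w | ⌊(2 : ℝ) ^ n * s w⌋ = k} with hB
      have hBm : ∀ k, MeasurableSet (B k) := fun k =>
        (Int.measurable_floor.comp (hs.const_mul _)) (measurableSet_singleton k)
      calc Q {z | ∃ i j, i ≠ j ∧ s (z i) = s (z j) ∧ s (z i) ≤ m}
          ≤ Q (⋃ k : ℤ, {z | ∃ i j, i ≠ j ∧ z i ∈ B k ∩ A ∧ z j ∈ B k ∩ A}) := by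
            refine measure_mono ?_
            rintro z ⟨i, j, hij, he, hi⟩
            refine mem_iUnion.2 ⟨⌊(2 : ℝ) ^ n * s (z i)⌋, i, j, hij, ⟨rfl, hi⟩, ?_, ?_⟩
            · simp only [hB, mem_ofPred_eq, he]
            · exact he.symm.le.trans hi
        _ ≤ ∑' k, Q {z | ∃ i j, i ≠ j ∧ z i ∈ B k ∩ A ∧ z j ∈ B k ∩ A} := measure_iUnion_le _
        _ ≤ ∑' k, μ (B k ∩ A) * μ (B k ∩ A) := ENNReal.tsum_le_tsum fun k =>
            hQ.measure_pair_le ((hBm k).inter hA)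
        _ = ∑' k, ((μ.restrict A).prod (μ.restrict A)) (B k ×ˢ B k) := by
            simp_rw [Measure.prod_prod, Measure.restrict_apply (hBm _)]
        _ = ((μ.restrict A).prod (μ.restrict A)) (⋃ k, B k ×ˢ B k) := by
            refine (measure_iUnion ?_ fun k => (hBm k).prod (hBm k)).symm
            intro k l hkl
            refine Set.disjoint_left.2 fun p hk hl => hkl ?_
            exact hk.1.symm.trans hl.1
        _ ≤ _ := by
            refine measure_mono (iUnion_subset fun k p hp => ?_)
            simp only [hD, mem_ofPred_eq, dyadicFloor]
            rw [show ⌊(2 : ℝ) ^ n * s p.1⌋ = k from hp.1, show ⌊(2 : ℝ) ^ n * s p.2⌋ = k from hp.2]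
    have hDeq : MeasurableSet {p : E × E | s p.1 = s p.2} :=
      measurableSet_eq_fun (hs.comp measurable_fst) (hs.comp measurable_snd)
    have hlim : Tendsto (fun n => ((μ.restrict A).prod (μ.restrict A)) (D n)) atTop
        (𝓝 (((μ.restrict A).prod (μ.restrict A)) {p | s p.1 = s p.2})) := by
      simp_rw [← lintegral_indicator_one (hDm _), ← lintegral_indicator_one hDeq]
      refine tendsto_lintegral_of_le_one (fun n => measurable_one.indicator (hDm n))
        (fun n p => indicator_le_self' (fun _ _ => by simp) p) fun p => ?_
      by_cases hp : s p.1 = s p.2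
      · rw [indicator_of_mem (by exact hp)]
        refine tendsto_const_nhds.congr fun n => ?_
        rw [indicator_of_mem (s := D n) (by simp only [hD, mem_ofPred_eq, hp])]
      · rw [indicator_of_notMem (by exact hp)]
        refine tendsto_const_nhds.congr' ?_
        have h1 := (tendsto_dyadicFloor (s p.1)).prodMk_nhds (tendsto_dyadicFloor (s p.2))
        have h2 : {q : ℝ × ℝ | q.1 ≠ q.2} ∈ 𝓝 (s p.1, s p.2) :=
          (isOpen_ne_fun continuous_fst continuous_snd).mem_nhds hp
        filter_upwards [h1 h2] with n hn
        exact (indicator_of_notMem (s := D n) hn _).symm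
    have hz : ((μ.restrict A).prod (μ.restrict A)) {p | s p.1 = s p.2} = 0 := by
      rw [Measure.measure_prod_null hDeq]
      refine Eventually.of_forall fun w => ?_
      refine measure_mono_null (fun w' (hw' : s w = s w') => hw'.symm)
        (Measure.absolutelyContinuous_of_le Measure.restrict_le_self (hatom (s w)))
    rw [hz] at hlim
    exact le_antisymm (ge_of_tendsto' hlim hbound) zero_le
  have hall : ∀ᵐ z ∂Q, ∀ m : ℕ, ¬ ∃ i j, i ≠ j ∧ s (z i) = s (z j) ∧ s (z i) ≤ m :=
    ae_all_iff.2 fun m => by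
      rw [ae_iff]; simpa using main m
  filter_upwards [hall] with z hz i j hij he
  obtain ⟨m, hm⟩ := exists_nat_ge (s (z i))
  exact hz m ⟨i, j, hij, he, hm⟩

end Mecke

/-! ### Independent marks -/

section Marks

variable {M : Type*} [MeasurableSpace M] (κ : Measure M) [IsProbabilityMeasure κ]

/-- Independence factors the finite partial products. Writing each factor as the exponential of its
`negLog` makes the limiting infinite product the exponential of a single sum, even when factors
vanish. -/
lemma lintegral_infinitePi_expNeg_tsum {v : ℕ → M → ℝ≥0∞} (hv : ∀ i, Measurable (v i)) :
    ∫⁻ m, expNeg (∑' i, v i (m i)) ∂(Measure.infinitePi fun _ : ℕ => κ) =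
      expNeg (∑' i, negLog (∫⁻ m, expNeg (v i m) ∂κ)) := by
  have h1 : Tendsto (fun n => ∫⁻ m, ∏ i ∈ Finset.range n, expNeg (v i (m i))
      ∂(Measure.infinitePi fun _ : ℕ => κ)) atTop
      (𝓝 (∫⁻ m, expNeg (∑' i, v i (m i)) ∂(Measure.infinitePi fun _ : ℕ => κ))) := by
    refine tendsto_lintegral_of_le_one (fun n => ?_) (fun n m => ?_) fun m => tendsto_expNeg_tsum _
    · exact Finset.measurable_prod _ fun i _ => ((hv i).comp (measurable_pi_apply i)).expNeg
    · exact Finset.prod_le_one' fun i _ => expNeg_le_one _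
  have h2 := tendsto_expNeg_tsum fun i => negLog (∫⁻ m, expNeg (v i m) ∂κ)
  refine tendsto_nhds_unique h1 (h2.congr fun n => ?_)
  have hind : iIndepFun (fun (i : ℕ) (m : ℕ → M) => expNeg (v i (m i)))
      (Measure.infinitePi fun _ : ℕ => κ) :=
    iIndepFun_infinitePi (P := fun _ : ℕ => κ) (X := fun i m => expNeg (v i m)) fun i => (hv i).expNeg
  rw [lintegral_prod_eq_prod_lintegral_of_indepFun _ _ hind
    fun i => ((hv i).comp (measurable_pi_apply i)).expNeg]
  refine Finset.prod_congr rfl fun i _ => ?_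
  rw [expNeg_negLog]
  · exact ((measurePreserving_eval_infinitePi (fun _ : ℕ => κ) i).lintegral_comp (hv i).expNeg).symm
  · calc ∫⁻ m, expNeg (v i m) ∂κ ≤ ∫⁻ m, 1 ∂κ := lintegral_mono fun m => expNeg_le_one _
      _ = 1 := by simp

variable {κ} in
lemma lintegral_one_sub_expNeg {v : M → ℝ≥0∞} (hv : Measurable v) :
    ∫⁻ m, (1 - expNeg (v m)) ∂κ = 1 - ∫⁻ m, expNeg (v m) ∂κ := by
  have h1 : ∫⁻ m, expNeg (v m) ∂κ ≤ 1 := by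
    calc ∫⁻ m, expNeg (v m) ∂κ ≤ ∫⁻ m, 1 ∂κ := lintegral_mono fun m => expNeg_le_one _
      _ = 1 := by simp
  rw [lintegral_sub hv.expNeg (ne_top_of_le_ne_top ENNReal.one_ne_top h1)
    (Eventually.of_forall fun m => expNeg_le_one _)]
  simp

/-- Resampling one coordinate of an i.i.d. sequence preserves its law. -/
lemma infinitePi_map_update (i : ℕ) :
    ((Measure.infinitePi fun _ : ℕ => κ).prod κ).map (fun p => Function.update p.1 i p.2) =
      Measure.infinitePi fun _ : ℕ => κ := by
  classical
  have hm : Measurable fun p : (ℕ → M) × M => Function.update p.1 i p.2 := measurable_update'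
  refine Measure.eq_infinitePi _ fun s t ht => ?_
  rw [Measure.map_apply hm (MeasurableSet.pi s.countable_toSet fun j _ => ht j)]
  have e : (fun p : (ℕ → M) × M => Function.update p.1 i p.2) ⁻¹' (Set.pi s t) =
      -- The overwritten coordinate i is unconstrained in the old sequence; its constraint, if any,
      -- falls on the new mark.
      (Set.pi (s.erase i : Finset ℕ) t) ×ˢ (if i ∈ s then t i else univ) := by
    ext p
    simp only [mem_preimage, Set.mem_pi, mem_prod, Finset.mem_coe, Finset.mem_erase]
    constructor
    · intro h
      refine ⟨fun j hj => by simpa [hj.1] using h j hj.2, ?_⟩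
      split_ifs with hi
      · simpa using h i hi
      · trivial
    · rintro ⟨h1, h2⟩ j hj
      by_cases h : j = i
      · subst h; simpa [hj] using h2
      · simpa [h] using h1 j ⟨h, hj⟩
  rw [e, Measure.prod_prod, Measure.infinitePi_pi _ fun j _ => ht j]
  by_cases hi : i ∈ s
  · rw [if_pos hi, ← Finset.prod_erase_mul s _ hi]
  · rw [if_neg hi, Finset.erase_eq_of_notMem hi]; simp

variable {κ}

/-- Law of a sequence of points of law `Q₀` with i.i.d. marks of law `κ`. -/
noncomputable def markedLaw {E : Type*} [MeasurableSpace E] (Q₀ : Measure (ℕ → E)) (κ : Measure M) :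
    Measure (ℕ → E × M) :=
  (Q₀.prod (Measure.infinitePi fun _ : ℕ => κ)).map fun p i => (p.1 i, p.2 i)

lemma measurable_zip {E : Type*} [MeasurableSpace E] :
    Measurable fun (p : (ℕ → E) × (ℕ → M)) (i : ℕ) => (p.1 i, p.2 i) :=
  measurable_pi_lambda _ fun i => ((measurable_pi_apply i).comp measurable_fst).prodMk
    ((measurable_pi_apply i).comp measurable_snd)

lemma lintegral_markedLaw {E : Type*} [MeasurableSpace E] {Q₀ : Measure (ℕ → E)}
    [SFinite Q₀] {F : (ℕ → E × M) → ℝ≥0∞} (hF : Measurable F) :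
    ∫⁻ z, F z ∂(markedLaw Q₀ κ) =
      ∫⁻ x, ∫⁻ m, F (fun i => (x i, m i)) ∂(Measure.infinitePi fun _ : ℕ => κ) ∂Q₀ := by
  rw [markedLaw, lintegral_map hF measurable_zip]
  exact lintegral_prod _ (hF.comp measurable_zip).aemeasurable

/-- Given the positions the marks are i.i.d., so redrawing one of them does not change the law. This
is how the fading of one BS is averaged with all else frozen. -/
lemma lintegral_markedLaw_resample {E : Type*} [MeasurableSpace E] {Q₀ : Measure (ℕ → E)}
    [SFinite Q₀] (i : ℕ) {F : (ℕ → E × M) → ℝ≥0∞} (hF : Measurable F) :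
    ∫⁻ z, F z ∂(markedLaw Q₀ κ) =
      ∫⁻ z, ∫⁻ m, F (Function.update z i ((z i).1, m)) ∂κ ∂(markedLaw Q₀ κ) := by
  have hup : Measurable fun q : (ℕ → E × M) × M => Function.update q.1 i ((q.1 i).1, q.2) :=
    (measurable_update' (a := i)).comp (measurable_fst.prodMk
      ((measurable_fst.comp ((measurable_pi_apply i).comp measurable_fst)).prodMk measurable_snd))
  have hG : Measurable fun z : ℕ → E × M => ∫⁻ m, F (Function.update z i ((z i).1, m)) ∂κ :=
    (hF.comp hup).lintegral_prod_right'
  rw [lintegral_markedLaw hF, lintegral_markedLaw hG]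
  refine lintegral_congr fun x => ?_
  have hFx : Measurable fun m : ℕ → M => F fun j => (x j, m j) :=
    hF.comp (measurable_zip.comp measurable_prodMk_left)
  conv_lhs => rw [← infinitePi_map_update κ i]
  rw [lintegral_map hFx measurable_update']
  refine (lintegral_prod _ (hFx.comp measurable_update').aemeasurable).trans ?_
  refine lintegral_congr fun m => lintegral_congr fun m' => congrArg F (funext fun j => ?_)
  by_cases h : j = i
  · subst h; simp
  · simp [h]

variable {Ω : Type*} [MeasurableSpace Ω] {P : Measure Ω} {lam : ℝ} {X : ℕ → Ω → Plane}
  {m : ℕ → Ω → M}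

omit [IsProbabilityMeasure κ] in
lemma IsMarkedPPP.aemeasurable (h : IsMarkedPPP P lam κ X m) :
    AEMeasurable (fun ω i => (X i ω, m i ω)) P :=
  aemeasurable_pi_iff.2 fun i => (h.ppp.measurable i).aemeasurable.prodMk (h.mark_law i).aemeasurable

omit [IsProbabilityMeasure κ] in
lemma IsMarkedPPP.map_eq [IsProbabilityMeasure P] (h : IsMarkedPPP P lam κ X m) :
    P.map (fun ω i => (X i ω, m i ω)) = markedLaw (P.map fun ω i => X i ω) κ := by
  have hX : AEMeasurable (fun ω i => X i ω) P :=
    (measurable_pi_lambda _ h.ppp.measurable).aemeasurable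
  have hm : AEMeasurable (fun ω i => m i ω) P :=
    aemeasurable_pi_iff.2 fun i => (h.mark_law i).aemeasurable
  have h1 := (indepFun_iff_map_prod_eq_prod_map_map hX hm).1 h.point_mark_indep
  have h2 : P.map (fun ω i => m i ω) = Measure.infinitePi fun _ : ℕ => κ :=
    (h.mark_indep.hasLaw_infinitePi h.mark_law hm).map_eq
  rw [markedLaw, ← h2, ← h1, AEMeasurable.map_map_of_aemeasurable measurable_zip.aemeasurable
    (hX.prodMk hm)]
  rfl

/-- The marking theorem: a marked Poisson process is a Poisson process on the product space. -/
lemma IsMarkedPPP.poissonLaplace [IsProbabilityMeasure P] (h : IsMarkedPPP P lam κ X m) :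
    PoissonLaplace (P.map fun ω i => (X i ω, m i ω)) ((ENNReal.ofReal lam • volume).prod κ) := by
  intro v hv
  have hX : Measurable (fun ω i => X i ω) := measurable_pi_lambda _ h.ppp.measurable
  have hF : Measurable fun z : ℕ → Plane × M => expNeg (∑' i, v (z i)) := by fun_prop
  have hg : Measurable fun x : Plane => ∫⁻ m, expNeg (v (x, m)) ∂κ := hv.expNeg.lintegral_prod_right'
  have hg1 : ∀ x : Plane, ∫⁻ m, expNeg (v (x, m)) ∂κ ≤ 1 := fun x => by
    calc ∫⁻ m, expNeg (v (x, m)) ∂κ ≤ ∫⁻ m, 1 ∂κ := lintegral_mono fun m => expNeg_le_one _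
      _ = 1 := by simp
  have : IsProbabilityMeasure (P.map fun ω i => X i ω) := Measure.isProbabilityMeasure_map hX.aemeasurable
  rw [h.map_eq, lintegral_markedLaw hF]
  have e : ∀ x : ℕ → Plane, ∫⁻ m, expNeg (∑' i, v (x i, m i)) ∂(Measure.infinitePi fun _ : ℕ => κ) =
      expNeg (∑' i, negLog (∫⁻ m, expNeg (v (x i, m)) ∂κ)) := fun x =>
    lintegral_infinitePi_expNeg_tsum κ (v := fun i m => v (x i, m))
      fun i => hv.comp measurable_prodMk_left
  simp_rw [e]
  -- Averaging over the marks leaves a sum over the positions alone, with exponent -log of the mean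
  -- of e^{-v(x,m)}, to which the unmarked Laplace functional applies.
  have hn : Measurable fun x : Plane => negLog (∫⁻ m, expNeg (v (x, m)) ∂κ) := negLog_measurable.comp hg
  have hN : Measurable fun x : ℕ → Plane => expNeg (∑' i, negLog (∫⁻ m, expNeg (v (x i, m)) ∂κ)) :=
    Measurable.expNeg (Measurable.tsum fun i => hn.comp (measurable_pi_apply i))
  rw [lintegral_map hN hX,
    h.ppp.laplace hn, lintegral_prod _ (hv.expNeg.const_sub 1).aemeasurable, lintegral_smul_measure]
  congr 2
  refine lintegral_congr fun x => ?_
  rw [expNeg_negLog (hg1 x)]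
  exact (lintegral_one_sub_expNeg (hv.comp measurable_prodMk_left)).symm

end Marks

/-! ### The laws of the marks -/

instance : IsProbabilityMeasure fadingLaw := isProbabilityMeasure_expMeasure one_pos

instance : IsProbabilityMeasure unitLaw :=
  cond_isProbabilityMeasure_of_finite (by simp) (by simp)

instance : IsProbabilityMeasure angleLaw :=
  cond_isProbabilityMeasure_of_finite (by simp [Real.pi_pos]) (by simp)

/-- The exponential tail turns coverage probabilities into Laplace transforms. The threshold ∞ is
included, so infinite interference needs no separate treatment. -/
lemma fadingLaw_tail (A : ℝ≥0∞) : fadingLaw {h | A < ENNReal.ofReal h} = expNeg A := by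
  by_cases hA : A = ∞
  · simp [hA]
  · have ha : 0 ≤ A.toReal := ENNReal.toReal_nonneg
    have e : {h | A < ENNReal.ofReal h} = (Iic A.toReal)ᶜ := by
      ext h
      rw [mem_ofPred_eq, ENNReal.lt_ofReal_iff_toReal_lt hA, mem_compl_iff, mem_Iic, not_le]
    rw [e, prob_compl_eq_one_sub measurableSet_Iic, ← ofReal_cdf, fadingLaw,
      cdf_expMeasure_eq one_pos, if_pos ha, ← ENNReal.ofReal_one, ← ENNReal.ofReal_sub, sub_sub_cancel,
      one_mul, ← expNeg_ofReal ha, ENNReal.ofReal_toReal hA]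
    rw [sub_nonneg, Real.exp_le_one_iff]; linarith

/-- The factor e^{-Bh} turns the density of rate 1 into (1+B)⁻¹ times the density of rate 1+B. -/
lemma lintegral_fadingLaw_expNeg {B : ℝ} (hB : 0 ≤ B) :
    ∫⁻ h, expNeg (ENNReal.ofReal (B * h)) ∂fadingLaw = (1 + ENNReal.ofReal B)⁻¹ := by
  have hB1 : 0 < 1 + B := by linarith
  have hm : Measurable (exponentialPDF 1) := (measurable_exponentialPDFReal 1).ennreal_ofReal
  rw [fadingLaw, expMeasure, gammaMeasure]
  change ∫⁻ h, _ ∂(volume.withDensity (exponentialPDF 1)) = _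
  rw [lintegral_withDensity_eq_lintegral_mul _ hm (by fun_prop)]
  have e : ∀ h, (exponentialPDF 1 * fun h => expNeg (ENNReal.ofReal (B * h))) h =
      ENNReal.ofReal (1 + B)⁻¹ * exponentialPDF (1 + B) h := by
    intro h
    rw [Pi.mul_apply, exponentialPDF_eq, exponentialPDF_eq]
    split_ifs with hh
    · rw [expNeg_ofReal (by positivity), ← ENNReal.ofReal_mul (by positivity),
        ← ENNReal.ofReal_mul (by positivity), inv_mul_cancel_left₀ hB1.ne', one_mul, one_mul,
        ← Real.exp_add]
      congr 2; ring
    · simp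
  simp_rw [e]
  rw [lintegral_const_mul' _ _ ENNReal.ofReal_ne_top, lintegral_exponentialPDF_eq_one hB1, mul_one,
    ENNReal.ofReal_inv_of_pos hB1, ENNReal.ofReal_add zero_le_one hB, ENNReal.ofReal_one]

lemma lintegral_ite_prob {α : Type*} [MeasurableSpace α] {κ : Measure α} [IsProbabilityMeasure κ]
    {S : Set α} (hS : MeasurableSet S) [DecidablePred (· ∈ S)] (x y : ℝ≥0∞) :
    ∫⁻ a, (if a ∈ S then x else y) ∂κ = κ S * x + (1 - κ S) * y := by
  have e : ∀ a, (if a ∈ S then x else y) = S.indicator (fun _ => x) a + Sᶜ.indicator (fun _ => y) a := by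
    intro a; by_cases ha : a ∈ S <;> simp [ha]
  simp_rw [e]
  rw [lintegral_add_left (measurable_const.indicator hS), lintegral_indicator_const hS,
    lintegral_indicator_const hS.compl, prob_compl_eq_one_sub hS, mul_comm x, mul_comm y]

lemma LinkType.sum_univ {β : Type*} [AddCommMonoid β] (g : LinkType → β) :
    ∑ t : LinkType, g t = g LinkType.LOS + g LinkType.NLOS := by
  change ∑ t ∈ ({LinkType.LOS, LinkType.NLOS} : Finset LinkType), g t = _
  rw [Finset.sum_pair (by simp)]

lemma NetParams.lintegral_linkType (q : NetParams) {r : ℝ} (hr : 0 ≤ r) (g : LinkType → ℝ≥0∞) :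
    ∫⁻ b, g (q.linkType r b) ∂unitLaw = ∑ t : LinkType, ENNReal.ofReal (q.p t r) * g t := by
  have h0 := q.pLOS_nonneg r hr
  have h1 := q.pLOS_le_one r hr
  have hS : unitLaw (Iic (q.pLOS r)) = ENNReal.ofReal (q.pLOS r) := by
    have hI : Icc (0 : ℝ) 1 ∩ Iic (q.pLOS r) = Icc 0 (q.pLOS r) := by
      ext b
      simp only [mem_inter_iff, mem_Icc, mem_Iic]
      constructor
      · exact fun h => ⟨h.1.1, h.2⟩
      · exact fun h => ⟨⟨h.1, h.2.trans h1⟩, h.2⟩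
    rw [unitLaw, cond_apply measurableSet_Icc, hI]
    simp
  have e : ∀ b, g (q.linkType r b) = if b ∈ Iic (q.pLOS r) then g .LOS else g .NLOS := by
    intro b
    simp only [NetParams.linkType, mem_Iic]
    split_ifs <;> rfl
  simp_rw [e]
  rw [lintegral_ite_prob measurableSet_Iic, hS, LinkType.sum_univ]
  simp only [NetParams.p]
  rw [ENNReal.ofReal_sub _ h0, ENNReal.ofReal_one]

lemma Antenna.beamwidth_ratio_nonneg (A : Antenna) : 0 ≤ A.beamwidth / (2 * Real.pi) :=
  div_nonneg A.beamwidth_pos.le (by positivity)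

lemma Antenna.lintegral_gain (A : Antenna) (g : ℝ → ℝ≥0∞) :
    ∫⁻ θ, g (A.gain θ) ∂angleLaw = ∑ k : Fin 2, ENNReal.ofReal (A.weight k) * g (A.lobe k) := by
  have hbw := A.beamwidth_le
  have hb0 := A.beamwidth_pos
  set S : Set ℝ := Icc (-(A.beamwidth / 2)) (A.beamwidth / 2)
  have hS : angleLaw S = ENNReal.ofReal (A.beamwidth / (2 * Real.pi)) := by
    have hpi := Real.pi_pos
    rw [angleLaw, cond_apply measurableSet_Icc, Icc_inter_Icc, max_eq_right (by linarith),
      min_eq_right (by linarith), Real.volume_Icc, Real.volume_Icc, mul_comm, ← div_eq_mul_inv,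
      ← ENNReal.ofReal_div_of_pos (by linarith)]
    congr 1
    ring
  have e : ∀ θ, g (A.gain θ) = if θ ∈ S then g A.main else g A.side := by
    intro θ
    simp only [Antenna.gain, S, mem_Icc, ← abs_le]
    split_ifs <;> rfl
  classical
  simp_rw [e]
  rw [lintegral_ite_prob measurableSet_Icc, hS, Fin.sum_univ_two]
  simp only [Antenna.weight, Antenna.lobe, Matrix.cons_val_zero, Matrix.cons_val_one]
  rw [ENNReal.ofReal_sub _ A.beamwidth_ratio_nonneg, ENNReal.ofReal_one]

lemma Antenna.measurable_gain (A : Antenna) : Measurable A.gain := by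
  unfold Antenna.gain
  exact Measurable.ite (measurableSet_le (by fun_prop) measurable_const) measurable_const measurable_const

lemma Antenna.lobe_nonneg (A : Antenna) (k : Fin 2) : 0 ≤ A.lobe k := by
  fin_cases k
  · exact A.main_pos.le
  · exact A.side_nonneg

/-! ### Integration of radial functions on the plane -/

lemma lintegral_norm_plane {f : ℝ → ℝ≥0∞} (hf : Measurable f) :
    ∫⁻ x : Plane, f ‖x‖ = ENNReal.ofReal (2 * Real.pi) * ∫⁻ r in Ioi (0 : ℝ), f r * ENNReal.ofReal r := by
  -- Polar coordinates are a homeomorphism only off the origin, which is a null set.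
  have h1 : ∫⁻ x : Plane, f ‖x‖ =
      ∫⁻ x : ({(0 : Plane)}ᶜ : Set Plane), f ‖x.1‖ ∂((volume : Measure Plane).comap (↑)) := by
    rw [lintegral_subtype_comap (measurableSet_singleton _).compl fun x : Plane => f ‖x‖,
      restrict_compl_singleton]
  have hf' : Measurable fun r : Ioi (0 : ℝ) => f r := hf.comp measurable_subtype_coe
  have h2 : ∫⁻ x : ({(0 : Plane)}ᶜ : Set Plane), f ‖x.1‖ ∂((volume : Measure Plane).comap (↑)) =
      ∫⁻ x, f x.2 ∂((volume : Measure Plane).toSphere.prod (Measure.volumeIoiPow (Module.finrank ℝ Plane - 1))) := by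
    have := (volume : Measure Plane).measurePreserving_homeomorphUnitSphereProd.lintegral_comp
      (hf'.comp measurable_snd)
    simpa using this
  have hS : (volume : Measure Plane).toSphere univ = ENNReal.ofReal (2 * Real.pi) := by
    rw [Measure.toSphere_apply_univ, EuclideanSpace.volume_ball_fin_two]
    simp [ENNReal.ofReal_mul]
  rw [h1, h2]
  refine (lintegral_prod _ (hf'.comp measurable_snd).aemeasurable).trans ?_
  simp only [Function.comp_apply]
  rw [lintegral_const, hS, mul_comm]
  congr 1
  rw [Measure.volumeIoiPow, lintegral_withDensity_eq_lintegral_mul _ (by fun_prop) hf',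
    ← lintegral_subtype_comap measurableSet_Ioi]
  refine lintegral_congr fun r => ?_
  simp [mul_comm]

lemma lintegral_Ioi_scale {c : ℝ} (hc : 0 < c) {F : ℝ → ℝ≥0∞} (hF : Measurable F) :
    ∫⁻ r in Ioi (0 : ℝ), F r = ENNReal.ofReal c * ∫⁻ u in Ioi (0 : ℝ), F (c * u) := by
  rw [← lintegral_indicator measurableSet_Ioi, ← lintegral_indicator measurableSet_Ioi]
  conv_lhs => rw [← Real.smul_map_volume_mul_left hc.ne']
  rw [lintegral_smul_measure, lintegral_map (hF.indicator measurableSet_Ioi) (measurable_const_mul c),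
    abs_of_pos hc, smul_eq_mul]
  congr 1
  refine lintegral_congr fun u => ?_
  by_cases hu : 0 < u
  · rw [indicator_of_mem (show c * u ∈ Ioi 0 from mul_pos hc hu),
      indicator_of_mem (show u ∈ Ioi 0 from hu)]
  · rw [indicator_of_notMem (show u ∉ Ioi 0 from hu), indicator_of_notMem]
    exact fun h => hu ((mul_pos_iff_of_pos_left hc).1 h)

lemma NetParams.measurable_p (q : NetParams) (t : LinkType) : Measurable (q.p t) := by
  cases t
  · exact q.pLOS_measurable
  · exact measurable_const.sub q.pLOS_measurable

lemma NetParams.p_nonneg (q : NetParams) (t : LinkType) {r : ℝ} (hr : 0 ≤ r) : 0 ≤ q.p t r := by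
  cases t
  · exact q.pLOS_nonneg r hr
  · exact sub_nonneg.2 (q.pLOS_le_one r hr)

lemma NetParams.p_le_one (q : NetParams) (t : LinkType) {r : ℝ} (hr : 0 ≤ r) : q.p t r ≤ 1 := by
  cases t
  · exact q.pLOS_le_one r hr
  · exact sub_le_self _ (q.pLOS_nonneg r hr)

lemma measurable_linkType_fun {β : Type*} [MeasurableSpace β] (f : LinkType → β) : Measurable f :=
  measurable_from_top

lemma NetParams.measurable_linkType (q : NetParams) :
    Measurable fun x : ℝ × ℝ => q.linkType x.1 x.2 := by
  unfold NetParams.linkType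
  exact Measurable.ite (measurableSet_le measurable_snd (q.pLOS_measurable.comp measurable_fst))
    measurable_const measurable_const

/-- The reciprocal of the average power received over a link of type `t` and length `r`
when the transmit power is `a`. -/
noncomputable def NetParams.level (q : NetParams) (a : ℝ) (t : LinkType) (r : ℝ) : ℝ := r ^ q.α t / (q.C t * a)

lemma NetParams.measurable_level (q : NetParams) :
    Measurable fun x : ℝ × LinkType × ℝ => q.level x.1 x.2.1 x.2.2 := by
  unfold NetParams.level
  have h1 : Measurable fun x : ℝ × LinkType × ℝ => q.α x.2.1 :=
    (measurable_linkType_fun q.α).comp (measurable_fst.comp measurable_snd)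
  have h2 : Measurable fun x : ℝ × LinkType × ℝ => q.C x.2.1 :=
    (measurable_linkType_fun q.C).comp (measurable_fst.comp measurable_snd)
  fun_prop

lemma NetParams.mul_pathLoss (q : NetParams) (a : ℝ) (t : LinkType) {r : ℝ} (hr : 0 ≤ r) :
    a * q.pathLoss t r = (q.level a t r)⁻¹ := by
  rw [NetParams.pathLoss, NetParams.level, inv_div, Real.rpow_neg hr]
  ring

/-- Distribution of the levels of a Poisson field of transmitters of power `a`. -/
lemma NetParams.lintegral_level (q : NetParams) {a : ℝ} (ha : 0 < a) {f : ℝ → ℝ≥0∞}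
    (hf : Measurable f) :
    ∫⁻ x : Plane, ∫⁻ b, f (q.level a (q.linkType ‖x‖ b) ‖x‖) ∂unitLaw =
      ENNReal.ofReal (2 * Real.pi) * ∑ t : LinkType, ∫⁻ u in Ioi (0 : ℝ),
        ENNReal.ofReal (q.p t (u * a ^ (1 / q.α t) * q.C t ^ (1 / q.α t)) * a ^ (2 / q.α t)) *
          ENNReal.ofReal (q.C t ^ (2 / q.α t)) * f (u ^ q.α t) * ENNReal.ofReal u := by
  have hlev : ∀ t, Measurable fun r => q.level a t r := fun t =>
    q.measurable_level.comp (by fun_prop : Measurable fun r : ℝ => (a, t, r))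
  have e1 : ∀ x : Plane, ∫⁻ b, f (q.level a (q.linkType ‖x‖ b) ‖x‖) ∂unitLaw =
      ∑ t : LinkType, ENNReal.ofReal (q.p t ‖x‖) * f (q.level a t ‖x‖) := fun x =>
    q.lintegral_linkType (norm_nonneg x) fun t => f (q.level a t ‖x‖)
  simp_rw [e1]
  have hm : ∀ t, Measurable fun r => ENNReal.ofReal (q.p t r) * f (q.level a t r) := fun t =>
    (q.measurable_p t).ennreal_ofReal.mul (hf.comp (hlev t))
  rw [lintegral_norm_plane (f := fun r => ∑ t : LinkType, ENNReal.ofReal (q.p t r) * f (q.level a t r))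
    (Finset.measurable_sum _ fun t _ => hm t)]
  congr 1
  simp_rw [Finset.sum_mul]
  have hm' : ∀ t, Measurable fun r =>
      ENNReal.ofReal (q.p t r) * f (q.level a t r) * ENNReal.ofReal r := fun t =>
    (hm t).mul ENNReal.measurable_ofReal
  rw [lintegral_finsetSum _ fun t _ => hm' t]
  refine Finset.sum_congr rfl fun t _ => ?_
  have hC := q.C_pos t
  have hα := q.α_pos t
  -- With r = c u the level r^α/(C a) becomes u^α, and r dr becomes c² u du, which is the source of
  -- the powers 2/α.
  set c := a ^ (1 / q.α t) * q.C t ^ (1 / q.α t) with hc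
  have hcpos : 0 < c := by positivity
  rw [lintegral_Ioi_scale hcpos (hm' t),
    ← lintegral_const_mul' _ _ ENNReal.ofReal_ne_top]
  refine setLIntegral_congr_fun measurableSet_Ioi fun u hu => ?_
  have hu0 : (0 : ℝ) < u := hu
  have hlevel : q.level a t (c * u) = u ^ q.α t := by
    rw [NetParams.level, hc, Real.mul_rpow (by positivity) hu0.le,
      Real.mul_rpow (by positivity) (by positivity), ← Real.rpow_mul ha.le, ← Real.rpow_mul hC.le,
      one_div_mul_cancel hα.ne', Real.rpow_one, Real.rpow_one]
    field_simp
  have hcc : a ^ (2 / q.α t) * q.C t ^ (2 / q.α t) = c * c := by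
    rw [hc, show (2 : ℝ) / q.α t = 1 / q.α t + 1 / q.α t by ring, Real.rpow_add ha, Real.rpow_add hC]
    ring
  have hp := q.p_nonneg t (r := c * u) (by positivity)
  simp only [hlevel]
  rw [show u * a ^ (1 / q.α t) * q.C t ^ (1 / q.α t) = c * u by rw [hc]; ring]
  rw [← ENNReal.ofReal_mul (by positivity), mul_assoc (q.p t _), hcc, ENNReal.ofReal_mul hcpos.le,
    ENNReal.ofReal_mul hp, ENNReal.ofReal_mul hcpos.le]
  ring

/-! ### Interference -/

/-- Passes from the Laplace transform of the fading to the integrand of F_S and F_P. For B = 0, the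
case of a vanishing side-lobe gain, both sides vanish because 0⁻¹ = ∞. -/
lemma one_sub_inv_one_add {B s : ℝ} (hB : 0 ≤ B) (hs : 0 < s) :
    1 - (1 + ENNReal.ofReal (B * s⁻¹))⁻¹ = (1 + (ENNReal.ofReal B)⁻¹ * ENNReal.ofReal s)⁻¹ := by
  rcases hB.eq_or_lt with rfl | hB
  · simp [ENNReal.top_mul, hs]
  · have h1 : 0 < 1 + B * s⁻¹ := by positivity
    have h2 : 0 < 1 + B⁻¹ * s := by positivity
    rw [← ENNReal.ofReal_inv_of_pos hB, ← ENNReal.ofReal_mul (by positivity), ← ENNReal.ofReal_one,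
      ← ENNReal.ofReal_add zero_le_one (by positivity), ← ENNReal.ofReal_add zero_le_one (by positivity),
      ← ENNReal.ofReal_inv_of_pos h1, ← ENNReal.ofReal_inv_of_pos h2,
      ← ENNReal.ofReal_sub _ (by positivity)]
    congr 1
    field_simp
    ring

/-- The mean of `1 - exp(-c G h)` over a Rayleigh fading variable `h` and a random gain `G`. -/
lemma Antenna.lintegral_fading_gain (A : Antenna) {c : ℝ} (hc : 0 ≤ c) :
    ∫⁻ h, ∫⁻ θ, (1 - expNeg (ENNReal.ofReal (c * A.gain θ * h))) ∂angleLaw ∂fadingLaw =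
      ∑ k : Fin 2, ENNReal.ofReal (A.weight k) * (1 - (1 + ENNReal.ofReal (c * A.lobe k))⁻¹) := by
  have e : ∀ h, ∫⁻ θ, (1 - expNeg (ENNReal.ofReal (c * A.gain θ * h))) ∂angleLaw =
      ∑ k : Fin 2, ENNReal.ofReal (A.weight k) * (1 - expNeg (ENNReal.ofReal (c * A.lobe k * h))) :=
    fun h => A.lintegral_gain fun G => 1 - expNeg (ENNReal.ofReal (c * G * h))
  simp_rw [e]
  rw [lintegral_finsetSum _ fun k _ => by fun_prop]
  refine Finset.sum_congr rfl fun k _ => ?_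
  rw [lintegral_const_mul _ (by fun_prop), lintegral_one_sub_expNeg (by fun_prop),
    lintegral_fadingLaw_expNeg (mul_nonneg hc (A.lobe_nonneg k))]

/-- Collecting the terms of a mixture over the lobes of an antenna. -/
lemma Antenna.sum_lintegral_mixture (A : Antenna) (c : ℝ≥0∞) (S : LinkType → Set ℝ) {κ : LinkType → ℝ → ℝ≥0∞}
    (hκ : ∀ t, Measurable (κ t)) {g : Fin 2 → LinkType → ℝ → ℝ≥0∞} (hg : ∀ k t, Measurable (g k t)) :
    c * ∑ t : LinkType, ∫⁻ u in S t,
        κ t u * (∑ k : Fin 2, ENNReal.ofReal (A.weight k) * g k t u) * ENNReal.ofReal u =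
      ∑ k : Fin 2, ENNReal.ofReal (A.weight k) *
        (c * ∑ t : LinkType, ∫⁻ u in S t, κ t u * g k t u * ENNReal.ofReal u) := by
  have e : ∀ t, ∫⁻ u in S t,
        κ t u * (∑ k : Fin 2, ENNReal.ofReal (A.weight k) * g k t u) * ENNReal.ofReal u =
      ∑ k : Fin 2, ENNReal.ofReal (A.weight k) *
        ∫⁻ u in S t, κ t u * g k t u * ENNReal.ofReal u := by
    intro t
    have hm : ∀ k, Measurable fun u => κ t u * g k t u * ENNReal.ofReal u := fun k =>
      ((hκ t).mul (hg k t)).mul ENNReal.measurable_ofReal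
    simp_rw [← lintegral_const_mul _ (hm _)]
    rw [← lintegral_finsetSum _ fun k _ => (hm k).const_mul _]
    refine lintegral_congr fun u => ?_
    rw [Finset.mul_sum, Finset.sum_mul]
    exact Finset.sum_congr rfl fun k _ => by ring
  simp_rw [e]
  rw [Finset.sum_comm, Finset.mul_sum]
  refine Finset.sum_congr rfl fun k _ => ?_
  rw [← Finset.mul_sum]; ring

namespace NetParams

variable (q : NetParams)

/-- Level of a transmitter of power `a`. -/
noncomputable def levelAt (a : ℝ) (x : Plane) (b : ℝ) : ℝ := q.level a (q.linkType ‖x‖ b) ‖x‖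

variable {q} in
@[fun_prop]
lemma measurable_levelAt {β : Type*} [MeasurableSpace β] {f : β → ℝ} {g : β → Plane} {h : β → ℝ}
    (hf : Measurable f) (hg : Measurable g) (hh : Measurable h) :
    Measurable fun y => q.levelAt (f y) (g y) (h y) := by
  have h1 : Measurable fun y => q.linkType ‖g y‖ (h y) := q.measurable_linkType.comp (hg.norm.prodMk hh)
  exact q.measurable_level.comp (hf.prodMk (h1.prodMk hg.norm))

lemma levelAt_nonneg {a : ℝ} (ha : 0 ≤ a) (x : Plane) (b : ℝ) : 0 ≤ q.levelAt a x b := by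
  unfold levelAt level
  have := q.C_pos (q.linkType ‖x‖ b)
  positivity

lemma levelAt_pos {a : ℝ} (ha : 0 < a) {x : Plane} (hx : x ≠ 0) (b : ℝ) : 0 < q.levelAt a x b := by
  unfold levelAt level
  have := q.C_pos (q.linkType ‖x‖ b)
  have := norm_pos_iff.2 hx
  positivity

lemma mul_pathLoss_eq (a : ℝ) (x : Plane) (b : ℝ) :
    a * q.pathLoss (q.linkType ‖x‖ b) ‖x‖ = (q.levelAt a x b)⁻¹ :=
  q.mul_pathLoss a _ (norm_nonneg x)

lemma measurable_M (t : LinkType) : Measurable (q.M t) := by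
  unfold M
  have := q.measurable_p t
  fun_prop

/-- Interference caused by a primary BS. -/
noncomputable def interfTermP (w : Plane × ℝ × ℝ × ℝ) : ℝ≥0∞ :=
  ENNReal.ofReal (q.powerP * q.antP.gain w.2.2.2 * w.2.2.1 *
    q.pathLoss (q.linkType ‖w.1‖ w.2.1) ‖w.1‖)

lemma interfTermP_eq (w : Plane × ℝ × ℝ × ℝ) : q.interfTermP w =
    ENNReal.ofReal ((q.levelAt q.powerP w.1 w.2.1)⁻¹ * q.antP.gain w.2.2.2 * w.2.2.1) := by
  rw [interfTermP, ← q.mul_pathLoss_eq]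
  congr 1; ring

lemma measurable_interfTermP : Measurable q.interfTermP := by
  have e : q.interfTermP = fun w =>
      ENNReal.ofReal ((q.levelAt q.powerP w.1 w.2.1)⁻¹ * q.antP.gain w.2.2.2 * w.2.2.1) :=
    funext q.interfTermP_eq
  rw [e]
  have h2 : Measurable fun w : Plane × ℝ × ℝ × ℝ => q.antP.gain w.2.2.2 :=
    q.antP.measurable_gain.comp (measurable_snd.comp (measurable_snd.comp measurable_snd))
  fun_prop

lemma lintegral_interfTermP {a : ℝ} (ha : 0 ≤ a) :
    ∫⁻ w, (1 - expNeg (ENNReal.ofReal a * q.interfTermP w))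
        ∂((ENNReal.ofReal q.lamPT • volume).prod (unitLaw.prod (fadingLaw.prod angleLaw))) =
      ENNReal.ofReal q.lamPT * ∑ k : Fin 2, ENNReal.ofReal (q.antP.weight k) * q.FP (a * q.antP.lobe k) := by
  have hm : Measurable fun w => 1 - expNeg (ENNReal.ofReal a * q.interfTermP w) :=
    (q.measurable_interfTermP.const_mul _).expNeg.const_sub _
  obtain ⟨φ, hφ⟩ : ∃ φ : ℝ → ℝ≥0∞, φ = fun s => ∑ k : Fin 2, ENNReal.ofReal (q.antP.weight k) *
    (1 - (1 + ENNReal.ofReal (a * s⁻¹ * q.antP.lobe k))⁻¹) := ⟨_, rfl⟩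
  have hφm : Measurable φ := by rw [hφ]; fun_prop
  have h1 : ∀ x : Plane, ∫⁻ m, (1 - expNeg (ENNReal.ofReal a * q.interfTermP (x, m)))
      ∂(unitLaw.prod (fadingLaw.prod angleLaw)) =
      ∫⁻ b, φ (q.level q.powerP (q.linkType ‖x‖ b) ‖x‖) ∂unitLaw := by
    intro x
    have hm1 : Measurable fun m : ℝ × ℝ × ℝ => 1 - expNeg (ENNReal.ofReal a * q.interfTermP (x, m)) :=
      hm.comp measurable_prodMk_left
    rw [lintegral_prod _ hm1.aemeasurable]
    refine lintegral_congr fun b => ?_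
    have hm2 : Measurable fun m : ℝ × ℝ =>
        1 - expNeg (ENNReal.ofReal a * q.interfTermP (x, b, m)) := hm1.comp measurable_prodMk_left
    rw [lintegral_prod _ hm2.aemeasurable]
    have hs := q.levelAt_nonneg q.powerP_pos.le x b
    change _ = φ (q.levelAt q.powerP x b)
    simp only [hφ]
    rw [← q.antP.lintegral_fading_gain (mul_nonneg ha (inv_nonneg.2 hs))]
    refine lintegral_congr fun h => lintegral_congr fun θ => ?_
    rw [interfTermP_eq, ← ENNReal.ofReal_mul ha]
    congr 3
    ring
  rw [lintegral_prod _ hm.aemeasurable, lintegral_smul_measure, smul_eq_mul]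
  simp_rw [h1]
  rw [q.lintegral_level q.powerP_pos hφm]
  congr 1
  have h2 : ∀ t, ∫⁻ u in Ioi (0 : ℝ),
      ENNReal.ofReal (q.p t (u * q.powerP ^ (1 / q.α t) * q.C t ^ (1 / q.α t)) * q.powerP ^ (2 / q.α t)) *
        ENNReal.ofReal (q.C t ^ (2 / q.α t)) * φ (u ^ q.α t) * ENNReal.ofReal u =
      ∫⁻ u in Ioi (0 : ℝ), q.M t u * (∑ k : Fin 2, ENNReal.ofReal (q.antP.weight k) *
        (1 + (ENNReal.ofReal (a * q.antP.lobe k))⁻¹ * ENNReal.ofReal (u ^ q.α t))⁻¹) * ENNReal.ofReal u := by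
    intro t
    refine setLIntegral_congr_fun measurableSet_Ioi fun u hu => ?_
    have hu0 : (0 : ℝ) < u := hu
    simp only [hφ]
    have hC := q.C_pos t
    rw [M, ENNReal.ofReal_mul' (show 0 ≤ q.C t ^ (2 / q.α t) by positivity)]
    congr 2
    refine Finset.sum_congr rfl fun k _ => ?_
    rw [← one_sub_inv_one_add (mul_nonneg ha (q.antP.lobe_nonneg k)) (by positivity)]
    rw [mul_right_comm a]
  simp_rw [h2]
  rw [q.antP.sum_lintegral_mixture _ (fun _ => Ioi 0) q.measurable_M (by intro k t; fun_prop)]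
  refine Finset.sum_congr rfl fun k _ => ?_
  simp only [FP, div_eq_mul_inv]

end NetParams

namespace Network

variable {q : NetParams} {Ω : Type*} [MeasurableSpace Ω] {P : Measure Ω} (N : Network q P)

/-- Laplace transform of the interference from the primary BSs. -/
lemma laplace_interfP [IsProbabilityMeasure P] {a : ℝ} (ha : 0 ≤ a) :
    ∫⁻ z, expNeg (ENNReal.ofReal a * ∑' i, q.interfTermP (z i))
        ∂(P.map fun ω i => (N.bsP i ω, N.blockP i ω, N.fadP i ω, N.angP i ω)) =
      expNeg (ENNReal.ofReal q.lamPT * ∑ k : Fin 2, ENNReal.ofReal (q.antP.weight k) *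
        q.FP (a * q.antP.lobe k)) := by
  simp_rw [← ENNReal.tsum_mul_left]
  rw [← q.lintegral_interfTermP ha]
  exact N.primary_law.poissonLaplace _ (q.measurable_interfTermP.const_mul _)

end Network

/-! ### Void probabilities and growth of the levels -/

section Void

variable {Ω : Type*} [MeasurableSpace Ω] {P : Measure Ω} {lam : ℝ} {X : ℕ → Ω → Plane}

lemma pointCount_eq_zero_iff {Ω : Type*} {X : ℕ → Ω → Plane} {B : Set Plane} {ω : Ω} :
    pointCount X B ω = (0 : ℕ) ↔ ∀ i, X i ω ∉ B := by
  rw [pointCount, Nat.cast_zero, Set.encard_eq_zero, Set.eq_empty_iff_forall_notMem]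
  rfl

lemma IsPPP.void_prob (h : IsPPP P lam X) {B : Set Plane} (hB : MeasurableSet B)
    (hB' : volume B ≠ ∞) (hlam : 0 ≤ lam) :
    P {ω | ∀ i, X i ω ∉ B} = ENNReal.ofReal (Real.exp (-(lam * (volume B).toReal))) := by
  have := h.poisson B hB hB' 0
  simp_rw [pointCount_eq_zero_iff] at this
  rw [this, poissonMeasure_singleton, Real.coe_toNNReal _ (mul_nonneg hlam ENNReal.toReal_nonneg)]
  simp

/-- A single point has zero area. Excluding it matters because 0^{-α} evaluates to 0, so a point at
the origin would count as the weakest link instead of the strongest. -/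
lemma IsPPP.ae_ne_zero [IsProbabilityMeasure P] (h : IsPPP P lam X) (hlam : 0 ≤ lam) :
    ∀ᵐ ω ∂P, ∀ i, X i ω ≠ 0 := by
  have h1 := h.void_prob (measurableSet_singleton (0 : Plane)) (by simp) hlam
  have hm : MeasurableSet {ω | ∀ i, X i ω ∉ ({0} : Set Plane)} := by
    simp_rw [Set.ofPred_forall]
    exact MeasurableSet.iInter fun i => (h.measurable i (measurableSet_singleton 0)).compl
  rw [show (volume : Measure Plane) {0} = 0 by simp] at h1
  simp only [ENNReal.toReal_zero, mul_zero, neg_zero, Real.exp_zero, ENNReal.ofReal_one] at h1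
  exact (prob_compl_eq_zero_iff hm).2 h1

end Void

namespace NetParams

variable (q : NetParams)

lemma normPower_eq_level (r : ℝ) (t : LinkType) : q.normPower r t = q.level 1 t r := by
  rw [normPower, level, mul_one]

lemma measurable_normPower : Measurable fun y : ℝ × LinkType => q.normPower y.1 y.2 := by
  simp_rw [normPower_eq_level]
  exact q.measurable_level.comp (measurable_const.prodMk (measurable_snd.prodMk measurable_fst))

/-- Polynomial growth of the levels. -/
lemma exists_level_le : ∃ (D : ℝ) (k : ℕ), 0 ≤ D ∧ ∀ t r, 0 ≤ r → q.level 1 t r ≤ D * (1 + r) ^ k := by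
  refine ⟨1 / q.C .LOS + 1 / q.C .NLOS, ⌈max (q.α .LOS) (q.α .NLOS)⌉₊, ?_, fun t r hr => ?_⟩
  · have h1 := q.C_pos .LOS
    have h2 := q.C_pos .NLOS
    positivity
  · have h1 := one_div_pos.2 (q.C_pos .LOS)
    have h2 := one_div_pos.2 (q.C_pos .NLOS)
    have hC : 1 / q.C t ≤ 1 / q.C .LOS + 1 / q.C .NLOS := by
      cases t <;> linarith
    have hα : q.α t ≤ (⌈max (q.α .LOS) (q.α .NLOS)⌉₊ : ℕ) := by
      refine le_trans ?_ (Nat.le_ceil _)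
      cases t
      · exact le_max_left _ _
      · exact le_max_right _ _
    have h3 : r ^ q.α t ≤ (1 + r) ^ ⌈max (q.α .LOS) (q.α .NLOS)⌉₊ := by
      rw [← Real.rpow_natCast]
      calc r ^ q.α t ≤ (1 + r) ^ q.α t := Real.rpow_le_rpow hr (by linarith) (q.α_pos t).le
        _ ≤ _ := Real.rpow_le_rpow_of_exponent_le (by linarith) hα
    rw [level, mul_one, div_eq_mul_one_div, mul_comm]
    gcongr

end NetParams

lemma summable_mul_pow_exp_neg_sq (D : ℝ) (k : ℕ) {c : ℝ} (hc : 0 < c) :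
    Summable fun n : ℕ => D * ((n : ℝ) + 2) ^ k * Real.exp (-(c * (n : ℝ) ^ 2)) := by
  have h1 := (summable_nat_add_iff 2).2 (Real.summable_pow_mul_exp_neg_nat_mul k hc)
  have h2 := h1.mul_left (|D| * Real.exp (2 * c))
  refine Summable.of_norm_bounded h2 fun n => ?_
  -- Valid for natural numbers. It bounds the Gaussian factor by a geometric one, and the shift from
  -- n to n + 2 costs the factor e^{2c}.
  have hn : (n : ℝ) ≤ (n : ℝ) ^ 2 := by
    rcases Nat.eq_zero_or_pos n with rfl | h
    · simp
    · have : (1 : ℝ) ≤ n := by exact_mod_cast h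
      nlinarith
  have h3 : Real.exp (-(c * (n : ℝ) ^ 2)) ≤ Real.exp (2 * c) * Real.exp (-c * ((n + 2 : ℕ) : ℝ)) := by
    rw [← Real.exp_add]
    apply Real.exp_le_exp.2
    push_cast
    nlinarith
  rw [norm_mul, norm_mul, Real.norm_eq_abs, norm_pow, Real.norm_of_nonneg (by positivity : (0 : ℝ) ≤ n + 2),
    Real.norm_of_nonneg (Real.exp_pos _).le]
  calc |D| * ((n : ℝ) + 2) ^ k * Real.exp (-(c * (n : ℝ) ^ 2))
      ≤ |D| * ((n : ℝ) + 2) ^ k * (Real.exp (2 * c) * Real.exp (-c * ((n + 2 : ℕ) : ℝ))) := by gcongr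
    _ = _ := by push_cast; ring

/-! ### The home link: moments of the transmit power and the functions K -/

namespace Network

variable {q : NetParams} {Ω : Type*} [MeasurableSpace Ω] {P : Measure Ω} (N : Network q P)

/-- Normalized transmit power of a secondary BS at the origin. -/
noncomputable def homePower (ω : Ω) : ℝ := q.normPower (N.homeDist ω) (N.homeType ω)

/-- Received power at unit transmit power is the reciprocal of the level, so the home user minimizes
the level, and the normalized power equals that minimum. -/
lemma ae_homePower [IsProbabilityMeasure P] : ∀ᵐ ω ∂P, 0 < N.homePower ω ∧
    ∀ k, N.homePower ω ≤ q.level 1 (q.linkType ‖N.user k ω‖ (N.userBlock k ω)) ‖N.user k ω‖ := by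
  filter_upwards [N.home_spec, N.users_law.ppp.ae_ne_zero q.lamPR_pos.le] with ω ⟨j, hj, h1, h2⟩ h0
  have hpos : ∀ k, 0 < q.level 1 (q.linkType ‖N.user k ω‖ (N.userBlock k ω)) ‖N.user k ω‖ := fun k =>
    q.levelAt_pos one_pos (h0 k) _
  have hp : ∀ k, q.pathLoss (q.linkType ‖N.user k ω‖ (N.userBlock k ω)) ‖N.user k ω‖ =
      (q.level 1 (q.linkType ‖N.user k ω‖ (N.userBlock k ω)) ‖N.user k ω‖)⁻¹ := fun k => by
    rw [← q.mul_pathLoss 1 _ (norm_nonneg _), one_mul]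
  have e : N.homePower ω = q.level 1 (q.linkType ‖N.user j ω‖ (N.userBlock j ω)) ‖N.user j ω‖ := by
    rw [homePower, q.normPower_eq_level, h1, h2]
  refine ⟨e ▸ hpos j, fun k => ?_⟩
  have := hj k
  rw [hp, hp] at this
  rw [e]
  exact (inv_le_inv₀ (hpos k) (hpos j)).1 this

/-- All moments of the transmit power of a secondary BS are finite. -/
lemma lintegral_homePower_rpow_lt_top [IsProbabilityMeasure P] {β : ℝ} (hβ : 0 < β) :
    ∫⁻ ω, ENNReal.ofReal (N.homePower ω ^ β) ∂P < ∞ := by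
  obtain ⟨D, k, hD, hlev⟩ := q.exists_level_le
  set V : ℕ → Set Ω := fun n => {ω | ∀ i, N.user i ω ∉ Metric.ball (0 : Plane) n} with hV
  have hVm : ∀ n, MeasurableSet (V n) := fun n => by
    simp only [hV, Set.ofPred_forall]
    exact MeasurableSet.iInter fun i =>
      (N.users_law.ppp.measurable i Metric.isOpen_ball.measurableSet).compl
  set m : ℕ := ⌈k * β⌉₊
  have hle : ∀ᵐ ω ∂P, ENNReal.ofReal (N.homePower ω ^ β) ≤
      ∑' n : ℕ, (V n).indicator (fun _ => ENNReal.ofReal (D ^ β * ((n : ℝ) + 2) ^ m)) ω := by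
    filter_upwards [N.ae_homePower] with ω ⟨hpos, hω⟩
    classical
    -- Let n + 1 be the least integer radius of a ball containing a user. The ball of radius n is
    -- empty, an event of probability e^{-λπn²}, while some user lies within n + 1, so the power is
    -- at most D(n+2)^k.
    have hex : ∃ n : ℕ, ∃ i, ‖N.user i ω‖ < n := by
      obtain ⟨n, hn⟩ := exists_nat_gt ‖N.user 0 ω‖
      exact ⟨n, 0, hn⟩
    obtain ⟨i, hi⟩ := Nat.find_spec hex
    obtain ⟨n, hn⟩ : ∃ n, Nat.find hex = n + 1 := by
      refine Nat.exists_eq_succ_of_ne_zero fun h0 => ?_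
      rw [h0, Nat.cast_zero] at hi
      exact absurd hi (norm_nonneg _).not_gt
    rw [hn] at hi
    have hmem : ω ∈ V n := fun j hj => by
      have : n < Nat.find hex := by omega
      exact Nat.find_min hex this ⟨j, mem_ball_zero_iff.1 hj⟩
    refine le_trans ?_ (ENNReal.le_tsum n)
    rw [indicator_of_mem hmem]
    apply ENNReal.ofReal_le_ofReal
    have h1 : N.homePower ω ≤ D * ((n : ℝ) + 2) ^ k := by
      refine ((hω i).trans (hlev _ _ (norm_nonneg _))).trans ?_
      push_cast at hi
      exact mul_le_mul_of_nonneg_left (pow_le_pow_left₀ (by positivity) (by linarith) _) hD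
    calc N.homePower ω ^ β ≤ (D * ((n : ℝ) + 2) ^ k) ^ β := Real.rpow_le_rpow hpos.le h1 hβ.le
      _ = D ^ β * ((n : ℝ) + 2) ^ (k * β) := by
        rw [Real.mul_rpow hD (by positivity), ← Real.rpow_natCast, ← Real.rpow_mul (by positivity)]
      _ ≤ D ^ β * ((n : ℝ) + 2) ^ m := by
        gcongr
        rw [← Real.rpow_natCast]
        exact Real.rpow_le_rpow_of_exponent_le (by linarith [Nat.cast_nonneg (α := ℝ) n]) (Nat.le_ceil _)
  refine (lintegral_mono_ae hle).trans_lt ?_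
  rw [lintegral_tsum fun n => (measurable_const.indicator (hVm n)).aemeasurable]
  have e : ∀ n : ℕ, ∫⁻ ω, (V n).indicator (fun _ => ENNReal.ofReal (D ^ β * ((n : ℝ) + 2) ^ m)) ω ∂P =
      ENNReal.ofReal (D ^ β * ((n : ℝ) + 2) ^ m * Real.exp (-(q.lamPR * Real.pi * (n : ℝ) ^ 2))) := by
    intro n
    rw [lintegral_indicator_const (hVm n), hV,
      N.users_law.ppp.void_prob Metric.isOpen_ball.measurableSet measure_ball_lt_top.ne q.lamPR_pos.le,
      EuclideanSpace.volume_ball_fin_two, ← ENNReal.ofReal_mul (by positivity)]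
    congr 4
    simp [Real.pi_pos.le]
    ring
  simp_rw [e]
  have hs := summable_mul_pow_exp_neg_sq (D ^ β) m (mul_pos q.lamPR_pos Real.pi_pos)
  rw [← ENNReal.ofReal_tsum_of_nonneg (fun n => by positivity) hs]
  exact ENNReal.ofReal_lt_top

/-- Since p_t ≤ 1, the moment of order 2/α_t of the transmit power bounds K_t uniformly. -/
lemma K_le [IsProbabilityMeasure P] (t : LinkType) : ∃ c : ℝ≥0∞, c ≠ ∞ ∧ ∀ u, 0 ≤ u → N.K t u ≤ c := by
  refine ⟨(∫⁻ ω, ENNReal.ofReal (N.homePower ω ^ (2 / q.α t)) ∂P) * ENNReal.ofReal (q.C t ^ (2 / q.α t)),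
    ENNReal.mul_ne_top (N.lintegral_homePower_rpow_lt_top (div_pos two_pos (q.α_pos t))).ne
      ENNReal.ofReal_ne_top, fun u hu => ?_⟩
  unfold K
  gcongr ?_ * _
  refine lintegral_mono_ae ?_
  filter_upwards [N.ae_homePower] with ω ⟨hpos, _⟩
  apply ENNReal.ofReal_le_ofReal
  have hC := q.C_pos t
  change _ ≤ N.homePower ω ^ (2 / q.α t)
  refine mul_le_of_le_one_left (Real.rpow_nonneg hpos.le _) (q.p_le_one t ?_)
  change 0 ≤ u * N.homePower ω ^ (1 / q.α t) * q.C t ^ (1 / q.α t)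
  positivity

/-- Law of the home link of a secondary BS. -/
noncomputable def homeLaw : Measure (ℝ × LinkType) := P.map fun ω => (N.homeDist ω, N.homeType ω)

instance [IsProbabilityMeasure P] : IsProbabilityMeasure N.homeLaw :=
  Measure.isProbabilityMeasure_map N.home_measurable.aemeasurable

lemma measurable_K_integrand (t : LinkType) : Measurable fun y : ℝ × ℝ × LinkType =>
    ENNReal.ofReal (q.p t (y.1 * q.normPower y.2.1 y.2.2 ^ (1 / q.α t) * q.C t ^ (1 / q.α t)) *
      q.normPower y.2.1 y.2.2 ^ (2 / q.α t)) := by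
  have h1 : Measurable fun y : ℝ × ℝ × LinkType => q.normPower y.2.1 y.2.2 :=
    q.measurable_normPower.comp measurable_snd
  have h2 := q.measurable_p t
  fun_prop

lemma K_eq (t : LinkType) (u : ℝ) : N.K t u =
    ∫⁻ y, ENNReal.ofReal (q.p t (u * q.normPower y.1 y.2 ^ (1 / q.α t) * q.C t ^ (1 / q.α t)) *
      q.normPower y.1 y.2 ^ (2 / q.α t)) * ENNReal.ofReal (q.C t ^ (2 / q.α t)) ∂N.homeLaw := by
  have hm : Measurable fun y : ℝ × LinkType =>
      ENNReal.ofReal (q.p t (u * q.normPower y.1 y.2 ^ (1 / q.α t) * q.C t ^ (1 / q.α t)) *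
      q.normPower y.1 y.2 ^ (2 / q.α t)) :=
    (measurable_K_integrand t).comp (measurable_const.prodMk measurable_id)
  rw [lintegral_mul_const _ hm, homeLaw, lintegral_map hm N.home_measurable, K]

lemma measurable_K [IsProbabilityMeasure P] (t : LinkType) : Measurable (N.K t) := by
  have : N.K t = fun u => _ := funext fun u => N.K_eq t u
  rw [this]
  exact ((measurable_K_integrand t).mul_const _).lintegral_prod_right'

lemma ae_homeLaw [IsProbabilityMeasure P] : ∀ᵐ y ∂N.homeLaw, 0 < q.normPower y.1 y.2 := by
  rw [homeLaw, ae_map_iff N.home_measurable.aemeasurable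
    (measurableSet_lt measurable_const q.measurable_normPower)]
  filter_upwards [N.ae_homePower] with ω h using h.1

end Network

/-- A secondary BS with its marks: blocking variable, fading, angle, home distance and type. -/
abbrev SPoint := Plane × ℝ × ℝ × ℝ × ℝ × LinkType

/-! ### Level, interference and exponent of a secondary BS -/

namespace NetParams

variable (q : NetParams)

/-- Level of a secondary BS. -/
noncomputable def levelS (w : SPoint) : ℝ :=
  q.levelAt (q.normPower w.2.2.2.2.1 w.2.2.2.2.2) w.1 w.2.1

lemma measurable_levelS : Measurable q.levelS :=
  measurable_levelAt (q.measurable_normPower.comp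
    (measurable_snd.comp (measurable_snd.comp (measurable_snd.comp measurable_snd))))
    measurable_fst (measurable_fst.comp measurable_snd)

/-- Interference caused by a secondary BS. -/
noncomputable def interfTermS (w : SPoint) : ℝ≥0∞ :=
  ENNReal.ofReal (q.xi * q.normPower w.2.2.2.2.1 w.2.2.2.2.2 * q.antS.gain w.2.2.2.1 * w.2.2.1 *
    q.pathLoss (q.linkType ‖w.1‖ w.2.1) ‖w.1‖)

lemma interfTermS_eq (w : SPoint) : q.interfTermS w =
    ENNReal.ofReal (q.xi * (q.levelS w)⁻¹ * q.antS.gain w.2.2.2.1 * w.2.2.1) := by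
  rw [interfTermS, levelS, ← q.mul_pathLoss_eq]
  congr 1; ring

lemma measurable_interfTermS : Measurable q.interfTermS := by
  have e : q.interfTermS = fun w =>
      ENNReal.ofReal (q.xi * (q.levelS w)⁻¹ * q.antS.gain w.2.2.2.1 * w.2.2.1) :=
    funext q.interfTermS_eq
  rw [e]
  have h1 := q.measurable_levelS
  have h2 : Measurable fun w : SPoint => q.antS.gain w.2.2.2.1 :=
    q.antS.measurable_gain.comp (measurable_fst.comp (measurable_snd.comp (measurable_snd.comp measurable_snd)))
  have h3 : Measurable fun w : SPoint => w.2.2.1 := measurable_fst.comp (measurable_snd.comp measurable_snd)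
  exact (((h1.inv.const_mul _).mul h2).mul h3).ennreal_ofReal

/-- Exponent of the interference and of the exclusion of stronger BSs when the tagged BS has
level `σ`. -/
noncomputable def exponentS (τ σ : ℝ) (w : SPoint) : ℝ≥0∞ :=
  (if q.levelS w < σ then ∞ else 0) +
    ENNReal.ofReal (τ * σ / (q.xi * q.antS.main)) * q.interfTermS w

lemma measurable_exponentS (τ : ℝ) : Measurable (Function.uncurry (q.exponentS τ)) := by
  unfold exponentS
  have h1 : Measurable fun y : ℝ × SPoint => q.levelS y.2 := q.measurable_levelS.comp measurable_snd
  have h2 : Measurable fun y : ℝ × SPoint => q.interfTermS y.2 :=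
    q.measurable_interfTermS.comp measurable_snd
  exact (Measurable.ite (measurableSet_lt h1 measurable_fst) measurable_const measurable_const).add
    (((measurable_fst.const_mul _).div_const _).ennreal_ofReal.mul h2)

lemma exponentS_ne_top (τ : ℝ) (w : SPoint) {σ : ℝ} (h : σ ≤ q.levelS w) : q.exponentS τ σ w ≠ ∞ := by
  rw [exponentS, if_neg h.not_gt, interfTermS]
  finiteness

lemma exponentS_mono {τ : ℝ} (hτ : 0 ≤ τ) (w : SPoint) : Monotone fun σ => q.exponentS τ σ w := by
  intro σ σ' h
  have h1 := q.xi_pos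
  have h2 := q.antS.main_pos
  simp only [exponentS]
  gcongr ?_ + ENNReal.ofReal ?_ * _
  · split_ifs with h3 h4
    · exact le_rfl
    · exact absurd (h3.trans_le h) h4
    · exact zero_le
    · exact le_rfl
  · gcongr

/-- The strict inequality in the exclusion term makes its jump left-continuous: a level below r is
eventually below σ n, and a level at least r is never below it. -/
lemma exponentS_left_cont (τ : ℝ) (w : SPoint) (σ : ℕ → ℝ) (r : ℝ) (h : ∀ n, σ n ≤ r)
    (hσ : Tendsto σ atTop (𝓝 r)) :
    Tendsto (fun n => q.exponentS τ (σ n) w) atTop (𝓝 (q.exponentS τ r w)) := by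
  by_cases hw : q.levelS w < r
  · rw [exponentS, if_pos hw, top_add]
    refine tendsto_const_nhds.congr' ?_
    filter_upwards [hσ.eventually_const_lt hw] with n hn
    rw [exponentS, if_pos hn, top_add]
  · have e : ∀ n, q.exponentS τ (σ n) w =
        ENNReal.ofReal (τ * σ n / (q.xi * q.antS.main)) * q.interfTermS w := fun n => by
      rw [exponentS, if_neg (fun h' => hw (h'.trans_le (h n))), zero_add]
    simp_rw [e]
    rw [exponentS, if_neg hw, zero_add]
    refine ENNReal.Tendsto.mul_const (ENNReal.tendsto_ofReal ((hσ.const_mul τ).div_const _)) (Or.inr ?_)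
    rw [interfTermS]
    finiteness

end NetParams

/-! ### Intensity of the levels of the secondary BSs -/

namespace Network

variable {q : NetParams} {Ω : Type*} [MeasurableSpace Ω] {P : Measure Ω} (N : Network q P)

/-- Law of the marks of the secondary BSs. -/
noncomputable def markLawS : Measure (ℝ × ℝ × ℝ × ℝ × LinkType) :=
  unitLaw.prod (fadingLaw.prod (angleLaw.prod N.homeLaw))

/-- Intensity measure of the marked secondary BSs. -/
noncomputable def intensityS : Measure SPoint := (ENNReal.ofReal q.lamST • volume).prod N.markLawS

variable [IsProbabilityMeasure P]

instance : IsProbabilityMeasure N.markLawS := by unfold markLawS; infer_instance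

instance : SFinite N.intensityS := by unfold intensityS; infer_instance

/-- Distribution of the levels of the secondary BSs. -/
lemma lintegral_intensityS {F : ℝ → ℝ → ℝ → ℝ≥0∞}
    (hF : Measurable fun y : ℝ × ℝ × ℝ => F y.1 y.2.1 y.2.2) :
    ∫⁻ w, F (q.levelS w) w.2.2.1 w.2.2.2.1 ∂N.intensityS =
      ENNReal.ofReal (2 * Real.pi * q.lamST) * ∑ t : LinkType, ∫⁻ u in Ioi (0 : ℝ),
        N.K t u * (∫⁻ h, ∫⁻ θ, F (u ^ q.α t) h θ ∂angleLaw ∂fadingLaw) * ENNReal.ofReal u := by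
  -- Fading and angle are integrated first, leaving a function of the level. Position and blocking
  -- come next, for a fixed home link, and the home link last, which produces K.
  obtain ⟨φ, hφ⟩ : ∃ φ : ℝ → ℝ≥0∞, φ = fun s => ∫⁻ h, ∫⁻ θ, F s h θ ∂angleLaw ∂fadingLaw := ⟨_, rfl⟩
  have hφm : Measurable φ := by
    have h1 : Measurable fun y : (ℝ × ℝ) × ℝ => F y.1.1 y.1.2 y.2 :=
      hF.comp ((measurable_fst.comp measurable_fst).prodMk
        ((measurable_snd.comp measurable_fst).prodMk measurable_snd))
    have h2 : Measurable fun y : ℝ × ℝ => ∫⁻ θ, F y.1 y.2 θ ∂angleLaw := h1.lintegral_prod_right'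
    rw [hφ]
    exact h2.lintegral_prod_right'
  have hFw : Measurable fun w : SPoint => F (q.levelS w) w.2.2.1 w.2.2.2.1 :=
    hF.comp (q.measurable_levelS.prodMk ((measurable_fst.comp (measurable_snd.comp measurable_snd)).prodMk
      (measurable_fst.comp (measurable_snd.comp (measurable_snd.comp measurable_snd)))))
  have hin : ∀ (x : Plane) (b : ℝ), ∫⁻ m, F (q.levelS (x, b, m)) m.1 m.2.1
      ∂(fadingLaw.prod (angleLaw.prod N.homeLaw)) =
      ∫⁻ y, φ (q.levelAt (q.normPower y.1 y.2) x b) ∂N.homeLaw := by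
    intro x b
    have hl : Measurable fun y : ℝ × LinkType => q.levelAt (q.normPower y.1 y.2) x b :=
      NetParams.measurable_levelAt q.measurable_normPower measurable_const measurable_const
    have m1 : Measurable fun m : ℝ × ℝ × ℝ × LinkType => F (q.levelS (x, b, m)) m.1 m.2.1 :=
      hFw.comp ((measurable_prodMk_left).comp measurable_prodMk_left)
    have m2 : ∀ h, Measurable fun m : ℝ × ℝ × LinkType => F (q.levelS (x, b, h, m)) h m.1 := fun h =>
      m1.comp measurable_prodMk_left
    rw [lintegral_prod _ m1.aemeasurable]
    have e : ∀ h, ∫⁻ m, F (q.levelS (x, b, h, m)) h m.1 ∂(angleLaw.prod N.homeLaw) =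
        ∫⁻ y, ∫⁻ θ, F (q.levelAt (q.normPower y.1 y.2) x b) h θ ∂angleLaw ∂N.homeLaw := by
      intro h
      rw [lintegral_prod_symm _ (m2 h).aemeasurable]
      rfl
    simp_rw [e, hφ]
    refine lintegral_lintegral_swap (f := fun h (y : ℝ × LinkType) =>
      ∫⁻ θ, F (q.levelAt (q.normPower y.1 y.2) x b) h θ ∂angleLaw) (Measurable.aemeasurable ?_)
    have h1 : Measurable fun y : (ℝ × ℝ × LinkType) × ℝ =>
        F (q.levelAt (q.normPower y.1.2.1 y.1.2.2) x b) y.1.1 y.2 :=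
      hF.comp ((hl.comp (measurable_snd.comp measurable_fst)).prodMk
        ((measurable_fst.comp measurable_fst).prodMk measurable_snd))
    exact h1.lintegral_prod_right'
  have hlxb : Measurable fun y : (Plane × ℝ × LinkType) × ℝ =>
      φ (q.levelAt (q.normPower y.1.2.1 y.1.2.2) y.1.1 y.2) :=
    hφm.comp (NetParams.measurable_levelAt (q.measurable_normPower.comp (measurable_snd.comp measurable_fst))
      (measurable_fst.comp measurable_fst) measurable_snd)
  have hmarks : ∀ x : Plane, ∫⁻ m, F (q.levelS (x, m)) m.2.1 m.2.2.1 ∂N.markLawS =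
      ∫⁻ y, ∫⁻ b, φ (q.levelAt (q.normPower y.1 y.2) x b) ∂unitLaw ∂N.homeLaw := by
    intro x
    have m1 : Measurable fun m : ℝ × ℝ × ℝ × ℝ × LinkType => F (q.levelS (x, m)) m.2.1 m.2.2.1 :=
      hFw.comp measurable_prodMk_left
    rw [markLawS, lintegral_prod _ m1.aemeasurable]
    simp_rw [hin x]
    refine lintegral_lintegral_swap (f := fun b (y : ℝ × LinkType) =>
      φ (q.levelAt (q.normPower y.1 y.2) x b)) (Measurable.aemeasurable ?_)
    exact hφm.comp (NetParams.measurable_levelAt (q.measurable_normPower.comp measurable_snd) measurable_const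
      measurable_fst)
  rw [intensityS, lintegral_prod _ hFw.aemeasurable, lintegral_smul_measure, smul_eq_mul]
  simp_rw [hmarks]
  rw [lintegral_lintegral_swap (f := fun (x : Plane) (y : ℝ × LinkType) =>
    ∫⁻ b, φ (q.levelAt (q.normPower y.1 y.2) x b) ∂unitLaw) hlxb.lintegral_prod_right'.aemeasurable]
  -- The radial formula needs a positive transmit power, which holds only almost surely.
  have hradial : ∀ᵐ y ∂N.homeLaw,
      ∫⁻ x : Plane, ∫⁻ b, φ (q.levelAt (q.normPower y.1 y.2) x b) ∂unitLaw =
      ENNReal.ofReal (2 * Real.pi) * ∑ t : LinkType, ∫⁻ u in Ioi (0 : ℝ),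
        ENNReal.ofReal (q.p t (u * q.normPower y.1 y.2 ^ (1 / q.α t) * q.C t ^ (1 / q.α t)) *
          q.normPower y.1 y.2 ^ (2 / q.α t)) *
          ENNReal.ofReal (q.C t ^ (2 / q.α t)) * φ (u ^ q.α t) * ENNReal.ofReal u := by
    filter_upwards [N.ae_homeLaw] with y hy
    exact q.lintegral_level hy hφm
  rw [lintegral_congr_ae hradial]
  have hkm : ∀ t, Measurable fun y : (ℝ × LinkType) × ℝ =>
      ENNReal.ofReal (q.p t (y.2 * q.normPower y.1.1 y.1.2 ^ (1 / q.α t) * q.C t ^ (1 / q.α t)) *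
          q.normPower y.1.1 y.1.2 ^ (2 / q.α t)) *
          ENNReal.ofReal (q.C t ^ (2 / q.α t)) * φ (y.2 ^ q.α t) * ENNReal.ofReal y.2 := fun t =>
    ((((measurable_K_integrand t).comp (measurable_snd.prodMk measurable_fst)).mul_const _).mul
      (hφm.comp (measurable_snd.pow_const _))).mul measurable_snd.ennreal_ofReal
  rw [lintegral_const_mul' _ _ ENNReal.ofReal_ne_top,
    lintegral_finsetSum _ fun t _ => (hkm t).lintegral_prod_right', ← mul_assoc,
    ← ENNReal.ofReal_mul q.lamST_pos.le, mul_comm q.lamST]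
  congr 1
  refine Finset.sum_congr rfl fun t _ => ?_
  rw [lintegral_lintegral_swap (hkm t).aemeasurable]
  refine lintegral_congr fun u => ?_
  rw [← show φ (u ^ q.α t) = _ from congrFun hφ _, N.K_eq]
  have hk1 : Measurable fun y : ℝ × LinkType =>
      ENNReal.ofReal (q.p t (u * q.normPower y.1 y.2 ^ (1 / q.α t) * q.C t ^ (1 / q.α t)) *
          q.normPower y.1 y.2 ^ (2 / q.α t)) * ENNReal.ofReal (q.C t ^ (2 / q.α t)) :=
    ((measurable_K_integrand t).comp (measurable_const.prodMk measurable_id)).mul_const _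
  simp only
  rw [lintegral_mul_const _ (hk1.mul_const _), lintegral_mul_const _ hk1]

lemma lintegral_intensityS_level {f : ℝ → ℝ≥0∞} (hf : Measurable f) :
    ∫⁻ w, f (q.levelS w) ∂N.intensityS =
      ENNReal.ofReal (2 * Real.pi * q.lamST) * ∑ t : LinkType, ∫⁻ u in Ioi (0 : ℝ),
        N.K t u * f (u ^ q.α t) * ENNReal.ofReal u := by
  have := N.lintegral_intensityS (F := fun s _ _ => f s) (hf.comp measurable_fst)
  simpa using this

/-- The condition u^α ≤ n confines u to a bounded interval, on which K is bounded. -/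
lemma intensityS_level_le_ne_top (n : ℕ) : N.intensityS {w | q.levelS w ≤ n} ≠ ∞ := by
  have hS : MeasurableSet {w | q.levelS w ≤ n} := measurableSet_le q.measurable_levelS measurable_const
  have e := N.lintegral_intensityS_level (f := (Iic (n : ℝ)).indicator 1) (measurable_one.indicator measurableSet_Iic)
  have e2 : ∫⁻ w, (Iic (n : ℝ)).indicator 1 (q.levelS w) ∂N.intensityS = N.intensityS {w | q.levelS w ≤ n} := by
    rw [← lintegral_indicator_one hS]; rfl
  rw [← e2, e]
  refine ENNReal.mul_ne_top ENNReal.ofReal_ne_top (ENNReal.sum_ne_top.2 fun t _ => ?_)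
  obtain ⟨c, hc, hK⟩ := N.K_le t
  set m : ℝ := (n : ℝ) ^ (1 / q.α t)
  have hbound : ∫⁻ u in Ioi (0 : ℝ), N.K t u * (Iic (n : ℝ)).indicator 1 (u ^ q.α t) * ENNReal.ofReal u ≤
      ∫⁻ u in Ioi (0 : ℝ), (Ioc 0 m).indicator (fun _ => c * ENNReal.ofReal m) u := by
    refine setLIntegral_mono' measurableSet_Ioi fun u hu => ?_
    have hu0 : (0 : ℝ) < u := hu
    by_cases h : u ^ q.α t ≤ n
    · have hum : u ≤ m := by
        have := Real.rpow_le_rpow (by positivity) h (one_div_nonneg.2 (q.α_pos t).le)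
        rwa [← Real.rpow_mul hu0.le, mul_one_div_cancel (q.α_pos t).ne', Real.rpow_one] at this
      rw [indicator_of_mem (show u ^ q.α t ∈ Iic (n : ℝ) from h),
        indicator_of_mem (show u ∈ Ioc 0 m from ⟨hu0, hum⟩), Pi.one_apply, mul_one]
      exact mul_le_mul' (hK u hu0.le) (ENNReal.ofReal_le_ofReal hum)
    · rw [indicator_of_notMem (show u ^ q.α t ∉ Iic (n : ℝ) from h)]
      simp
  refine ne_top_of_le_ne_top ?_ (hbound.trans (setLIntegral_le_lintegral _ _))
  rw [lintegral_indicator_const measurableSet_Ioc, Real.volume_Ioc]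
  finiteness

/-- For each link type at most one positive u has u^α = r, and it is null for the density in u. -/
lemma intensityS_level_eq (r : ℝ) : N.intensityS {w | q.levelS w = r} = 0 := by
  have hS : MeasurableSet {w | q.levelS w = r} := measurableSet_eq_fun q.measurable_levelS measurable_const
  have e := N.lintegral_intensityS_level (f := ({r} : Set ℝ).indicator 1)
    (measurable_one.indicator (measurableSet_singleton r))
  have e2 : ∫⁻ w, ({r} : Set ℝ).indicator 1 (q.levelS w) ∂N.intensityS = N.intensityS {w | q.levelS w = r} := by
    rw [← lintegral_indicator_one hS]; rfl
  rw [← e2, e]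
  refine mul_eq_zero_of_right _ (Finset.sum_eq_zero fun t _ => ?_)
  rw [← lintegral_zero (μ := (volume : Measure ℝ).restrict (Ioi 0))]
  refine lintegral_congr_ae ?_
  have hne : ∀ᵐ u ∂(volume : Measure ℝ).restrict (Ioi 0), u ≠ r ^ (1 / q.α t) :=
    ae_restrict_of_ae (Measure.ae_ne volume _)
  filter_upwards [hne, ae_restrict_mem measurableSet_Ioi] with u hu hu0
  rw [indicator_of_notMem]
  · simp
  · intro h
    refine hu ?_
    rw [← show u ^ q.α t = r from h, ← Real.rpow_mul (le_of_lt hu0), mul_one_div_cancel (q.α_pos t).ne',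
      Real.rpow_one]

lemma intensityS_level_nonpos : N.intensityS {w | q.levelS w ≤ 0} = 0 := by
  have hS : MeasurableSet {w | q.levelS w ≤ 0} := measurableSet_le q.measurable_levelS measurable_const
  have e := N.lintegral_intensityS_level (f := (Iic (0 : ℝ)).indicator 1)
    (measurable_one.indicator measurableSet_Iic)
  have e2 : ∫⁻ w, (Iic (0 : ℝ)).indicator 1 (q.levelS w) ∂N.intensityS = N.intensityS {w | q.levelS w ≤ 0} := by
    rw [← lintegral_indicator_one hS]; rfl
  rw [← e2, e]
  refine mul_eq_zero_of_right _ (Finset.sum_eq_zero fun t _ => ?_)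
  rw [← lintegral_zero (μ := (volume : Measure ℝ).restrict (Ioi 0))]
  refine setLIntegral_congr_fun measurableSet_Ioi fun u hu => ?_
  have hu0 : (0 : ℝ) < u := hu
  have : u ^ q.α t ∉ Iic (0 : ℝ) := not_le.2 (Real.rpow_pos_of_pos hu0 _)
  simp [indicator_of_notMem this]

end Network

lemma PoissonLaplace.ae_notMem {E : Type*} [MeasurableSpace E] {Q : Measure (ℕ → E)} {μ : Measure E}
    [IsProbabilityMeasure Q] (hQ : PoissonLaplace Q μ) {A : Set E} (hA : MeasurableSet A) (hμ : μ A = 0) :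
    ∀ᵐ z ∂Q, ∀ i, z i ∉ A := by
  have hm : Measurable (A.indicator (1 : E → ℝ≥0∞)) := measurable_one.indicator hA
  have h := hQ.mean hm
  have hS : Measurable fun z : ℕ → E => ∑' i, A.indicator (1 : E → ℝ≥0∞) (z i) :=
    Measurable.tsum fun i => hm.comp (measurable_pi_apply i)
  rw [lintegral_indicator_one hA, hμ, lintegral_eq_zero_iff hS] at h
  filter_upwards [h] with z hz i hi
  have := ENNReal.tsum_eq_zero.1 hz i
  simp [hi] at this

/-- Total exponent of the points other than the `i`-th when an infinite exponent stands for a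
constraint. -/
lemma expNeg_sumOthers_ite (i : ℕ) (p : ℕ → Prop) [DecidablePred p] :
    expNeg (sumOthers i fun j => if p j then ∞ else 0) = {_x : Unit | ∀ j, j ≠ i → ¬ p j}.indicator 1 () := by
  by_cases h : ∀ j, j ≠ i → ¬ p j
  · rw [indicator_of_mem (by exact h), Pi.one_apply, ← expNeg_zero]
    congr 1
    refine ENNReal.tsum_eq_zero.2 fun j => ?_
    by_cases hj : j = i
    · simp [hj]
    · simp [hj, h j hj]
  · rw [indicator_of_notMem (by exact h)]
    push Not at h
    obtain ⟨j, hj, hp⟩ := h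
    rw [← expNeg_top]
    congr 1
    refine ENNReal.tsum_eq_top_of_eq_top ⟨j, ?_⟩
    simp [hj, hp]

/-! ### The Laplace exponent and the laws of the two networks -/

namespace Network

variable {q : NetParams} {Ω : Type*} [MeasurableSpace Ω] {P : Measure Ω} (N : Network q P)
  [IsProbabilityMeasure P]

/-- Exponent of the secondary interference and of the exclusion of stronger BSs. -/
lemma lintegral_exponentS {τ σ : ℝ} (hτ : 0 < τ) (hσ : 0 < σ) :
    ∫⁻ w, (1 - expNeg (q.exponentS τ σ w)) ∂N.intensityS =
      ENNReal.ofReal q.lamST * ∑ k : Fin 2, ENNReal.ofReal (q.antS.weight k) *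
        N.FS (τ * σ * q.antS.lobe k / q.antS.main) σ +
      ENNReal.ofReal (2 * Real.pi * q.lamST) * ∑ t : LinkType,
        ∫⁻ z in Ioc 0 (σ ^ (1 / q.α t)), N.K t z * ENNReal.ofReal z := by
  have hξ := q.xi_pos
  have hG := q.antS.main_pos
  set a := τ * σ / (q.xi * q.antS.main) with ha
  have ha0 : 0 < a := by positivity
  set F : ℝ → ℝ → ℝ → ℝ≥0∞ := fun s h θ => 1 - expNeg ((if s < σ then ∞ else 0) +
    ENNReal.ofReal a * ENNReal.ofReal (q.xi * s⁻¹ * q.antS.gain θ * h)) with hF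
  have hFm : Measurable fun y : ℝ × ℝ × ℝ => F y.1 y.2.1 y.2.2 := by
    have h1 : Measurable fun y : ℝ × ℝ × ℝ => q.antS.gain y.2.2 :=
      q.antS.measurable_gain.comp (measurable_snd.comp measurable_snd)
    have h2 : Measurable fun y : ℝ × ℝ × ℝ => if y.1 < σ then ∞ else (0 : ℝ≥0∞) :=
      Measurable.ite (measurableSet_lt measurable_fst measurable_const) measurable_const measurable_const
    simp only [hF]
    fun_prop
  have e1 : ∀ w, 1 - expNeg (q.exponentS τ σ w) = F (q.levelS w) w.2.2.1 w.2.2.2.1 := fun w => by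
    rw [NetParams.exponentS, q.interfTermS_eq]
  simp_rw [e1]
  rw [N.lintegral_intensityS hFm]
  -- A point below σ has infinite exponent and contributes 1 - e^{-∞} = 1, independently of its
  -- fading and gain.
  have hlow : ∀ s, s < σ → ∫⁻ h, ∫⁻ θ, F s h θ ∂angleLaw ∂fadingLaw = 1 := fun s hs => by
    simp [hF, hs]
  have hhigh : ∀ s, 0 < s → σ ≤ s → ∫⁻ h, ∫⁻ θ, F s h θ ∂angleLaw ∂fadingLaw =
      ∑ k : Fin 2, ENNReal.ofReal (q.antS.weight k) *
        (1 + (ENNReal.ofReal (τ * σ * q.antS.lobe k / q.antS.main))⁻¹ * ENNReal.ofReal s)⁻¹ := by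
    intro s hs0 hs
    -- The threshold ξ in the transmit power cancels the ξ in the coefficient a.
    have hc : 0 ≤ τ * σ / q.antS.main * s⁻¹ := by positivity
    have e : ∀ k : Fin 2, (1 + (ENNReal.ofReal (τ * σ * q.antS.lobe k / q.antS.main))⁻¹ * ENNReal.ofReal s)⁻¹
        = 1 - (1 + ENNReal.ofReal (τ * σ / q.antS.main * s⁻¹ * q.antS.lobe k))⁻¹ := fun k => by
      have hl := q.antS.lobe_nonneg k
      rw [← one_sub_inv_one_add (by positivity) hs0]
      congr 4
      ring
    simp_rw [e]
    rw [← q.antS.lintegral_fading_gain hc]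
    refine lintegral_congr fun h => lintegral_congr fun θ => ?_
    simp only [hF, if_neg hs.not_gt, zero_add]
    rw [← ENNReal.ofReal_mul ha0.le]
    congr 3
    rw [ha]
    field_simp
  have hsplit : ∀ t, ∫⁻ u in Ioi (0 : ℝ), N.K t u * (∫⁻ h, ∫⁻ θ, F (u ^ q.α t) h θ ∂angleLaw ∂fadingLaw) *
        ENNReal.ofReal u =
      (∫⁻ z in Ioc 0 (σ ^ (1 / q.α t)), N.K t z * ENNReal.ofReal z) +
      ∫⁻ u in Ioi (σ ^ (1 / q.α t)), N.K t u * (∑ k : Fin 2, ENNReal.ofReal (q.antS.weight k) *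
        (1 + (ENNReal.ofReal (τ * σ * q.antS.lobe k / q.antS.main))⁻¹ * ENNReal.ofReal (u ^ q.α t))⁻¹) *
          ENNReal.ofReal u := by
    intro t
    have hα := q.α_pos t
    have hm0 : 0 ≤ σ ^ (1 / q.α t) := by positivity
    have hpow : (σ ^ (1 / q.α t)) ^ q.α t = σ := by
      rw [← Real.rpow_mul hσ.le, one_div_mul_cancel hα.ne', Real.rpow_one]
    rw [← Ioc_union_Ioi_eq_Ioi hm0, lintegral_union measurableSet_Ioi
      (Set.disjoint_left.2 fun u hu hu' => hu.2.not_gt hu')]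
    congr 1
    · refine lintegral_congr_ae ?_
      -- At the right endpoint the level equals σ and is not excluded; this point is null.
      have hne : ∀ᵐ u ∂(volume : Measure ℝ).restrict (Ioc 0 (σ ^ (1 / q.α t))), u ≠ σ ^ (1 / q.α t) :=
        ae_restrict_of_ae (Measure.ae_ne volume _)
      filter_upwards [hne, ae_restrict_mem measurableSet_Ioc] with u hu hu'
      rw [hlow, mul_one]
      rw [← hpow]
      exact Real.rpow_lt_rpow hu'.1.le (lt_of_le_of_ne hu'.2 hu) hα
    · refine setLIntegral_congr_fun measurableSet_Ioi fun u hu => ?_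
      have hu' : σ ^ (1 / q.α t) < u := hu
      have hu0 : 0 < u := hm0.trans_lt hu'
      rw [hhigh _ (by positivity)]
      rw [← hpow]
      exact Real.rpow_le_rpow hm0 hu'.le hα.le
  simp_rw [hsplit]
  rw [Finset.sum_add_distrib, mul_add, add_comm]
  congr 1
  rw [q.antS.sum_lintegral_mixture _ (fun t => Ioi (σ ^ (1 / q.α t))) N.measurable_K
    (by intro k t; fun_prop), Finset.mul_sum]
  refine Finset.sum_congr rfl fun k _ => ?_
  simp only [FS, div_eq_mul_inv]
  rw [mul_comm (2 * Real.pi), ENNReal.ofReal_mul q.lamST_pos.le]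
  ring

/-- Law of the marked secondary BSs. -/
noncomputable def lawS : Measure (ℕ → SPoint) :=
  P.map fun ω i => (N.bsS i ω, N.blockS i ω, N.fadS i ω, N.angS i ω, N.R i ω, N.T i ω)

/-- Law of the marked primary BSs. -/
noncomputable def lawP : Measure (ℕ → Plane × ℝ × ℝ × ℝ) :=
  P.map fun ω i => (N.bsP i ω, N.blockP i ω, N.fadP i ω, N.angP i ω)

omit [IsProbabilityMeasure P] in
lemma aemeasurable_secondary : AEMeasurable
    (fun ω i => (N.bsS i ω, N.blockS i ω, N.fadS i ω, N.angS i ω, N.R i ω, N.T i ω)) P :=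
  N.secondary_law.aemeasurable

omit [IsProbabilityMeasure P] in
lemma aemeasurable_primary : AEMeasurable
    (fun ω i => (N.bsP i ω, N.blockP i ω, N.fadP i ω, N.angP i ω)) P :=
  N.primary_law.aemeasurable

instance : IsProbabilityMeasure N.lawS := Measure.isProbabilityMeasure_map N.aemeasurable_secondary

instance : IsProbabilityMeasure N.lawP := Measure.isProbabilityMeasure_map N.aemeasurable_primary

lemma lawS_eq : N.lawS = markedLaw (P.map fun ω i => N.bsS i ω) N.markLawS :=
  N.secondary_law.map_eq

lemma poissonLaplace_lawS : PoissonLaplace N.lawS N.intensityS :=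
  IsMarkedPPP.poissonLaplace (κ := N.markLawS) N.secondary_law

lemma map_networks : P.map (fun ω =>
      ((fun i => (N.bsS i ω, N.blockS i ω, N.fadS i ω, N.angS i ω, N.R i ω, N.T i ω) : ℕ → SPoint),
      (fun i => (N.bsP i ω, N.blockP i ω, N.fadP i ω, N.angP i ω) : ℕ → Plane × ℝ × ℝ × ℝ))) =
    N.lawS.prod N.lawP :=
  (indepFun_iff_map_prod_eq_prod_map_map N.aemeasurable_secondary N.aemeasurable_primary).1
    N.networks_indep

lemma ae_level_pos : ∀ᵐ z ∂N.lawS, ∀ i, 0 < q.levelS (z i) := by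
  filter_upwards [N.poissonLaplace_lawS.ae_notMem
    (measurableSet_le q.measurable_levelS measurable_const) N.intensityS_level_nonpos] with z hz i
  exact not_le.1 (hz i)

lemma ae_level_ne : ∀ᵐ z ∂N.lawS, ∀ i j, i ≠ j → q.levelS (z i) ≠ q.levelS (z j) :=
  N.poissonLaplace_lawS.ae_ne q.measurable_levelS N.intensityS_level_le_ne_top N.intensityS_level_eq

lemma ae_exists_min_level : ∀ᵐ z ∂N.lawS, ∃ i, ∀ j, q.levelS (z i) ≤ q.levelS (z j) := by
  filter_upwards [N.poissonLaplace_lawS.ae_finite q.measurable_levelS N.intensityS_level_le_ne_top]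
    with z hz
  obtain ⟨n, hn⟩ := exists_nat_ge (q.levelS (z 0))
  obtain ⟨i, hi, hmin⟩ := Set.exists_min_image _ (fun i => q.levelS (z i)) (hz n) ⟨0, hn⟩
  refine ⟨i, fun j => ?_⟩
  by_cases hj : q.levelS (z j) ≤ n
  · exact hmin j hj
  · exact le_trans hi (not_le.1 hj).le

/-- Integrals over the secondary network only depend on the averages over the fading of one BS. -/
lemma lintegral_congr_fading (i : ℕ) {F G : (ℕ → SPoint) → ℝ≥0∞} (hF : Measurable F) (hG : Measurable G)
    (h : ∀ (z : ℕ → SPoint) (b : ℝ) (r : ℝ × ℝ × LinkType),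
      ∫⁻ x, F (Function.update z i ((z i).1, b, x, r)) ∂fadingLaw =
        ∫⁻ x, G (Function.update z i ((z i).1, b, x, r)) ∂fadingLaw) :
    ∫⁻ z, F z ∂N.lawS = ∫⁻ z, G z ∂N.lawS := by
  have : IsProbabilityMeasure (P.map fun ω i => N.bsS i ω) := Measure.isProbabilityMeasure_map
    (measurable_pi_lambda _ N.secondary_law.ppp.measurable).aemeasurable
  have key : ∀ {H : (ℕ → SPoint) → ℝ≥0∞}, Measurable H → ∀ z : ℕ → SPoint,
      ∫⁻ m, H (Function.update z i ((z i).1, m)) ∂N.markLawS =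
      ∫⁻ b, ∫⁻ r, ∫⁻ x, H (Function.update z i ((z i).1, b, x, r)) ∂fadingLaw
        ∂(angleLaw.prod N.homeLaw) ∂unitLaw := by
    intro H hH z
    have hm : Measurable fun m : ℝ × ℝ × ℝ × ℝ × LinkType => H (Function.update z i ((z i).1, m)) :=
      hH.comp ((measurable_update z).comp measurable_prodMk_left)
    rw [markLawS, lintegral_prod _ hm.aemeasurable]
    refine lintegral_congr fun b => ?_
    exact lintegral_prod_symm _ (hm.comp measurable_prodMk_left).aemeasurable
  rw [N.lawS_eq, lintegral_markedLaw_resample i hF, lintegral_markedLaw_resample i hG]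
  refine lintegral_congr fun z => ?_
  rw [key hF, key hG]
  simp_rw [h]

end Network

/-! ### Coverage events and the coverage formula -/

namespace Network

variable {q : NetParams} {Ω : Type*} [MeasurableSpace Ω] {P : Measure Ω} (N : Network q P)

/-- BS `i` has the smallest level of the configuration. -/
def IsMinLevel (q : NetParams) (i : ℕ) (z : ℕ → SPoint) : Prop :=
  ∀ j, j ≠ i → q.levelS (z i) ≤ q.levelS (z j)

lemma measurableSet_isMinLevel (i : ℕ) : MeasurableSet {z | IsMinLevel q i z} := by
  simp only [IsMinLevel, Set.ofPred_forall]
  exact MeasurableSet.iInter fun j => MeasurableSet.iInter fun _ =>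
    measurableSet_le (q.measurable_levelS.comp (measurable_pi_apply i))
      (q.measurable_levelS.comp (measurable_pi_apply j))

/-- Noise plus interference when BS `i` is the tagged BS. -/
noncomputable def disturbance (q : NetParams) (i : ℕ) (z : ℕ → SPoint)
    (y : ℕ → Plane × ℝ × ℝ × ℝ) : ℝ≥0∞ :=
  ENNReal.ofReal q.noise + ∑' j, q.interfTermP (y j) + sumOthers i fun j => q.interfTermS (z j)

variable {X : Type*} [MeasurableSpace X] {f : X → ℕ → SPoint} {g : X → ℕ → Plane × ℝ × ℝ × ℝ}

lemma measurable_disturbance (i : ℕ) (hf : Measurable f) (hg : Measurable g) :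
    Measurable fun x => disturbance q i (f x) (g x) := by
  have h1 : Measurable fun x => ∑' j, q.interfTermP (g x j) :=
    Measurable.tsum fun j => q.measurable_interfTermP.comp ((measurable_pi_apply j).comp hg)
  have h2 : Measurable fun x => sumOthers i fun j => q.interfTermS (f x j) :=
    measurable_sumOthers i fun j => q.measurable_interfTermS.comp ((measurable_pi_apply j).comp hf)
  exact (measurable_const.add h1).add h2

/-- Configurations in which BS `i` has the smallest level and covers the user. -/
def coverSet (q : NetParams) (τ : ℝ) (i : ℕ) : Set ((ℕ → SPoint) × (ℕ → Plane × ℝ × ℝ × ℝ)) :=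
  {p | IsMinLevel q i p.1 ∧
    ENNReal.ofReal (τ * q.levelS (p.1 i) / (q.xi * q.antS.main)) * disturbance q i p.1 p.2 <
      ENNReal.ofReal (p.1 i).2.2.1}

lemma measurable_levelS_apply (i : ℕ) : Measurable fun z : ℕ → SPoint => q.levelS (z i) :=
  q.measurable_levelS.comp (measurable_pi_apply i)

lemma measurable_threshold (τ : ℝ) (i : ℕ) (hf : Measurable f) (hg : Measurable g) :
    Measurable fun x => ENNReal.ofReal (τ * q.levelS (f x i) / (q.xi * q.antS.main)) *
      disturbance q i (f x) (g x) := by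
  have h1 : Measurable fun x => q.levelS (f x i) := (measurable_levelS_apply i).comp hf
  exact ((h1.const_mul τ).div_const _).ennreal_ofReal.mul (measurable_disturbance i hf hg)

lemma measurableSet_coverSet (τ : ℝ) (i : ℕ) : MeasurableSet (coverSet q τ i) := by
  refine (measurable_fst (measurableSet_isMinLevel i)).inter (measurableSet_lt
    (measurable_threshold τ i measurable_fst measurable_snd) ?_)
  exact (measurable_fst.comp (measurable_snd.comp (measurable_snd.comp
    ((measurable_pi_apply i).comp measurable_fst)))).ennreal_ofReal

/-- The secondary network with its marks. -/
def secondary (ω : Ω) (i : ℕ) : SPoint :=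
  (N.bsS i ω, N.blockS i ω, N.fadS i ω, N.angS i ω, N.R i ω, N.T i ω)

/-- The primary network with its marks. -/
def primary (ω : Ω) (i : ℕ) : Plane × ℝ × ℝ × ℝ :=
  (N.bsP i ω, N.blockP i ω, N.fadP i ω, N.angP i ω)

lemma avgPowerS_eq (i : ℕ) (ω : Ω) : N.avgPowerS i ω = q.xi * (q.levelS (N.secondary ω i))⁻¹ := by
  rw [NetParams.levelS, ← q.mul_pathLoss_eq, ← mul_assoc]
  rfl

lemma isTagged_iff {i : ℕ} {ω : Ω} (h : ∀ j, 0 < q.levelS (N.secondary ω j)) :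
    N.IsTagged i ω ↔ ∀ j, q.levelS (N.secondary ω i) ≤ q.levelS (N.secondary ω j) := by
  unfold IsTagged
  refine forall_congr' fun j => ?_
  rw [avgPowerS_eq, avgPowerS_eq, mul_le_mul_iff_right₀ q.xi_pos, inv_le_inv₀ (h j) (h i)]

/-- The inequality SINR > τ is solved for the fading. With τ > 0 and a finite signal this remains
valid when the disturbance is 0 or ∞. -/
lemma mem_coverSet_iff {τ : ℝ} {i : ℕ} {ω : Ω} (hτ : 0 < τ) (h : ∀ j, 0 < q.levelS (N.secondary ω j)) :
    (N.secondary ω, N.primary ω) ∈ coverSet q τ i ↔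
      N.IsTagged i ω ∧ ENNReal.ofReal τ < N.sinr i ω := by
  rw [N.isTagged_iff h]
  refine and_congr ⟨fun h' j => ?_, fun h' j _ => h' j⟩ ?_
  · by_cases hj : j = i
    · rw [hj]
    · exact h' j hj
  · set L := q.levelS (N.secondary ω i) with hL
    have hLi : 0 < L := h i
    have hξ := q.xi_pos
    have hG := q.antS.main_pos
    have hsig : N.powerS i ω * q.antS.main * N.fadS i ω * q.pathLoss (N.typeS i ω) ‖N.bsS i ω‖ =
        q.xi * q.antS.main * L⁻¹ * N.fadS i ω := by
      have := N.avgPowerS_eq i ω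
      rw [avgPowerS] at this
      calc _ = (N.powerS i ω * q.pathLoss (N.typeS i ω) ‖N.bsS i ω‖) * q.antS.main * N.fadS i ω := by ring
        _ = _ := by rw [this]; ring
    have hdist : ENNReal.ofReal q.noise + N.interfP ω + N.interfS i ω =
        disturbance q i (N.secondary ω) (N.primary ω) := rfl
    have hκ : 0 < q.xi * q.antS.main * L⁻¹ := by positivity
    rw [sinr, hsig, hdist, ENNReal.lt_div_iff_mul_lt (Or.inr ENNReal.ofReal_ne_top) (Or.inr (by simpa using hτ)),
      ENNReal.ofReal_mul hκ.le]
    have e : ENNReal.ofReal τ = ENNReal.ofReal (q.xi * q.antS.main * L⁻¹) *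
        ENNReal.ofReal (τ * L / (q.xi * q.antS.main)) := by
      rw [← ENNReal.ofReal_mul hκ.le]
      congr 1
      field_simp
    rw [e, mul_assoc, ENNReal.mul_lt_mul_iff_right (ENNReal.ofReal_pos.2 hκ).ne' ENNReal.ofReal_ne_top]
    rfl

variable [IsProbabilityMeasure P]

omit [IsProbabilityMeasure P] in
lemma ae_secondary {p : (ℕ → SPoint) → Prop} (h : ∀ᵐ z ∂N.lawS, p z) : ∀ᵐ ω ∂P, p (N.secondary ω) :=
  ae_of_ae_map N.aemeasurable_secondary h

/-- Almost surely the tagged BS exists and is unique. -/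
theorem ae_existsUnique_tagged : ∀ᵐ ω ∂P, ∃! i : ℕ, N.IsTagged i ω := by
  filter_upwards [N.ae_secondary N.ae_level_pos, N.ae_secondary N.ae_level_ne,
    N.ae_secondary N.ae_exists_min_level] with ω hpos hne ⟨i, hi⟩
  refine ⟨i, (N.isTagged_iff hpos).2 hi, fun j hj => ?_⟩
  by_contra h
  exact hne j i h (le_antisymm ((N.isTagged_iff hpos).1 hj i) (hi j))

/-- Levels are almost surely distinct, so at most one BS has the smallest one. The cover sets are
thus disjoint up to null sets and their probabilities add up. -/
lemma coverage_eq_tsum {τ : ℝ} (hτ : 0 < τ) :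
    N.coverage τ = ∑' i, (N.lawS.prod N.lawP) (coverSet q τ i) := by
  have hZ : AEMeasurable (fun ω => (N.secondary ω, N.primary ω)) P :=
    N.aemeasurable_secondary.prodMk N.aemeasurable_primary
  have hmap : P.map (fun ω => (N.secondary ω, N.primary ω)) = N.lawS.prod N.lawP := N.map_networks
  have h1 : N.coverage τ = (N.lawS.prod N.lawP) (⋃ i, coverSet q τ i) := by
    rw [← hmap, Measure.map_apply_of_aemeasurable hZ (MeasurableSet.iUnion fun i => measurableSet_coverSet τ i),
      coverage]
    -- The two events agree only where all levels are positive, which is almost everywhere.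
    refine measure_congr ?_
    filter_upwards [N.ae_secondary N.ae_level_pos] with ω hpos
    refine propext ?_
    change (∃ i, N.IsTagged i ω ∧ ENNReal.ofReal τ < N.sinr i ω) ↔
      (N.secondary ω, N.primary ω) ∈ ⋃ i, coverSet q τ i
    simp_rw [mem_iUnion, N.mem_coverSet_iff hτ hpos]
  rw [h1]
  refine measure_iUnion₀ (fun i j hij => ?_) fun i => (measurableSet_coverSet τ i).nullMeasurableSet
  have hae : ∀ᵐ p ∂(N.lawS.prod N.lawP), ∀ i j, i ≠ j → q.levelS (p.1 i) ≠ q.levelS (p.1 j) :=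
    Measure.quasiMeasurePreserving_fst.ae N.ae_level_ne
  refine measure_mono_null (fun p hp => ?_) hae
  intro hne
  exact hne i j hij (le_antisymm (hp.1.1 j hij.symm) (hp.2.1 i hij))

/-- The fading of BS `i` is exponential given everything else. -/
lemma lawS_lt_fading (i : ℕ) {A : Set (ℕ → SPoint)} (hA : MeasurableSet A) {f : (ℕ → SPoint) → ℝ≥0∞}
    (hf : Measurable f)
    (hA' : ∀ (z : ℕ → SPoint) (b : ℝ) (r : ℝ × ℝ × LinkType) (x : ℝ),
      Function.update z i ((z i).1, b, x, r) ∈ A ↔ Function.update z i ((z i).1, b, 0, r) ∈ A)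
    (hf' : ∀ (z : ℕ → SPoint) (b : ℝ) (r : ℝ × ℝ × LinkType) (x : ℝ),
      f (Function.update z i ((z i).1, b, x, r)) = f (Function.update z i ((z i).1, b, 0, r))) :
    N.lawS {z | z ∈ A ∧ f z < ENNReal.ofReal (z i).2.2.1} =
      ∫⁻ z, A.indicator (fun z => expNeg (f z)) z ∂N.lawS := by
  have hfad : Measurable fun z : ℕ → SPoint => ENNReal.ofReal (z i).2.2.1 :=
    (measurable_fst.comp (measurable_snd.comp (measurable_snd.comp (measurable_pi_apply i)))).ennreal_ofReal
  have hC : MeasurableSet {z | z ∈ A ∧ f z < ENNReal.ofReal (z i).2.2.1} :=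
    hA.inter (measurableSet_lt hf hfad)
  rw [← lintegral_indicator_one hC]
  refine N.lintegral_congr_fading i (measurable_one.indicator hC) (hf.expNeg.indicator hA) fun z b r => ?_
  by_cases h : Function.update z i ((z i).1, b, 0, r) ∈ A
  · obtain ⟨a, ha⟩ : ∃ a, a = f (Function.update z i ((z i).1, b, 0, r)) := ⟨_, rfl⟩
    have e1 : ∀ x, {z | z ∈ A ∧ f z < ENNReal.ofReal (z i).2.2.1}.indicator (1 : (ℕ → SPoint) → ℝ≥0∞)
        (Function.update z i ((z i).1, b, x, r)) = {x | a < ENNReal.ofReal x}.indicator 1 x := fun x => by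
      have hx : Function.update z i ((z i).1, b, x, r) ∈ {z | z ∈ A ∧ f z < ENNReal.ofReal (z i).2.2.1} ↔
          x ∈ {x | a < ENNReal.ofReal x} := by
        rw [mem_ofPred_eq, hA', hf', ← ha, Function.update_self, mem_ofPred_eq, and_iff_right h]
      by_cases h' : x ∈ {x | a < ENNReal.ofReal x}
      · rw [indicator_of_mem h', indicator_of_mem (hx.2 h'), Pi.one_apply, Pi.one_apply]
      · rw [indicator_of_notMem h', indicator_of_notMem (mt hx.1 h')]
    have e2 : ∀ x, A.indicator (fun z => expNeg (f z)) (Function.update z i ((z i).1, b, x, r)) =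
        expNeg a := fun x => by
      rw [indicator_of_mem ((hA' z b r x).2 h), hf', ha]
    rw [lintegral_congr e1, lintegral_congr e2,
      lintegral_indicator_one (measurableSet_lt measurable_const ENNReal.measurable_ofReal), fadingLaw_tail]
    simp
  · refine lintegral_congr fun x => ?_
    rw [indicator_of_notMem fun h' => h ((hA' z b r x).1 h'),
      indicator_of_notMem fun h' => h ((hA' z b r x).1 h'.1)]

omit [IsProbabilityMeasure P] in
lemma levelS_update_fading (z : ℕ → SPoint) (i j : ℕ) (b : ℝ) (r : ℝ × ℝ × LinkType) (x : ℝ) :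
    q.levelS (Function.update z i ((z i).1, b, x, r) j) =
      q.levelS (Function.update z i ((z i).1, b, 0, r) j) := by
  by_cases hj : j = i
  · subst hj
    simp only [Function.update_self, NetParams.levelS]
  · simp only [Function.update_of_ne hj]

lemma disturbance_update (z : ℕ → SPoint) (y : ℕ → Plane × ℝ × ℝ × ℝ) (i : ℕ) (w w' : SPoint) :
    disturbance q i (Function.update z i w) y = disturbance q i (Function.update z i w') y := by
  unfold disturbance sumOthers
  congr 1
  refine tsum_congr fun j => ?_
  by_cases hj : j = i
  · simp [hj]
  · simp only [hj, if_false, Function.update_of_ne hj]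

/-- The exclusion of stronger BSs becomes part of the exponential of a single sum over the other
points, the form that Mecke's formula requires. -/
lemma expNeg_sumOthers_exponentS (τ : ℝ) (i : ℕ) (z : ℕ → SPoint) :
    expNeg (sumOthers i fun j => q.exponentS τ (q.levelS (z i)) (z j)) =
      {z | IsMinLevel q i z}.indicator (fun z => expNeg
        (ENNReal.ofReal (τ * q.levelS (z i) / (q.xi * q.antS.main)) *
          sumOthers i fun j => q.interfTermS (z j))) z := by
  classical
  have e : sumOthers i (fun j => q.exponentS τ (q.levelS (z i)) (z j)) =
      sumOthers i (fun j => if q.levelS (z j) < q.levelS (z i) then ∞ else 0) +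
        ENNReal.ofReal (τ * q.levelS (z i) / (q.xi * q.antS.main)) *
          sumOthers i fun j => q.interfTermS (z j) := by
    rw [← mul_sumOthers, ← sumOthers_add]
    rfl
  rw [e, expNeg_add, expNeg_sumOthers_ite]
  by_cases h : IsMinLevel q i z
  · rw [indicator_of_mem (s := {z | IsMinLevel q i z}) h, indicator_of_mem, Pi.one_apply, one_mul]
    exact fun j hj => (h j hj).not_gt
  · rw [indicator_of_notMem (s := {z | IsMinLevel q i z}) h, indicator_of_notMem, zero_mul]
    exact fun h' => h fun j hj => not_lt.1 (h' j hj)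

/-- Conditional probability of coverage by BS `i`, averaged over its fading. -/
lemma lawS_coverSet (τ : ℝ) (i : ℕ) (y : ℕ → Plane × ℝ × ℝ × ℝ) :
    N.lawS {z | (z, y) ∈ coverSet q τ i} =
      ∫⁻ z, expNeg (ENNReal.ofReal (τ * q.levelS (z i) / (q.xi * q.antS.main)) *
          (ENNReal.ofReal q.noise + ∑' j, q.interfTermP (y j))) *
        expNeg (sumOthers i fun j => q.exponentS τ (q.levelS (z i)) (z j)) ∂N.lawS := by
  have hthr : Measurable fun z : ℕ → SPoint =>
      ENNReal.ofReal (τ * q.levelS (z i) / (q.xi * q.antS.main)) * disturbance q i z y :=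
    measurable_threshold τ i measurable_id measurable_const
  refine (N.lawS_lt_fading i (measurableSet_isMinLevel i) hthr (fun z b r x => ?_) fun z b r x => ?_).trans
    (lintegral_congr fun z => ?_)
  · simp only [mem_ofPred_eq, IsMinLevel, levelS_update_fading z i _ b r x]
  · simp only [levelS_update_fading z i _ b r x]
    rw [disturbance_update]
  · rw [expNeg_sumOthers_exponentS]
    by_cases h : IsMinLevel q i z
    · rw [indicator_of_mem (s := {z | IsMinLevel q i z}) h, indicator_of_mem (s := {z | IsMinLevel q i z}) h,
        ← expNeg_add, ← mul_add, disturbance]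
    · rw [indicator_of_notMem (s := {z | IsMinLevel q i z}) h,
        indicator_of_notMem (s := {z | IsMinLevel q i z}) h, mul_zero]

/-- Laplace transform of noise and primary interference at the threshold of a BS of level `σ`. -/
noncomputable def backgroundFactor (τ σ : ℝ) : ℝ≥0∞ :=
  ∫⁻ y, expNeg (ENNReal.ofReal (τ * σ / (q.xi * q.antS.main)) *
    (ENNReal.ofReal q.noise + ∑' j, q.interfTermP (y j))) ∂N.lawP

lemma measurable_background {X : Type*} [MeasurableSpace X] (τ : ℝ) {f : X → ℝ} (hf : Measurable f)
    {g : X → ℕ → Plane × ℝ × ℝ × ℝ} (hg : Measurable g) :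
    Measurable fun x => expNeg (ENNReal.ofReal (τ * f x / (q.xi * q.antS.main)) *
      (ENNReal.ofReal q.noise + ∑' j, q.interfTermP (g x j))) := by
  have h : Measurable fun x => ∑' j, q.interfTermP (g x j) :=
    Measurable.tsum fun j => q.measurable_interfTermP.comp ((measurable_pi_apply j).comp hg)
  exact (((hf.const_mul τ).div_const _).ennreal_ofReal.mul (h.const_add _)).expNeg

lemma measurable_backgroundFactor (τ : ℝ) : Measurable (N.backgroundFactor τ) :=
  (measurable_background τ measurable_fst measurable_snd).lintegral_prod_right'

lemma backgroundFactor_le_one (τ σ : ℝ) : N.backgroundFactor τ σ ≤ 1 := by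
  calc N.backgroundFactor τ σ ≤ ∫⁻ y, 1 ∂N.lawP := lintegral_mono fun y => expNeg_le_one _
    _ = 1 := by simp

lemma backgroundFactor_eq {τ σ : ℝ} (hτ : 0 < τ) (hσ : 0 < σ) : N.backgroundFactor τ σ =
    expNeg (ENNReal.ofReal (τ * σ / (q.xi * q.antS.main) * q.noise)) *
      expNeg (ENNReal.ofReal q.lamPT * ∑ k : Fin 2, ENNReal.ofReal (q.antP.weight k) *
        q.FP (τ * σ * q.antP.lobe k / (q.xi * q.antS.main))) := by
  have hξ := q.xi_pos
  have hG := q.antS.main_pos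
  have ha : 0 ≤ τ * σ / (q.xi * q.antS.main) := by positivity
  unfold backgroundFactor
  simp_rw [mul_add, expNeg_add]
  rw [lintegral_const_mul' _ _ (expNeg_ne_top _), ← ENNReal.ofReal_mul ha]
  congr 1
  refine (N.laplace_interfP ha).trans ?_
  simp_rw [div_mul_eq_mul_div]

/-- The coverage probability as an integral over the level of the tagged BS. -/
lemma coverage_eq_lintegral {τ : ℝ} (hτ : 0 < τ) :
    N.coverage τ = ∫⁻ w, N.backgroundFactor τ (q.levelS w) *
      expNeg (∫⁻ w', (1 - expNeg (q.exponentS τ (q.levelS w) w')) ∂N.intensityS) ∂N.intensityS := by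
  have hex : ∀ i, Measurable fun z : ℕ → SPoint =>
      expNeg (sumOthers i fun j => q.exponentS τ (q.levelS (z i)) (z j)) := fun i => by
    have h : ∀ j, Measurable fun z : ℕ → SPoint =>
        Function.uncurry (q.exponentS τ) (q.levelS (z i), z j) := fun j =>
      (q.measurable_exponentS τ).comp ((measurable_levelS_apply i).prodMk (measurable_pi_apply j))
    exact Measurable.expNeg (measurable_sumOthers i h)
  have h1 : ∀ i, (N.lawS.prod N.lawP) (coverSet q τ i) =
      ∫⁻ z, N.backgroundFactor τ (q.levelS (z i)) *
        expNeg (sumOthers i fun j => q.exponentS τ (q.levelS (z i)) (z j)) ∂N.lawS := by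
    intro i
    have hb : Measurable fun p : (ℕ → Plane × ℝ × ℝ × ℝ) × (ℕ → SPoint) =>
        expNeg (ENNReal.ofReal (τ * q.levelS (p.2 i) / (q.xi * q.antS.main)) *
          (ENNReal.ofReal q.noise + ∑' j, q.interfTermP (p.1 j))) :=
      measurable_background τ ((measurable_levelS_apply i).comp measurable_snd) measurable_fst
    -- The primary network is frozen while the fading of BS i is averaged out. Exchanging the
    -- integrals then collects the primary interference into `backgroundFactor`.
    rw [Measure.prod_apply_symm (measurableSet_coverSet τ i)]
    refine (lintegral_congr fun y => N.lawS_coverSet τ i y).trans ?_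
    rw [lintegral_lintegral_swap (hb.mul ((hex i).comp measurable_snd)).aemeasurable]
    refine lintegral_congr fun z => ?_
    rw [lintegral_mul_const' _ _ (expNeg_ne_top _)]
    rfl
  rw [N.coverage_eq_tsum hτ]
  simp_rw [h1]
  have h2 : ∀ i, AEMeasurable (fun z : ℕ → SPoint => N.backgroundFactor τ (q.levelS (z i)) *
      expNeg (sumOthers i fun j => q.exponentS τ (q.levelS (z i)) (z j))) N.lawS := fun i =>
    (((N.measurable_backgroundFactor τ).comp (measurable_levelS_apply i)).mul (hex i)).aemeasurable
  rw [← lintegral_tsum h2]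
  -- The dependence on the distinguished BS is only through its level: the background factor plays
  -- the role of f ≤ 1, and the exponent that of v.
  exact N.poissonLaplace_lawS.mecke q.measurable_levelS
    ((N.measurable_backgroundFactor τ).comp q.measurable_levelS) (q.measurable_exponentS τ)
    (fun w σ h => q.exponentS_ne_top τ w h) (q.exponentS_mono hτ.le) (q.exponentS_left_cont τ)
    (fun w => N.backgroundFactor_le_one τ _) N.intensityS_level_le_ne_top

end Network

theorem theorem1 (q : NetParams) {Ω : Type*} [MeasurableSpace Ω] (P : Measure Ω)
    [IsProbabilityMeasure P] (N : Network q P) (τ : ℝ) (hτ : 0 < τ) :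
    (∀ᵐ ω ∂P, ∃! i : ℕ, N.IsTagged i ω) ∧
    N.coverage τ =
      ∑ t₀ : LinkType, ∫⁻ u in Ioi (0 : ℝ),
        ENNReal.ofReal (2 * Real.pi * q.lamST) *
        expNeg
          (ENNReal.ofReal q.lamPT * ∑ k : Fin 2, ENNReal.ofReal (q.antP.weight k) *
              q.FP (τ * u ^ q.α t₀ * q.antP.lobe k / (q.xi * q.antS.main))
            + ENNReal.ofReal q.lamST * ∑ k : Fin 2, ENNReal.ofReal (q.antS.weight k) *
              N.FS (τ * u ^ q.α t₀ * q.antS.lobe k / q.antS.main) (u ^ q.α t₀)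
            + ENNReal.ofReal (τ * u ^ q.α t₀ / (q.xi * q.antS.main) * q.noise)
            + ENNReal.ofReal (2 * Real.pi * q.lamST) *
              (∫⁻ z in Ioc 0 (u ^ (q.α t₀ / q.α LinkType.LOS)),
                N.K LinkType.LOS z * ENNReal.ofReal z)
            + ENNReal.ofReal (2 * Real.pi * q.lamST) *
              (∫⁻ z in Ioc 0 (u ^ (q.α t₀ / q.α LinkType.NLOS)),
                N.K LinkType.NLOS z * ENNReal.ofReal z)) *
        N.K t₀ u * ENNReal.ofReal u := by
  refine ⟨N.ae_existsUnique_tagged, ?_⟩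
  have hI : Measurable fun σ => ∫⁻ w, (1 - expNeg (q.exponentS τ σ w)) ∂N.intensityS :=
    ((q.measurable_exponentS τ).expNeg.const_sub 1).lintegral_prod_right'
  -- The integrand depends on the tagged BS only through its level, so the integral becomes one over
  -- u and the link type, with level u^{α_{t₀}}.
  rw [N.coverage_eq_lintegral hτ, N.lintegral_intensityS_level (f := fun σ => N.backgroundFactor τ σ *
    expNeg (∫⁻ w, (1 - expNeg (q.exponentS τ σ w)) ∂N.intensityS))
    ((N.measurable_backgroundFactor τ).mul hI.expNeg), Finset.mul_sum]
  refine Finset.sum_congr rfl fun t _ => ?_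
  rw [← lintegral_const_mul' _ _ ENNReal.ofReal_ne_top]
  refine setLIntegral_congr_fun measurableSet_Ioi fun u hu => ?_
  have hu0 : (0 : ℝ) < u := hu
  have hσ : 0 < u ^ q.α t := Real.rpow_pos_of_pos hu0 _
  -- A BS of type s has level below u^{α_t} exactly when its own variable is below u^{α_t/α_s}, the
  -- upper limit of the K integrals.
  have hpow : ∀ s, (u ^ q.α t) ^ (1 / q.α s) = u ^ (q.α t / q.α s) := fun s => by
    rw [← Real.rpow_mul hu0.le, mul_one_div]
  rw [N.backgroundFactor_eq hτ hσ, N.lintegral_exponentS hτ hσ, LinkType.sum_univ, hpow, hpow]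
  simp only [mul_add, expNeg_add]
  ring
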